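/- **Model.** There are $n$ identical devices ($n$ is unknown) sharing one channel; time is divided into slots. In each slot every device transmits a message, listens (each costs one unit of energy), or is idle (free). If nobody transmits, listeners hear silence; if exactly one device transmits, they hear its message; if at least two transmit, they hear noise in the models Strong-CD and Receiver-CD, and silence in Sender-CD and No-CD. In Strong-CD and Sender-CD a transmitter receives the same signal as a listener; in Receiver-CD and No-CD it receives none. Devices have private independent random bits. In No-CD it is assumed that $n\ge 2$, otherwise $n\ge 1$. Time and energy are the maximum over the devices. All logarithms are to base 2, $\alpha$ is the inverse Ackermann function, $\log^\ast$ the iterated logarithm. **Algorithm.** Let $D=(d_1,d_2,\dots)$ be positive integers ("checkpoints") with $d_{i+1}\ge\gamma d_i$, $\sum_{k\ge d_1}1/\sqrt{2^k}\le 1$ and $\sqrt{2^{d_1}}\ge100$. Two kinds of subroutines are used. - *Trivial-Algorithm*$(N)$ takes time depending only on $N$; on $n$ devices, with probability at least $1-Cn^{-c}$, either all devices decide (correctly) that $n>N$, or they agree on an estimate $e$ with $n/2\le e\le 2n$. - *Test-Network-Size*$(x)$, for real $x\ge100$, takes time at most $C\log x$; run by $n\ge 0$ devices, with probability at least $1-C\max(n,x)^{-c}$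 each of them spends energy at most $C\alpha(\lceil x\rceil)$, at most one of them becomes a leader, exactly one does if $n/1.5\le x\le1.5n$, and none does if $x\ge1.9n$ or $x\le n/1.9$. *Estimate-Network-Size*$(D)$: (1) Each device chooses at most one label, the label $k\ge d_1$ with probability $1/\sqrt{2^k}$. (2) Run Trivial-Algorithm$(2^{d_1})$; terminate if it gives an estimate. (3) In Sender-CD and No-CD let $k_0=d_1$. In Strong-CD and Receiver-CD let $\mathrm{Test}(i)$ be the slot in which each device transmits with probability $2^{-d_i}$ and listens otherwise, the answer being "yes" if there is silence; run $\mathrm{Test}(i)$ for $i=1,2,4,\dots$ until the first "yes", at $i'$, then do a binary search with $\mathrm{Test}$ on $\{1,\dots,i'\}$, giving $\tilde\imath$, and let $k_0=d_{\max(1,\tilde\imath-2)}$. (4) For $k=k_0,k_0+1,\dots$: the devices with label $k$ run Test-Network-Size$(\sqrt{2^k})$; then, if $k$ is a checkpoint, all leaders with odd labels announce their labels while all others listen, and then the same for even labels; whenever exactly one message $\tilde k$ is sent, all devices terminate with the estimate $\tilde n=2^{\tilde k}$ (an announcing leader that receives no signal in its model takes for granted that it was the only one). For a given $n$ let $\hat\imath\ge1$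 be the index with $d_{\hat\imath-1}<\log n\le d_{\hat\imath}$ ($\hat\imath=1$ if $\log n\le d_1$). Let $s(x)=\log x$ in Strong-CD and Receiver-CD, and $s(x)=x$ in Sender-CD and No-CD. **Theorem.** For each of the four models there are constants $\gamma>1$, $C,c>0$, a function $K$ of $d_1$, and subroutines Trivial-Algorithm and Test-Network-Size with the properties above, such that the following hold. 1. For every $D$ as above and every $n$, with probability at least $1-Cn^{-c}$, Estimate-Network-Size$(D)$ makes all devices terminate and agree on an estimate $\tilde n$ with $n/2\le\tilde n\le2n$, in time at most $C d_{\hat\imath}^2+K(d_1)$ and with energy at most $C\,(s(\hat\imath)+\alpha(d_{\hat\imath}))+K(d_1)$. So the time is $O(d_{\hat\imath}^2)$; and unless $D$ grows so fast that $\alpha(d_i)\ne O(s(i))$, the energy is $O(\log\hat\imath)$ in Strong-CD and Receiver-CD, and $O(\hat\imath)$ in Sender-CD and No-CD. 2. The following choices of $D$ (each of which is possible with suitable $d_1$; for every admissible $D$ of this form and all sufficiently large $n$) give the same guarantee, with probability at least $1-Cn^{-c}$, within the following time and energy: - $d_{i}=\lceil 2^{2^{(\log d_{i-1})^{\varepsilon}}}\rceil$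 with $0<\varepsilon<1$: time at most $2^{2^{(\log\log n)^{\varepsilon'}}}=n^{o(1)}$ for each $\varepsilon'\in(\varepsilon,1)$, energy $O(s(\log^\ast n))$, with an absolute constant; - $d_i=\lceil d_{i-1}^{1+\varepsilon/2}\rceil$ with $0<\varepsilon\le B$: time $O((\log n)^{2+\varepsilon})$ and energy $O(s(\varepsilon^{-1}\log\log\log n))$, with constants depending only on $B$; - $d_i=\lceil g\,d_{i-1}\rceil$ with a constant $g\ge\gamma$: time $O((\log n)^2)$ and energy $O(s(\log\log n))$, with constants depending only on $g$. -/

import Mathlib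

open MeasureTheory Filter

noncomputable section

open scoped unitInterval

namespace RadioNetwork

/-! ## The radio network model -/

/-- The four collision-detection models. -/
inductive CDModel where
  | strongCD
  | senderCD
  | receiverCD
  | noCD

/-- Collisions are heard as noise (rather than as silence) in Strong-CD and Receiver-CD. -/
def CDModel.detectsNoise : CDModel → Bool
  | .strongCD => true
  | .senderCD => false
  | .receiverCD => true
  | .noCD => false

/-- Transmitters receive a signal in Strong-CD and Sender-CD, and none in the other two models. -/
def CDModel.sendersHear : CDModel → Bool
  | .strongCD => true
  | .senderCD => true
  | .receiverCD => false
  | .noCD => false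

/-- Network sizes: at least one device, and at least two in No-CD. -/
def CDModel.Allows (cd : CDModel) (n : ℕ) : Prop :=
  1 ≤ n ∧ (cd = .noCD → 2 ≤ n)

/-- What a device does in one time slot. Messages are natural numbers (any countable message
space can be coded by them; the message size is unbounded). -/
inductive Action where
  | idle
  | listen
  | transmit (msg : ℕ)

/-- The message put on the channel, if any. -/
def Action.sent : Action → Option ℕ
  | .transmit m => some m
  | _ => none

/-- Listening and transmitting cost one unit of energy each. -/
def Action.cost : Action → ℕ
  | .idle => 0
  | .listen => 1
  | .transmit _ => 1

/-- What a device perceives at the end of a time slot (`nothing`: no signal at all). -/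
inductive Feedback where
  | nothing
  | silence
  | noise
  | message (msg : ℕ)

def Feedback.isSilence : Feedback → Bool
  | .silence => true
  | _ => false

/-- The signal carried by the channel when the devices act as in `a`. -/
def channel (cd : CDModel) {n : ℕ} (a : Fin n → Action) : Feedback :=
  match (List.ofFn a).filterMap Action.sent with
  | [] => .silence
  | [m] => .message m
  | _ :: _ :: _ => if cd.detectsNoise then .noise else .silence

/-- The feedback received by device `i`. -/
def feedback (cd : CDModel) {n : ℕ} (a : Fin n → Action) (i : Fin n) : Feedback :=
  match a i with
  | .idle => .nothing
  | .listen => channel cd a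
  | .transmit _ => if cd.sendersHear then channel cd a else .nothing

/-- A randomized device with outputs in `β`. It draws one random number, uniform in `[0,1]`, to
choose its starting state, and a fresh one in each time slot. All devices of a network are
identical. A device whose state has an output has terminated. -/
structure Device (β : Type) where
  State : Type
  start : I → State
  output : State → Option β
  act : State → I → Action
  next : State → I → Feedback → State

/-- The private random numbers of `n` devices: `ω (i, 0)` chooses the starting state of device
`i`, and `ω (i, t + 1)` is used by device `i` in time slot `t`. -/
abbrev Coins (n : ℕ) : Type := Fin n × ℕ → I

/-- All random numbers are independent and uniform. -/
def coinMeasure (n : ℕ) : Measure (Coins n) :=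
  Measure.infinitePi fun _ : Fin n × ℕ => (volume : Measure I)

namespace Device

variable {β : Type} (A : Device β) (cd : CDModel) {n : ℕ} (ω : Coins n)

/-- The actions in time slot `t` if the devices are in the states `s`; terminated devices
stay idle. -/
def actions (s : Fin n → A.State) (t : ℕ) (i : Fin n) : Action :=
  match A.output (s i) with
  | some _ => .idle
  | none => A.act (s i) (ω (i, t + 1))

/-- The states of the devices after `t` time slots. -/
def config : ℕ → Fin n → A.State
  | 0 => fun i => A.start (ω (i, 0))
  | t + 1 => fun i =>
    match A.output (config t i) with
    | some _ => config t i
    | none => A.next (config t i) (ω (i, t + 1)) (feedback cd (A.actions ω (config t) t) i)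

/-- The energy spent by device `i` during the first `T` time slots. -/
def energy (T : ℕ) (i : Fin n) : ℕ :=
  ∑ t ∈ Finset.range T, (A.actions ω (A.config cd ω t) t i).cost

/-- The output of device `i` after `T` time slots, if it has terminated by then. -/
def result (T : ℕ) (i : Fin n) : Option β :=
  A.output (A.config cd ω T i)

end Device

/-- Within time `τ` and energy `E` per device, all devices terminate and agree on an estimate `e`
of the network size with `n / 2 ≤ e ≤ 2 n`. -/
def Solves (A : Device ℕ) (cd : CDModel) {n : ℕ} (ω : Coins n) (τ E : ℝ) : Prop :=
  ∃ T e : ℕ, (T : ℝ) ≤ τ ∧ (n : ℝ) / 2 ≤ e ∧ (e : ℝ) ≤ 2 * n ∧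
    ∀ i, A.result cd ω T i = some e ∧ (A.energy cd ω T i : ℝ) ≤ E

/-- The probability that `Solves` fails on `n` devices. -/
def failureProb (A : Device ℕ) (cd : CDModel) (n : ℕ) (τ E : ℝ) : ENNReal :=
  coinMeasure n {ω | ¬ Solves A cd ω τ E}

/-! ## Writing programs for a device -/

/-- A program of a single device that takes boundedly many steps along each branch: either return
a value, or use one more time slot. -/
inductive Proto (β : Type) : Type where
  | done (b : β) : Proto β
  | slot (act : I → Action) (next : I → Feedback → Proto β) : Proto β

/-- Sequential composition; returning takes no time. -/
def Proto.bind {β δ : Type} : Proto β → (β → Proto δ) → Proto δ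
  | .done b, f => f b
  | .slot act next, f => .slot act fun u y => (next u y).bind f

/-- Stay idle for the given number of time slots. -/
def Proto.wait {β : Type} : ℕ → β → Proto β
  | 0, b => .done b
  | t + 1, b => .slot (fun _ => .idle) fun _ _ => Proto.wait t b

/-- The device that runs a program and outputs the value that it returns. -/
def Proto.device {β : Type} (p : Proto β) : Device β where
  State := Proto β
  start _ := p
  output
    | .done b => some b
    | .slot _ _ => none
  act
    | .done _, _ => .idle
    | .slot act _, u => act u
  next
    | .done b, _, _ => .done b
    | .slot _ next, u, y => next u y

/-- Start the body of a loop over, if the previous round of the loop has returned the loop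
state `s`. -/
def unroll {κ β : Type} (body : κ → Proto (κ ⊕ β)) : Proto (κ ⊕ β) → Proto (κ ⊕ β)
  | .done (.inl s) => body s
  | p => p

/-- The device that runs `init` and then `body` again and again, until a value `.inr b`
is returned, which is its output. -/
def loopDevice {κ β : Type} (init : I → Proto (κ ⊕ β)) (body : κ → Proto (κ ⊕ β)) : Device β where
  State := Proto (κ ⊕ β)
  start := init
  output
    | .done (.inr b) => some b
    | _ => none
  act p u :=
    match unroll body p with
    | .done _ => .idle
    | .slot act _ => act u
  next p u y :=
    match unroll body p with
    | .done r => .done r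
    | .slot _ next => next u y

/-- A subroutine that takes exactly `len` time slots. The action in a slot depends on the
history (the random numbers and feedbacks of the previous slots of this subroutine, latest first)
and the current random number. -/
structure Subroutine (β : Type) where
  len : ℕ
  act : List (I × Feedback) → I → Action
  out : List (I × Feedback) → β

def Subroutine.runFrom {β : Type} (S : Subroutine β) : ℕ → List (I × Feedback) → Proto β
  | 0, h => .done (S.out h)
  | t + 1, h => .slot (S.act h) fun u y => S.runFrom t ((u, y) :: h)

def Subroutine.run {β : Type} (S : Subroutine β) : Proto β := S.runFrom S.len []

/-! ## The algorithm Estimate-Network-Size -/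

/-- What a device remembers: its label, and whether it has been elected as a leader. -/
structure Memory where
  label : Option ℕ
  leader : Bool

/-- The position in the algorithm: about to run `Test(i)` in the doubling part of
Exponential-Search, about to bisect `{lo, …, hi}`, or about to run iteration `k` of the
main loop. -/
inductive Phase where
  | expand (i : ℕ)
  | bisect (lo hi : ℕ)
  | iterate (k : ℕ)

/-- The label chosen with a uniform random number `u`: for each `k ≥ d₁`, the label is `k` with
probability `1 / √(2 ^ k)`. -/
def labelOf (d₁ : ℕ) (u : I) : Option ℕ :=
  open Classical in
  if h : ∃ k, d₁ ≤ k ∧ (u : ℝ) < ∑ j ∈ Finset.Icc d₁ k, 1 / √(2 ^ j) then some (Nat.find h)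
  else none

/-- `Test(i)` of Exponential-Search: transmit with probability `2 ^ (- d i)`, otherwise listen.
The value `true` is the decision "`i` is at least the index looked for". -/
def searchTest (d : ℕ → ℕ) (i : ℕ) : Proto Bool :=
  open Classical in
  .slot (fun u => if (u : ℝ) < (1 / 2) ^ d i then .transmit 0 else .listen)
    fun u y => .done (if (u : ℝ) < (1 / 2) ^ d i then false else y.isSilence)

/-- Continue the binary search on `{lo, …, hi}`. When a single index `i` is left, enter the main
loop with `k = d (i - 2)`, or with `k = d 1` if `i - 2 < 1`. -/
def narrow (d : ℕ → ℕ) (lo hi : ℕ) : Phase :=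
  if lo < hi then .bisect lo hi else .iterate (d (max 1 (lo - 2)))

/-- The estimate conveyed by a received label. -/
def Feedback.estimate : Feedback → Option ℕ
  | .message k => some (2 ^ k)
  | _ => none

/-- The slot in which the leaders whose label is congruent to `r` modulo 2 announce their labels
and all other devices listen. The result is the estimate, if exactly one message was sent.
A transmitter without a signal takes for granted that it was the only one. -/
def announce (cd : CDModel) (r : ℕ) : Memory → Proto (Option ℕ)
  | ⟨some l, true⟩ =>
    if l % 2 = r then
      .slot (fun _ => .transmit l)
        fun _ y => .done (if cd.sendersHear then y.estimate else some (2 ^ l))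
    else .slot (fun _ => .listen) fun _ y => .done y.estimate
  | _ => .slot (fun _ => .listen) fun _ y => .done y.estimate

/-- Terminate if an estimate has been found, otherwise go on with `p`. -/
def stopOr {κ : Type} (p : Proto (κ ⊕ ℕ)) : Option ℕ → Proto (κ ⊕ ℕ)
  | some e => .done (.inr e)
  | none => p

/-- One round of Exponential-Search, or one iteration of the main loop. The argument `test x` is
the subroutine Test-Network-Size with guess `x`. -/
def roundBody (cd : CDModel) (d : ℕ → ℕ) (test : ℝ → Subroutine Bool) :
    Phase × Memory → Proto ((Phase × Memory) ⊕ ℕ)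
  | (.expand i, m) => (searchTest d i).bind fun b =>
      .done (.inl (if b then narrow d 1 i else .expand (2 * i), m))
  | (.bisect lo hi, m) => (searchTest d ((lo + hi) / 2)).bind fun b =>
      .done (.inl (if b then narrow d lo ((lo + hi) / 2) else narrow d ((lo + hi) / 2 + 1) hi, m))
  | (.iterate k, m) =>
      (if m.label = some k then (test √(2 ^ k)).run
        else Proto.wait (test √(2 ^ k)).len m.leader).bind fun b =>
      open Classical in
      if ∃ i, 1 ≤ i ∧ d i = k then
        (announce cd 1 ⟨m.label, b⟩).bind <| stopOr <|
        (announce cd 0 ⟨m.label, b⟩).bind <| stopOr <|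
        .done (.inl (.iterate (k + 1), ⟨m.label, b⟩))
      else .done (.inl (.iterate (k + 1), ⟨m.label, b⟩))

/-- Estimate-Network-Size with checkpoints `d 1, d 2, …` (the value `d 0` is never used).
The argument `triv` is the family of subroutines Trivial-Algorithm; the result `none` of
`triv N` means "the network has more than `N` devices". -/
def estimateNetworkSize (cd : CDModel) (d : ℕ → ℕ) (triv : ℕ → Subroutine (Option ℕ))
    (test : ℝ → Subroutine Bool) : Device ℕ :=
  loopDevice
    (fun u => (triv (2 ^ d 1)).run.bind <| stopOr <|
      .done (.inl (if cd.detectsNoise then .expand 1 else .iterate (d 1), ⟨labelOf (d 1) u, false⟩)))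
    (roundBody cd d test)

/-! ## Requirements and bounds -/

/-- The inverse Ackermann function. -/
def invAck (N : ℕ) : ℕ := sInf {i | N ≤ ack i i}

/-- The iterated logarithm (base 2). -/
def logStar (x : ℝ) : ℕ := sInf {i | (Real.logb 2)^[i] x ≤ 1}

/-- Trivial-Algorithm: on `n` devices, with probability `1 - C n ^ (-c)`, `triv N` decides that
`n > N` (and this is so) or all devices agree on an estimate within a factor two. Its running time
is a constant that depends only on `N`. -/
def TrivialSpec (cd : CDModel) (triv : ℕ → Subroutine (Option ℕ)) (C c : ℝ) : Prop :=
  ∀ N n : ℕ, cd.Allows n →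
    coinMeasure n {ω | ¬
      ((N < n ∧ ∀ i, (triv N).run.device.result cd ω (triv N).len i = some none) ∨
        ∃ e : ℕ, (n : ℝ) / 2 ≤ e ∧ (e : ℝ) ≤ 2 * n ∧
          ∀ i, (triv N).run.device.result cd ω (triv N).len i = some (some e))}
      ≤ ENNReal.ofReal (C * (n : ℝ) ^ (-c))

/-- The set of devices that are elected as a leader by Test-Network-Size. -/
def leaders (cd : CDModel) (S : Subroutine Bool) {n : ℕ} (ω : Coins n) : Set (Fin n) :=
  {i | S.run.device.result cd ω S.len i = some true}

/-- Test-Network-Size with a guess `x ≥ 100`: it takes time `O(log x)` and, when run by `n` devices,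
with probability `1 - C (max n x) ^ (-c)`, it takes energy `O(α(x))`, elects a leader if
`n / 1.5 ≤ x ≤ 1.5 n`, no leader if `x ≥ 1.9 n` or `x ≤ n / 1.9`, and never more than one. -/
def TestSpec (cd : CDModel) (test : ℝ → Subroutine Bool) (C c : ℝ) : Prop :=
  ∀ x : ℝ, 100 ≤ x → ((test x).len : ℝ) ≤ C * Real.logb 2 x ∧
    ∀ n : ℕ, coinMeasure n {ω | ¬
      ((∀ i, ((test x).run.device.energy cd ω (test x).len i : ℝ) ≤ C * invAck ⌈x⌉₊) ∧
        (leaders cd (test x) ω).ncard ≤ 1 ∧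
        ((n : ℝ) / 1.5 ≤ x ∧ x ≤ 1.5 * n → (leaders cd (test x) ω).ncard = 1) ∧
        (1.9 * n ≤ x ∨ x ≤ n / 1.9 → (leaders cd (test x) ω).ncard = 0))}
      ≤ ENNReal.ofReal (C * (max (n : ℝ) x) ^ (-c))

/-- The requirements on the checkpoints `d 1, d 2, …`. -/
structure Admissible (γ : ℝ) (d : ℕ → ℕ) : Prop where
  growth : ∀ i, 1 ≤ i → γ * d i ≤ d (i + 1)
  sum_le : ∑' j : ℕ, 1 / √(2 ^ (d 1 + j)) ≤ 1
  large : 100 ≤ √(2 ^ d 1)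

/-- The index `i` with `d (i - 1) < log n ≤ d i` (where `i = 1` if `log n ≤ d 1`). -/
def IsIndex (d : ℕ → ℕ) (n i : ℕ) : Prop :=
  1 ≤ i ∧ Real.logb 2 n ≤ d i ∧ (2 ≤ i → (d (i - 1) : ℝ) < Real.logb 2 n)

/-- `log x` in Strong-CD and Receiver-CD, and `x` in Sender-CD and No-CD. -/
def CDModel.scale (cd : CDModel) (x : ℝ) : ℝ :=
  if cd.detectsNoise then Real.logb 2 x else x

end RadioNetwork

end

open RadioNetwork

noncomputable section
open scoped unitInterval

namespace RadioNetwork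

/-! ## The signal on the channel -/

/-! Both subroutines use only messages that a device hears while it listens (`Machine`). Noise,
silence and whatever a transmitter perceives are ignored, so the same subroutines serve all four
models.

Trivial-Algorithm lets each device announce a random identifier and counts what it hears. If
identifiers are distinct, everybody counts the `n - 1` others. Two identifier ranges of very
different size make the answer reliable for all `n` at once (`trivialSpec_trivialAlgorithm`).

Test-Network-Size runs about `log x` positions. In each, an unused device becomes a candidate or a
helper, with probability `1 / x` each, and a candidate is registered if it is the only one and there
is exactly one helper. With `l = n / x` this has probability about `(l * exp (-l)) ^ 2`. For large
`x` this is at least 0.107 if `x` is within a factor 1.5 of `n`, and at most 0.102 if it is off by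
1.9 or more (`le_pairProb`, `pairProb_le`), and Hoeffding's inequality separates the two cases.
Counting the registrations costs each device only constant energy: registered candidates form a
relay in which every member keeps the counter during 1000 positions of its own. As registrations are
far more frequent than one in 1000, the relay outlives the election whenever it matters
(`token_count`, `election_leaders`). The energy is at most 3005 (`election_energyLe`), so the
inverse Ackermann term is replaced by a constant throughout.

In the main loop about `n / √(2 ^ k)` devices have label `k` and test the guess `√(2 ^ k)`; the
ratio is `n / 2 ^ k`. Hence leaders have labels with `n / 2 < 2 ^ k < 2 n`, of which there are at
most two, of different parity, so announcements by parity never collide (`LeadersOK.speaker`). Some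
`k` with `2 ^ k` within `√2` of `n` does elect a leader (`exists_central`), so the loop ends at the
latest at the first checkpoint above `log n` (`AtPhase.iterate`). Each device pays for one election,
since it has one label, and for two slots per checkpoint. Exponential-Search, where collisions are
audible, leaves at most four checkpoints (`AtPhase.search`); otherwise there are at most `i` of
them.

The failure probability adds up the errors of the search (`coinMeasure_not_searchOK_le`) and of the
elections (`coinMeasure_not_electionOK_le`). Labels are independent of the slot randomness, and
Chebyshev's inequality controls the number of devices with each label. The error for label `k`
decays geometrically in `k`, and a union bound over all outcomes of the search replaces conditioning
on it (`coinMeasure_not_goodRun_le`). The special choices of checkpoints then only require bounds on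
the index and on `d i` for given growth. -/

/-- The message carried by a signal, if any. -/
def Feedback.msg : Feedback → Option ℕ
  | .message m => some m
  | _ => none

section Channel

variable {cd : CDModel} {n : ℕ} {a : Fin n → Action}

theorem filterMap_sent_eq_nil (h : ∀ i, (a i).sent = none) :
    (List.ofFn a).filterMap Action.sent = [] := by
  rw [List.filterMap_eq_nil_iff]
  intro x hx
  obtain ⟨i, rfl⟩ := (List.mem_ofFn' a x).mp hx
  exact h i

theorem filterMap_sent_eq_singleton {i : Fin n} {m : ℕ} (hi : (a i).sent = some m)
    (h : ∀ j, j ≠ i → (a j).sent = none) :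
    (List.ofFn a).filterMap Action.sent = [m] := by
  induction n with
  | zero => exact i.elim0
  | succ n ih =>
    rw [List.ofFn_succ]
    rcases Fin.eq_zero_or_eq_succ i with rfl | ⟨j, rfl⟩
    · rw [List.filterMap_cons_some hi,
        filterMap_sent_eq_nil fun j => h _ (Fin.succ_ne_zero j)]
    · rw [List.filterMap_cons_none (h 0 (Fin.succ_ne_zero j).symm)]
      exact ih (a := fun k => a k.succ) hi fun k hk => h _ fun e => hk (Fin.succ_injective _ e)

theorem exists_filterMap_sent_eq_cons {i : Fin n} (hi : (a i).sent ≠ none) :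
    ∃ m l, (List.ofFn a).filterMap Action.sent = m :: l := by
  refine List.exists_cons_of_ne_nil fun h => hi ?_
  rw [List.filterMap_eq_nil_iff] at h
  exact h _ ((List.mem_ofFn' a _).mpr ⟨i, rfl⟩)

theorem exists_filterMap_sent_eq_cons_cons {i j : Fin n} (hij : i ≠ j) (hi : (a i).sent ≠ none)
    (hj : (a j).sent ≠ none) :
    ∃ m m' l, (List.ofFn a).filterMap Action.sent = m :: m' :: l := by
  induction n with
  | zero => exact i.elim0
  | succ n ih =>
    rw [List.ofFn_succ]
    wlog h0 : i ≤ j generalizing i j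
    · exact this hij.symm hj hi (le_of_not_ge h0)
    obtain ⟨j, rfl⟩ := (Fin.eq_zero_or_eq_succ j).resolve_left (by
      rintro rfl
      exact hij (Fin.le_zero_iff.mp h0))
    rcases hs : (a 0).sent with _ | m
    · rw [List.filterMap_cons_none hs]
      obtain ⟨i, rfl⟩ := (Fin.eq_zero_or_eq_succ i).resolve_left (by rintro rfl; exact hi hs)
      exact ih (a := fun k => a k.succ) (fun e => hij (by rw [e])) hi hj
    · rw [List.filterMap_cons_some hs]
      obtain ⟨m', l, hl⟩ := exists_filterMap_sent_eq_cons (a := fun k => a k.succ) hj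
      exact ⟨m, m', l, by rw [hl]⟩

theorem channel_of_forall_none (h : ∀ i, (a i).sent = none) : channel cd a = .silence := by
  simp [channel, filterMap_sent_eq_nil h]

theorem channel_of_unique {i : Fin n} {m : ℕ} (hi : (a i).sent = some m)
    (h : ∀ j, j ≠ i → (a j).sent = none) : channel cd a = .message m := by
  simp [channel, filterMap_sent_eq_singleton hi h]

theorem channel_of_two {i j : Fin n} (hij : i ≠ j) (hi : (a i).sent ≠ none)
    (hj : (a j).sent ≠ none) :
    channel cd a = if cd.detectsNoise then .noise else .silence := by
  obtain ⟨m, m', l, hl⟩ := exists_filterMap_sent_eq_cons_cons hij hi hj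
  simp [channel, hl]

theorem channel_of_two_msg {i j : Fin n} (hij : i ≠ j) (hi : (a i).sent ≠ none)
    (hj : (a j).sent ≠ none) : (channel cd a).msg = none := by
  rw [channel_of_two hij hi hj]
  split_ifs <;> rfl

theorem sent_trichotomy (a : Fin n → Action) :
    (∀ i, (a i).sent = none) ∨ (∃ i m, (a i).sent = some m ∧ ∀ j, j ≠ i → (a j).sent = none) ∨
      ∃ i j, i ≠ j ∧ (a i).sent ≠ none ∧ (a j).sent ≠ none := by
  by_cases h : ∀ i, (a i).sent = none
  · exact .inl h
  push Not at h
  obtain ⟨i, hi⟩ := h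
  by_cases h' : ∀ j, j ≠ i → (a j).sent = none
  · obtain ⟨m, hm⟩ := Option.ne_none_iff_exists'.mp hi
    exact .inr (.inl ⟨i, m, hm, h'⟩)
  · push Not at h'
    obtain ⟨j, hj, hj'⟩ := h'
    exact .inr (.inr ⟨i, j, hj.symm, hi, hj'⟩)

/-- If some device sends and noise can be detected, then nobody perceives silence. -/
theorem channel_ne_silence (hcd : cd.detectsNoise = true) {i : Fin n} (hi : (a i).sent ≠ none) :
    (channel cd a).isSilence = false := by
  rcases sent_trichotomy a with h | ⟨i, m, h, h'⟩ | ⟨i, j, h, h', h''⟩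
  · exact absurd (h i) hi
  · rw [channel_of_unique h h']; rfl
  · rw [channel_of_two h h' h'', hcd]; rfl

/-- Devices that send nothing can be dropped from the network. -/
theorem channel_embed {m : ℕ} {b : Fin m → Action} {e : Fin m → Fin n}
    (he : Function.Injective e) (hab : ∀ j, a (e j) = b j)
    (h : ∀ i, i ∉ Set.range e → (a i).sent = none) : channel cd a = channel cd b := by
  rcases sent_trichotomy b with hb | ⟨j, m, hb, hb'⟩ | ⟨j, k, hb, hb', hb''⟩
  · rw [channel_of_forall_none hb, channel_of_forall_none]
    intro i
    by_cases hi : i ∈ Set.range e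
    · obtain ⟨j, rfl⟩ := hi
      rw [hab, hb]
    · exact h i hi
  · rw [channel_of_unique hb hb', channel_of_unique (i := e j) (m := m) (by rw [hab, hb])]
    intro i hij
    by_cases hi : i ∈ Set.range e
    · obtain ⟨k, rfl⟩ := hi
      rw [hab, hb' _ fun hk => hij (by rw [hk])]
    · exact h i hi
  · rw [channel_of_two hb hb' hb'',
      channel_of_two (i := e j) (j := e k) (he.ne hb) (by rwa [hab]) (by rwa [hab])]

end Channel

theorem feedback_of_listen {cd : CDModel} {n : ℕ} {a : Fin n → Action} {i : Fin n}
    (h : a i = .listen) : feedback cd a i = channel cd a := by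
  simp [feedback, h]

/-! ## Networks of devices that run programs -/

section Net

variable {β δ : Type} (cd : CDModel) {n : ℕ} (ω : Coins n)

/-- The action of a program with random number `u`. -/
def Proto.action : Proto β → I → Action
  | .done _, _ => .idle
  | .slot act _, u => act u

/-- The remaining program after one time slot. -/
def Proto.after : Proto β → I → Feedback → Proto β
  | .done b, _, _ => .done b
  | .slot _ next, u, y => next u y

/-- The actions in time slot `t` of devices that run the programs `p`. -/
def netAct (t : ℕ) (p : Fin n → Proto β) (i : Fin n) : Action :=
  (p i).action (ω (i, t + 1))

/-- The programs of the devices after time slot `t`. -/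
def netStep (t : ℕ) (p : Fin n → Proto β) (i : Fin n) : Proto β :=
  (p i).after (ω (i, t + 1)) (feedback cd (netAct ω t p) i)

/-- The programs of the devices after `T` time slots, starting at time `t`. -/
def netRun : ℕ → ℕ → (Fin n → Proto β) → Fin n → Proto β
  | _, 0, p => p
  | t, T + 1, p => netRun (t + 1) T (netStep cd ω t p)

/-- The energy spent in `T` time slots, starting at time `t`. -/
def netEnergy : ℕ → ℕ → (Fin n → Proto β) → Fin n → ℕ
  | _, 0, _, _ => 0
  | t, T + 1, p, i => (netAct ω t p i).cost + netEnergy (t + 1) T (netStep cd ω t p) i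

theorem netRun_succ' (t T : ℕ) (p : Fin n → Proto β) :
    netRun cd ω t (T + 1) p = netStep cd ω (t + T) (netRun cd ω t T p) := by
  induction T generalizing t p with
  | zero => rfl
  | succ T ih =>
    rw [netRun, ih, netRun, Nat.add_right_comm t 1 T, add_assoc]

theorem netEnergy_eq_sum (t T : ℕ) (p : Fin n → Proto β) (i : Fin n) :
    netEnergy cd ω t T p i =
      ∑ s ∈ Finset.range T, (netAct ω (t + s) (netRun cd ω t s p) i).cost := by
  induction T generalizing t p with
  | zero => rfl
  | succ T ih =>
    rw [netEnergy, ih, Finset.sum_range_succ', add_comm]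
    simp only [netRun, add_zero, Nat.add_right_comm t 1, add_assoc]

/-- All branches of the program take exactly `T` time slots. -/
def Proto.HasLen : Proto β → ℕ → Prop
  | .done _, T => T = 0
  | .slot _ next, T => ∃ T', T = T' + 1 ∧ ∀ u y, (next u y).HasLen T'

/-- All branches of the program cost at most `E`. -/
def Proto.EnergyLe : Proto β → ℕ → Prop
  | .done _, _ => True
  | .slot act next, E => ∀ u y, ∃ E', (act u).cost + E' ≤ E ∧ (next u y).EnergyLe E'

def Proto.IsSlot : Proto β → Prop
  | .done _ => False
  | .slot _ _ => True

theorem Proto.HasLen.isSlot {p : Proto β} {T : ℕ} (h : p.HasLen T) (hT : 0 < T) : p.IsSlot := by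
  cases p with
  | done b => exact hT.ne' h
  | slot act next => trivial

theorem Proto.HasLen.after {p : Proto β} {T : ℕ} (h : p.HasLen (T + 1)) (u : I) (y : Feedback) :
    (p.after u y).HasLen T := by
  cases p with
  | done b => exact absurd h (Nat.succ_ne_zero T)
  | slot act next =>
    obtain ⟨T', hT, h⟩ := h
    obtain rfl : T = T' := Nat.succ_injective hT
    exact h u y

theorem Proto.HasLen.eq_done {p : Proto β} (h : p.HasLen 0) : ∃ b, p = .done b := by
  cases p with
  | done b => exact ⟨b, rfl⟩
  | slot act next =>
    obtain ⟨T', hT, -⟩ := h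
    exact absurd hT (Nat.succ_ne_zero T').symm

theorem Proto.hasLen_wait (T : ℕ) (b : β) : (Proto.wait T b).HasLen T := by
  induction T with
  | zero => rfl
  | succ T ih => exact ⟨T, rfl, fun _ _ => ih⟩

theorem Proto.energyLe_wait (T : ℕ) (b : β) : (Proto.wait T b).EnergyLe 0 := by
  induction T with
  | zero => trivial
  | succ T ih => exact fun _ _ => ⟨0, le_rfl, ih⟩

theorem Action.cost_le_one (a : Action) : a.cost ≤ 1 := by
  cases a <;> simp [Action.cost]

theorem Proto.HasLen.energyLe {p : Proto β} {T : ℕ} (h : p.HasLen T) : p.EnergyLe T := by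
  induction p generalizing T with
  | done b => trivial
  | slot act next ih =>
    obtain ⟨S, rfl, h⟩ := h
    exact fun u y => ⟨S, by have := (act u).cost_le_one; omega, ih u y (h u y)⟩

variable {cd ω}

theorem hasLen_netRun {t T s : ℕ} {p : Fin n → Proto β} {i : Fin n} (h : (p i).HasLen (T + s)) :
    (netRun cd ω t T p i).HasLen s := by
  induction T generalizing t p with
  | zero => rwa [zero_add] at h
  | succ T ih =>
    refine ih (Proto.HasLen.after ?_ _ _)
    rwa [Nat.add_right_comm] at h

/-- A program that has returned stays in place and idles, so the bound holds for every number of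
slots, also beyond the end of the program. -/
theorem netEnergy_le {t T E : ℕ} {p : Fin n → Proto β} {i : Fin n} (h : (p i).EnergyLe E) :
    netEnergy cd ω t T p i ≤ E := by
  induction T generalizing t p E with
  | zero => exact Nat.zero_le _
  | succ T ih =>
    rw [netEnergy]
    rcases hp : p i with b | ⟨act, next⟩
    · have h1 := ih (t := t + 1) (p := netStep cd ω t p) (E := 0)
        (by simp [netStep, hp, Proto.after, Proto.EnergyLe])
      simp only [netAct, hp, Proto.action, Action.cost]
      omega
    · rw [hp] at h
      obtain ⟨F, hF, h⟩ := h (ω (i, t + 1)) (feedback cd (netAct ω t p) i)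
      have h1 := ih (t := t + 1) (p := netStep cd ω t p) (E := F)
        (by simpa [netStep, hp, Proto.after] using h)
      have h2 : netAct ω t p i = act (ω (i, t + 1)) := by simp [netAct, hp, Proto.action]
      rw [h2]
      omega

theorem Proto.action_bind {p : Proto β} (hp : p.IsSlot) (f : β → Proto δ) (u : I) :
    (p.bind f).action u = p.action u := by
  cases p with
  | done b => exact hp.elim
  | slot act next => rfl

theorem Proto.after_bind {p : Proto β} (hp : p.IsSlot) (f : β → Proto δ) (u : I) (y : Feedback) :
    (p.bind f).after u y = (p.after u y).bind f := by
  cases p with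
  | done b => exact hp.elim
  | slot act next => rfl

/-- The length hypothesis keeps all programs from returning before slot `T`, so the continuations do
not interfere during these slots. -/
theorem netRun_bind {t T s : ℕ} {p : Fin n → Proto β} (f : Fin n → β → Proto δ)
    (h : ∀ i, (p i).HasLen (T + s)) :
    netRun cd ω t T (fun i => (p i).bind (f i)) = fun i => (netRun cd ω t T p i).bind (f i) := by
  induction T generalizing t p with
  | zero => rfl
  | succ T ih =>
    have h' : ∀ i, (p i).HasLen (T + s + 1) := fun i => by
      have := h i
      rwa [Nat.add_right_comm] at this
    have hs : ∀ i, (p i).IsSlot := fun i => (h' i).isSlot (Nat.succ_pos _)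
    have ha : netAct ω t (fun i => (p i).bind (f i)) = netAct ω t p := by
      funext i
      exact Proto.action_bind (hs i) _ _
    have hst : netStep cd ω t (fun i => (p i).bind (f i)) =
        fun i => (netStep cd ω t p i).bind (f i) := by
      funext i
      rw [netStep, ha]
      exact Proto.after_bind (hs i) _ _ _
    rw [netRun, hst]
    exact ih fun i => (h' i).after _ _

theorem Proto.device_actions (p : Proto β) (c : Fin n → Proto β) (t : ℕ) :
    p.device.actions ω c t = netAct ω t c := by
  funext j
  change (match p.device.output (c j) with
    | some _ => Action.idle
    | none => p.device.act (c j) (ω (j, t + 1))) = (c j).action (ω (j, t + 1))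
  rcases c j with b | ⟨act, next⟩ <;> rfl

theorem Proto.device_config (p : Proto β) (T : ℕ) :
    p.device.config cd ω T = netRun cd ω 0 T fun _ => p := by
  induction T with
  | zero => rfl
  | succ T ih =>
    rw [netRun_succ', zero_add]
    funext i
    change (match p.device.output (p.device.config cd ω T i) with
      | some _ => p.device.config cd ω T i
      | none => p.device.next (p.device.config cd ω T i) (ω (i, T + 1))
          (feedback cd (p.device.actions ω (p.device.config cd ω T) T) i)) = _
    rw [ih]
    change (match p.device.output (netRun cd ω 0 T (fun _ => p) i) with
      | some _ => netRun cd ω 0 T (fun _ => p) i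
      | none => p.device.next (netRun cd ω 0 T (fun _ => p) i) (ω (i, T + 1))
          (feedback cd (p.device.actions ω (netRun cd ω 0 T (fun _ => p)) T) i)) =
      (netRun cd ω 0 T (fun _ => p) i).after (ω (i, T + 1))
        (feedback cd (netAct ω T (netRun cd ω 0 T (fun _ => p))) i)
    rw [Proto.device_actions]
    rcases netRun cd ω 0 T (fun _ => p) i with b | ⟨act, next⟩ <;> rfl

theorem Proto.device_energy (p : Proto β) (T : ℕ) (i : Fin n) :
    p.device.energy cd ω T i = netEnergy cd ω 0 T (fun _ => p) i := by
  rw [netEnergy_eq_sum, Device.energy]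
  refine Finset.sum_congr rfl fun t _ => ?_
  rw [Proto.device_config, zero_add, Proto.device_actions]

theorem Proto.device_result (p : Proto β) (T : ℕ) (i : Fin n) (b : β) :
    p.device.result cd ω T i = some b ↔ netRun cd ω 0 T (fun _ => p) i = .done b := by
  rw [Device.result, Proto.device_config]
  rcases netRun cd ω 0 T (fun _ => p) i with b | ⟨act, next⟩ <;> simp [Proto.device]

/-! ### Loops -/

section Loop

variable {κ : Type} {init : I → Proto (κ ⊕ β)} {body : κ → Proto (κ ⊕ β)}

theorem unroll_of_isSlot {p : Proto (κ ⊕ β)} (h : p.IsSlot) : unroll body p = p := by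
  cases p with
  | done b => exact h.elim
  | slot act next => rfl

theorem loopDevice_act (p : Proto (κ ⊕ β)) (u : I) :
    (loopDevice init body).act p u = (unroll body p).action u := by
  simp only [loopDevice]
  cases unroll body p <;> rfl

theorem loopDevice_next (p : Proto (κ ⊕ β)) (u : I) (y : Feedback) :
    (loopDevice init body).next p u y = (unroll body p).after u y := by
  simp only [loopDevice]
  cases unroll body p <;> rfl

theorem loopDevice_actions {t : ℕ} {c q : Fin n → Proto (κ ⊕ β)}
    (hq : ∀ i, unroll body (c i) = q i) (hs : ∀ i, (q i).IsSlot) :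
    (loopDevice init body).actions ω c t = netAct ω t q := by
  funext i
  have h1 := hs i
  rw [netAct, ← hq]
  rw [← hq] at h1
  change (match (loopDevice init body).output (c i) with
    | some _ => Action.idle
    | none => (loopDevice init body).act (c i) (ω (i, t + 1))) = _
  rcases h2 : c i with (k | b) | ⟨act, next⟩
  · exact loopDevice_act _ _
  · rw [h2] at h1
    exact h1.elim
  · rfl

/-- Here `q` is the configuration with all pending restarts of the body carried out. A restart takes
no time, and no device has terminated because every `q i` is a slot; so the loop behaves like a
network of plain programs. -/
theorem loopDevice_step {t : ℕ} {q : Fin n → Proto (κ ⊕ β)}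
    (hq : ∀ i, unroll body ((loopDevice init body).config cd ω t i) = q i)
    (hs : ∀ i, (q i).IsSlot) :
    (loopDevice init body).actions ω ((loopDevice init body).config cd ω t) t = netAct ω t q ∧
      (loopDevice init body).config cd ω (t + 1) = netStep cd ω t q := by
  obtain ⟨c, hc⟩ : ∃ c : Fin n → Proto (κ ⊕ β), (loopDevice init body).config cd ω t = c :=
    ⟨_, rfl⟩
  have ha := loopDevice_actions (init := init) (ω := ω) (t := t) hq hs
  refine ⟨ha, ?_⟩
  funext i
  change (match (loopDevice init body).output ((loopDevice init body).config cd ω t i) with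
    | some _ => (loopDevice init body).config cd ω t i
    | none => (loopDevice init body).next ((loopDevice init body).config cd ω t i) (ω (i, t + 1))
        (feedback cd
          ((loopDevice init body).actions ω ((loopDevice init body).config cd ω t) t) i)) =
    (q i).after (ω (i, t + 1)) (feedback cd (netAct ω t q) i)
  rw [ha]
  have h1 := hs i
  rw [← hq] at h1 ⊢
  rw [hc] at h1 ⊢
  rcases h2 : c i with (k | b) | ⟨act, next⟩
  · exact loopDevice_next _ _ _
  · rw [h2] at h1
    exact h1.elim
  · rfl

/-- Only the first slot may involve a restart: afterwards the states are themselves slots, on which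
`unroll` does nothing. -/
theorem loopDevice_run {t T : ℕ} {q : Fin n → Proto (κ ⊕ β)}
    (hq : ∀ i, unroll body ((loopDevice init body).config cd ω t i) = q i)
    (hs : ∀ s < T + 1, ∀ i, (netRun cd ω t s q i).IsSlot) :
    (loopDevice init body).config cd ω (t + (T + 1)) = netRun cd ω t (T + 1) q ∧
      ∀ i, (loopDevice init body).energy cd ω (t + (T + 1)) i =
        (loopDevice init body).energy cd ω t i + netEnergy cd ω t (T + 1) q i := by
  induction T with
  | zero =>
    have h := loopDevice_step hq (hs 0 zero_lt_one)
    refine ⟨h.2, fun i => ?_⟩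
    rw [zero_add, Device.energy, Finset.sum_range_succ, h.1, netEnergy_eq_sum]
    simp [Device.energy, netRun]
  | succ T ih =>
    obtain ⟨h1, h2⟩ := ih fun s h => hs s (by omega)
    have h := loopDevice_step (init := init) (t := t + (T + 1))
      (q := netRun cd ω t (T + 1) q) (body := body) (cd := cd) (ω := ω)
      (fun i => by rw [h1, unroll_of_isSlot (hs _ (by omega) i)]) (hs _ (by omega))
    refine ⟨?_, fun i => ?_⟩
    · rw [netRun_succ', ← h.2]
      rfl
    · have h3 := congrFun h.1 i
      have h4 := h2 i
      rw [netEnergy_eq_sum, Finset.sum_range_succ, ← netEnergy_eq_sum, ← h3,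
        ← add_assoc ((loopDevice init body).energy cd ω t i), ← h4, ← add_assoc t (T + 1) 1]
      exact Finset.sum_range_succ _ _

/-- Running a segment of fixed length of the body of a loop. -/
theorem loopDevice_segment {t T : ℕ} (hT : 0 < T) {p : Fin n → Proto δ} {E : Fin n → ℕ}
    {f : Fin n → δ → Proto (κ ⊕ β)}
    (hq : ∀ i, unroll body ((loopDevice init body).config cd ω t i) = (p i).bind (f i))
    (hp : ∀ i, (p i).HasLen T) (hE : ∀ i, (p i).EnergyLe (E i)) :
    (∀ i, (loopDevice init body).config cd ω (t + T) i = (netRun cd ω t T p i).bind (f i)) ∧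
      ∀ i, (loopDevice init body).energy cd ω (t + T) i ≤
        (loopDevice init body).energy cd ω t i + E i := by
  obtain ⟨T, rfl⟩ := Nat.exists_eq_succ_of_ne_zero hT.ne'
  have hb : ∀ s ≤ T + 1, netRun cd ω t s (fun i => (p i).bind (f i)) =
      fun i => (netRun cd ω t s p i).bind (f i) := fun s hs =>
    netRun_bind (s := T + 1 - s) f fun i => by
      rw [Nat.add_sub_of_le hs]
      exact hp i
  have hs : ∀ s < T + 1, ∀ i, (netRun cd ω t s p i).IsSlot := fun s hs i =>
    (hasLen_netRun (s := T + 1 - s) (by rw [Nat.add_sub_of_le hs.le]; exact hp i)).isSlot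
      (by omega)
  obtain ⟨h1, h2⟩ := loopDevice_run (T := T) hq fun s h i => by
    rw [hb s h.le]
    have := hs s h i
    change ((netRun cd ω t s p i).bind (f i)).IsSlot
    rcases h : netRun cd ω t s p i with b | ⟨act, next⟩
    · rw [h] at this
      exact this.elim
    · trivial
  refine ⟨fun i => ?_, fun i => ?_⟩
  · rw [Nat.succ_eq_add_one, h1, hb _ le_rfl]
  · rw [Nat.succ_eq_add_one, h2]
    have h3 : netEnergy cd ω t (T + 1) (fun i => (p i).bind (f i)) i =
        netEnergy cd ω t (T + 1) p i := by
      rw [netEnergy_eq_sum, netEnergy_eq_sum]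
      refine Finset.sum_congr rfl fun s h => ?_
      have h := Finset.mem_range.mp h
      rw [hb s h.le, netAct, netAct, Proto.action_bind (hs s h i)]
    rw [h3]
    exact Nat.add_le_add_left (netEnergy_le (hE i)) _

end Loop

/-! ### Subnetworks -/

/-- Devices that only wait can be dropped from the network. -/
theorem netRun_embed {m : ℕ} {e : Fin m → Fin n} (he : Function.Injective e) {t t' T : ℕ}
    {ω' : Coins m} (hω : ∀ j s, ω' (j, t' + s + 1) = ω (e j, t + s + 1)) {p : Fin n → Proto β}
    {q : Fin m → Proto β} (hpq : ∀ j, p (e j) = q j)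
    (hp : ∀ i, i ∉ Set.range e → ∃ S b, p i = .wait S b) (j : Fin m) :
    netRun cd ω t T p (e j) = netRun cd ω' t' T q j := by
  induction T generalizing t t' p q with
  | zero => exact hpq j
  | succ T ih =>
    have h0 : ∀ j, ω' (j, t' + 1) = ω (e j, t + 1) := fun j => hω j 0
    have ha : ∀ j, netAct ω t p (e j) = netAct ω' t' q j := fun j => by
      rw [netAct, netAct, hpq, h0]
    have hch : channel cd (netAct ω t p) = channel cd (netAct ω' t' q) := by
      refine channel_embed he ha fun i hi => ?_
      obtain ⟨S, b, hS⟩ := hp i hi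
      rw [netAct, hS]
      cases S <;> rfl
    refine ih (fun j s => ?_) (fun j => ?_) fun i hi => ?_
    · have := hω j (s + 1)
      rwa [← add_assoc, ← add_assoc, Nat.add_right_comm t' s, Nat.add_right_comm t s] at this
    · rw [netStep, netStep, hpq, h0, feedback, feedback, ha, hch]
    · obtain ⟨S, b, hS⟩ := hp i hi
      rw [netStep, hS]
      cases S with
      | zero => exact ⟨0, b, rfl⟩
      | succ S => exact ⟨S, b, rfl⟩

end Net

end RadioNetwork
end

noncomputable section
open scoped unitInterval

namespace RadioNetwork

/-! ## Subroutines given by state machines -/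

/-- The message heard by all listeners, if any. -/
def heard (cd : CDModel) {n : ℕ} (a : Fin n → Action) : Option ℕ := (channel cd a).msg

/-- What a device with the given action hears. -/
def Action.hears : Action → Option ℕ → Option ℕ
  | .listen, h => h
  | _, _ => none

section Heard

variable {cd : CDModel} {n : ℕ} {a : Fin n → Action}

theorem heard_of_forall_none (h : ∀ i, (a i).sent = none) : heard cd a = none := by
  rw [heard, channel_of_forall_none h]; rfl

theorem heard_of_unique {i : Fin n} {m : ℕ} (hi : (a i).sent = some m)
    (h : ∀ j, j ≠ i → (a j).sent = none) : heard cd a = some m := by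
  rw [heard, channel_of_unique hi h]; rfl

theorem heard_of_two {i j : Fin n} (hij : i ≠ j) (hi : (a i).sent ≠ none)
    (hj : (a j).sent ≠ none) : heard cd a = none :=
  channel_of_two_msg hij hi hj

/-- If all senders send the same message, then it is heard if and only if there is exactly one. -/
theorem heard_of_const {P : Fin n → Prop} {m : ℕ} (h : ∀ i, P i → (a i).sent = some m)
    (h' : ∀ i, ¬ P i → (a i).sent = none) :
    heard cd a = open Classical in if ∃! i, P i then some m else none := by
  split_ifs with hP
  · obtain ⟨i, hi, hu⟩ := hP
    exact heard_of_unique (h i hi) fun j hj => h' j fun hPj => hj (hu j hPj)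
  · by_cases hE : ∃ i, P i
    · obtain ⟨i, hi⟩ := hE
      obtain ⟨j, hj, hji⟩ : ∃ j, P j ∧ j ≠ i := by
        by_contra! hc
        exact hP ⟨i, hi, fun j hj => hc j hj⟩
      exact heard_of_two hji (by simp [h j hj]) (by simp [h i hi])
    · push Not at hE
      exact heard_of_forall_none fun i => h' i (hE i)

end Heard

/-- A state machine that uses feedback only if it listens and hears a message. -/
structure Machine (St β : Type) where
  len : ℕ
  init : St
  act : ℕ → St → I → Action
  upd : ℕ → St → I → Option ℕ → St
  out : St → β

namespace Machine

variable {St β : Type} (M : Machine St β)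

/-- The state reached after a history. -/
def state : List (I × Feedback) → St
  | [] => M.init
  | (u, y) :: h =>
    M.upd h.length (state h) u ((M.act h.length (state h) u).hears y.msg)

/-- The subroutine that runs the machine. -/
def sub : Subroutine β where
  len := M.len
  act h u := M.act h.length (M.state h) u
  out h := M.out (M.state h)

variable (cd : CDModel) {n : ℕ} (ω : Coins n)

/-- The actions in time slot `t` of machines in the states `s`. -/
def acts (t : ℕ) (s : Fin n → St) (i : Fin n) : Action := M.act t (s i) (ω (i, t + 1))

/-- The states after `t` time slots. -/
def states : ℕ → Fin n → St
  | 0, _ => M.init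
  | t + 1, i => M.upd t (states t i) (ω (i, t + 1))
      ((M.acts ω t (states t) i).hears (heard cd (M.acts ω t (states t))))

variable {cd ω}

/-- The history recorded by a device determines the same state as the global recursion `states`. The
two agree in all collision-detection models because `hears` discards the feedback of transmitters
and `msg` identifies noise with silence. -/
theorem exists_history {t : ℕ} (ht : t ≤ M.len) (i : Fin n) :
    ∃ h, h.length = t ∧ M.state h = M.states cd ω t i ∧
      netRun cd ω 0 t (fun _ => M.sub.run) i = M.sub.runFrom (M.len - t) h := by
  induction t generalizing i with
  | zero => exact ⟨[], rfl, rfl, rfl⟩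
  | succ t ih =>
    have ht' : t ≤ M.len := by omega
    obtain ⟨k, hk⟩ : ∃ k, M.len - t = k + 1 := ⟨M.len - t - 1, by omega⟩
    have ha : netAct ω t (netRun cd ω 0 t fun _ => M.sub.run) =
        M.acts ω t (M.states cd ω t) := by
      funext j
      obtain ⟨h, hl, hst, hr⟩ := ih ht' j
      rw [netAct, hr, hk, acts, ← hst, ← hl]
      rfl
    obtain ⟨h, hl, hst, hr⟩ := ih ht' i
    have hai : M.act t (M.states cd ω t i) (ω (i, t + 1)) =
      M.acts ω t (M.states cd ω t) i := rfl
    refine ⟨(ω (i, t + 1), feedback cd (M.acts ω t (M.states cd ω t)) i) :: h, by simp [hl],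
      ?_, ?_⟩
    · rw [state, hst, hl, states, hai]
      congr 1
      cases hact : M.acts ω t (M.states cd ω t) i with
      | listen => rw [feedback_of_listen hact]; rfl
      | idle => rfl
      | transmit m => rfl
    · rw [netRun_succ', zero_add, netStep, ha, hr, hk]
      have : M.len - (t + 1) = k := by omega
      rw [this]
      rfl

theorem netRun_eq_done (i : Fin n) :
    netRun cd ω 0 M.len (fun _ => M.sub.run) i = .done (M.out (M.states cd ω M.len i)) := by
  obtain ⟨h, -, hst, hr⟩ := M.exists_history (cd := cd) (ω := ω) le_rfl i
  rw [hr, Nat.sub_self, ← hst]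
  rfl

theorem result_eq (i : Fin n) :
    M.sub.run.device.result cd ω M.sub.len i = some (M.out (M.states cd ω M.len i)) :=
  (Proto.device_result _ _ _ _).mpr (M.netRun_eq_done i)

/-- A bound on the energy by means of a potential. -/
theorem energyLe_runFrom {Φ : ℕ → St → ℕ}
    (hΦ : ∀ t s u h, (M.act t s u).cost + Φ (t + 1) (M.upd t s u h) ≤ Φ t s)
    (T : ℕ) (h : List (I × Feedback)) :
    (M.sub.runFrom T h).EnergyLe (Φ h.length (M.state h)) := by
  induction T generalizing h with
  | zero => trivial
  | succ T ih => exact fun u y => ⟨_, hΦ _ _ _ _, ih ((u, y) :: h)⟩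

end Machine

theorem Subroutine.hasLen_runFrom {β : Type} (S : Subroutine β) (T : ℕ)
    (h : List (I × Feedback)) : (S.runFrom T h).HasLen T := by
  induction T generalizing h with
  | zero => rfl
  | succ T ih => exact ⟨T, rfl, fun u y => ih _⟩

theorem Subroutine.hasLen_run {β : Type} (S : Subroutine β) : S.run.HasLen S.len :=
  S.hasLen_runFrom _ _

end RadioNetwork
end

noncomputable section
open scoped unitInterval

namespace RadioNetwork

/-! ## Trivial-Algorithm -/

/-- The identifier in `{0, …, M}` drawn with a uniform random number. -/
def cell (M : ℕ) (u : I) : ℕ := ⌊(u : ℝ) * M⌋₊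

/-- Two identifiers, and the numbers of messages heard in two rounds of announcements. -/
structure CensusState where
  id₁ : ℕ
  id₂ : ℕ
  c₁ : ℕ
  c₂ : ℕ

/-- Add one if a message has been heard. -/
def tally (c : ℕ) (h : Option ℕ) : ℕ := if h.isSome then c + 1 else c

/-- Each device draws two identifiers, one in `{0, …, M₁}` and one in `{0, …, M₂}`. In two rounds
of announcements, a device transmits in the slot given by its identifier and listens in all other
slots. -/
def census (N M₁ M₂ : ℕ) : Machine CensusState (Option ℕ) where
  len := 2 + (M₁ + 1) + (M₂ + 1)
  init := ⟨0, 0, 0, 0⟩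
  act t s _ :=
    if t < 2 then .idle
    else if t < 2 + (M₁ + 1) then (if s.id₁ = t - 2 then .transmit 0 else .listen)
    else (if s.id₂ = t - (2 + (M₁ + 1)) then .transmit 0 else .listen)
  upd t s u h :=
    if t = 0 then { s with id₁ := cell M₁ u }
    else if t = 1 then { s with id₂ := cell M₂ u }
    else if t < 2 + (M₁ + 1) then { s with c₁ := tally s.c₁ h }
    else { s with c₂ := tally s.c₂ h }
  out s := if s.c₁ = s.c₂ ∧ 1 ≤ s.c₁ ∧ s.c₁ + 1 ≤ N then some (s.c₁ + 1) else none

/-- The number of identifiers below `r` heard by device `i`. -/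
def heardCount {n : ℕ} (d : Fin n → ℕ) (i : Fin n) (r : ℕ) : ℕ :=
  open Classical in ((Finset.range r).filter fun q => (∃! j, d j = q) ∧ d i ≠ q).card

theorem heardCount_succ {n : ℕ} (d : Fin n → ℕ) (i : Fin n) (r : ℕ) :
    heardCount d i (r + 1) =
      open Classical in heardCount d i r + if (∃! j, d j = r) ∧ d i ≠ r then 1 else 0 := by
  classical
  rw [heardCount, Finset.range_add_one, Finset.filter_insert]
  split_ifs with h
  · rw [Finset.card_insert_of_notMem (by simp)]
    rfl
  · rfl

theorem heardCount_of_injective {n : ℕ} {d : Fin n → ℕ} (hd : Function.Injective d) {r : ℕ}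
    (hr : ∀ i, d i < r) (i : Fin n) : heardCount d i r = n - 1 := by
  classical
  have : (Finset.range r).filter (fun q => (∃! j, d j = q) ∧ d i ≠ q) =
      (Finset.univ.erase i).image d := by
    ext q
    simp only [Finset.mem_filter, Finset.mem_range, Finset.mem_image, Finset.mem_erase,
      Finset.mem_univ, and_true]
    constructor
    · rintro ⟨-, ⟨j, hj, -⟩, hi⟩
      exact ⟨j, fun e => hi (e ▸ hj), hj⟩
    · rintro ⟨j, hj, rfl⟩
      exact ⟨hr j, ⟨j, rfl, fun k hk => hd hk⟩, fun e => hj (hd e).symm⟩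
  rw [heardCount, this, Finset.card_image_of_injective _ hd, Finset.card_erase_of_mem
    (Finset.mem_univ i), Finset.card_univ, Fintype.card_fin]

theorem heardCount_eq_zero {n : ℕ} {d : Fin n → ℕ} {r : ℕ} (hd : ∀ q < r, ¬ ∃! j, d j = q)
    (i : Fin n) : heardCount d i r = 0 := by
  classical
  rw [heardCount, Finset.card_eq_zero, Finset.filter_eq_empty_iff]
  exact fun q hq h => hd q (Finset.mem_range.mp hq) h.1

/-- Identifier `r` is heard by device `i` exactly if one device owns it and that device is not `i`,
which transmits in its own slot instead of listening. -/
theorem tally_announcement {cd : CDModel} {n : ℕ} (d : Fin n → ℕ) (i : Fin n) (r : ℕ) :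
    tally (heardCount d i r)
      ((if d i = r then Action.transmit 0 else .listen).hears
        (heard cd fun j => if d j = r then Action.transmit 0 else .listen)) =
      heardCount d i (r + 1) := by
  classical
  rw [heard_of_const (P := fun j => d j = r) (m := 0) (fun j hj => by simp [hj, Action.sent])
    (fun j hj => by simp [hj, Action.sent]), heardCount_succ]
  by_cases h1 : d i = r <;> by_cases h2 : ∃! j, d j = r <;> simp [h1, h2, Action.hears, tally]

section Census

variable {cd : CDModel} {n : ℕ} {ω : Coins n} {N M₁ M₂ : ℕ}

theorem census_states_first (i : Fin n) (r : ℕ) (hr : r ≤ M₁ + 1) :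
    (census N M₁ M₂).states cd ω (2 + r) i =
      ⟨cell M₁ (ω (i, 1)), cell M₂ (ω (i, 2)),
        heardCount (fun j => cell M₁ (ω (j, 1))) i r, 0⟩ := by
  induction r generalizing i with
  | zero => simp [Machine.states, census, heardCount]
  | succ r ih =>
    have ih := fun i => ih i (by omega)
    have ha : (census N M₁ M₂).acts ω (2 + r) ((census N M₁ M₂).states cd ω (2 + r)) =
        fun j => if cell M₁ (ω (j, 1)) = r then Action.transmit 0 else .listen := by
      funext j
      rw [Machine.acts, ih]
      simp [census, show r < M₁ + 1 by omega, show ¬ 2 + r ≤ 1 by omega]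
    rw [← add_assoc, Machine.states, ha, ih, ← tally_announcement (cd := cd)]
    simp [census, show r < M₁ + 1 by omega, show 2 + r ≠ 1 by omega]

theorem census_states_second (i : Fin n) (r : ℕ) (hr : r ≤ M₂ + 1) :
    (census N M₁ M₂).states cd ω (2 + (M₁ + 1) + r) i =
      ⟨cell M₁ (ω (i, 1)), cell M₂ (ω (i, 2)),
        heardCount (fun j => cell M₁ (ω (j, 1))) i (M₁ + 1),
        heardCount (fun j => cell M₂ (ω (j, 2))) i r⟩ := by
  induction r generalizing i with
  | zero => rw [add_zero, census_states_first _ _ le_rfl]; simp [heardCount]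
  | succ r ih =>
    have ih := fun i => ih i (by omega)
    have h2 : ¬ 2 + (M₁ + 1) + r < 2 := by omega
    have h3 : 2 + (M₁ + 1) + r ≠ 0 := by omega
    have h4 : 2 + (M₁ + 1) + r ≠ 1 := by omega
    have h5 : ¬ 2 + (M₁ + 1) + r < 2 + (M₁ + 1) := by omega
    have h6 : 2 + (M₁ + 1) + r - (2 + (M₁ + 1)) = r := by omega
    have ha : (census N M₁ M₂).acts ω (2 + (M₁ + 1) + r)
        ((census N M₁ M₂).states cd ω (2 + (M₁ + 1) + r)) =
        fun j => if cell M₂ (ω (j, 2)) = r then Action.transmit 0 else .listen := by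
      funext j
      rw [Machine.acts, ih]
      simp only [census, if_neg h2, if_neg h5, h6]
    rw [← add_assoc, Machine.states, ha, ih, 
      ← tally_announcement (cd := cd) _ _ r]
    simp only [census, if_neg h3, if_neg h4, if_neg h5]

theorem census_result (i : Fin n) :
    (census N M₁ M₂).sub.run.device.result cd ω (census N M₁ M₂).sub.len i =
      some ((census N M₁ M₂).out ⟨cell M₁ (ω (i, 1)), cell M₂ (ω (i, 2)),
        heardCount (fun j => cell M₁ (ω (j, 1))) i (M₁ + 1),
        heardCount (fun j => cell M₂ (ω (j, 2))) i (M₂ + 1)⟩) := by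
  rw [Machine.result_eq, ← census_states_second (cd := cd) (N := N) i (M₂ + 1) le_rfl]
  rfl

theorem cell_lt (M : ℕ) (u : I) : cell M u < M + 1 := by
  have h1 : (u : ℝ) * M ≤ M := mul_le_of_le_one_left (Nat.cast_nonneg M) u.2.2
  exact Nat.lt_succ_of_le (Nat.floor_le_of_le h1)

/-- Every device hears each of the `n - 1` others once in both rounds. Two devices are needed
because a count of 0 is read as "more than `N`". -/
theorem census_of_injective (hn : 2 ≤ n) (hN : n ≤ N)
    (h₁ : Function.Injective fun j => cell M₁ (ω (j, 1)))
    (h₂ : Function.Injective fun j => cell M₂ (ω (j, 2))) (i : Fin n) :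
    (census N M₁ M₂).sub.run.device.result cd ω (census N M₁ M₂).sub.len i = some (some n) := by
  rw [census_result, heardCount_of_injective h₁ fun j => cell_lt _ _,
    heardCount_of_injective h₂ fun j => cell_lt _ _]
  simp only [census]
  rw [if_pos ⟨trivial, by omega, by omega⟩, Nat.sub_add_cancel (by omega)]

/-- The second round alone suffices: acceptance would force both counts to be `n - 1`, and then `n ≤
N`. -/
theorem census_of_injective_of_lt (hN : N < n)
    (h₂ : Function.Injective fun j => cell M₂ (ω (j, 2))) (i : Fin n) :
    (census N M₁ M₂).sub.run.device.result cd ω (census N M₁ M₂).sub.len i = some none := by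
  rw [census_result, heardCount_of_injective h₂ fun j => cell_lt _ _]
  simp only [census]
  rw [if_neg (by omega)]

theorem census_of_not_unique (h₁ : ∀ q < M₁ + 1, ¬ ∃! j, cell M₁ (ω (j, 1)) = q) (i : Fin n) :
    (census N M₁ M₂).sub.run.device.result cd ω (census N M₁ M₂).sub.len i = some none := by
  rw [census_result, heardCount_eq_zero h₁]
  simp [census]

end Census

/-! ### Probabilities -/

instance (n : ℕ) : IsProbabilityMeasure (coinMeasure n) := by
  unfold coinMeasure
  infer_instance

theorem coinMeasure_pi {n : ℕ} (s : Finset (Fin n × ℕ)) {A : Fin n × ℕ → Set I}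
    (hA : ∀ x ∈ s, MeasurableSet (A x)) :
    coinMeasure n {ω | ∀ x ∈ s, ω x ∈ A x} = ∏ x ∈ s, volume (A x) :=
  Measure.infinitePi_pi (μ := fun _ : Fin n × ℕ => (volume : Measure I)) hA

/-- The probability that the random numbers used by the devices in one time slot lie in given
sets. -/
theorem coinMeasure_slot {n : ℕ} (t : ℕ) (s : Finset (Fin n)) {A : Fin n → Set I}
    (hA : ∀ i ∈ s, MeasurableSet (A i)) :
    coinMeasure n {ω | ∀ i ∈ s, ω (i, t) ∈ A i} = ∏ i ∈ s, volume (A i) := by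
  have h := coinMeasure_pi (s.map ⟨fun i => (i, t), fun i j h => (Prod.mk.inj h).1⟩)
    (A := fun x => A x.1) fun x hx => by
      obtain ⟨i, hi, rfl⟩ := Finset.mem_map.mp hx
      exact hA i hi
  rw [Finset.prod_map] at h
  rw [← show _ = ∏ i ∈ s, volume (A i) from h]
  congr 1
  ext ω
  refine ⟨fun h x hx => ?_, fun h i hi => h (i, t) (Finset.mem_map.mpr ⟨i, hi, rfl⟩)⟩
  obtain ⟨i, hi, rfl⟩ := Finset.mem_map.mp hx
  exact h i hi

theorem measurable_cell (M : ℕ) : Measurable (cell M) :=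
  Nat.measurable_floor.comp (measurable_subtype_coe.mul_const _)

theorem measurableSet_cell (M q : ℕ) : MeasurableSet {u | cell M u = q} :=
  measurable_cell M (measurableSet_singleton q)

theorem volume_unitInterval_eq (s : Set I) :
    volume s = volume (Subtype.val '' s : Set ℝ) :=
  (MeasurableEmbedding.subtype_coe measurableSet_Icc).comap_apply _ _

theorem volume_Ico {a b : ℝ} (ha : 0 ≤ a) (hb : b ≤ 1) :
    volume {u : I | a ≤ (u : ℝ) ∧ (u : ℝ) < b} = ENNReal.ofReal (b - a) := by
  rw [volume_unitInterval_eq]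
  have : (Subtype.val '' {u : I | a ≤ (u : ℝ) ∧ (u : ℝ) < b} : Set ℝ) = Set.Ico a b := by
    ext x
    constructor
    · rintro ⟨u, hu, rfl⟩
      exact hu
    · intro hx
      exact ⟨⟨x, ha.trans hx.1, hx.2.le.trans hb⟩, hx, rfl⟩
  rw [this, Real.volume_Ico]

theorem volume_cell {M : ℕ} (hM : 0 < M) {q : ℕ} (hq : q < M) :
    volume {u | cell M u = q} = ENNReal.ofReal (1 / M) := by
  have hM' : (0 : ℝ) < M := Nat.cast_pos.mpr hM
  have : {u | cell M u = q} =
      {u : I | (q : ℝ) / M ≤ (u : ℝ) ∧ (u : ℝ) < (q + 1 : ℝ) / M} := by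
    ext u
    simp only [cell, Set.mem_ofPred_eq]
    rw [Nat.floor_eq_iff (mul_nonneg u.2.1 hM'.le), div_le_iff₀ hM', lt_div_iff₀ hM']
  rw [this, volume_Ico (by positivity)]
  · congr 1
    ring
  · rw [div_le_one hM']
    exact_mod_cast hq

theorem volume_cell_self (M : ℕ) (hM : 0 < M) : volume {u | cell M u = M} = 0 := by
  have : {u | cell M u = M} ⊆ {1} := by
    intro u hu
    have hu : ⌊(u : ℝ) * M⌋₊ = M := hu
    have hM' : (0 : ℝ) < M := Nat.cast_pos.mpr hM
    have h1 : (M : ℝ) ≤ u * M := by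
      have := Nat.floor_le (mul_nonneg u.2.1 hM'.le)
      rwa [hu] at this
    exact Set.mem_singleton_iff.mpr
      (Subtype.ext (le_antisymm u.2.2 ((le_mul_iff_one_le_left hM').mp h1)))
  exact measure_mono_null this (by
    rw [volume_unitInterval_eq]
    simp)

theorem volume_cell_le {M : ℕ} (hM : 0 < M) {q : ℕ} (hq : q < M + 1) :
    volume {u | cell M u = q} ≤ ENNReal.ofReal (1 / M) := by
  rcases Nat.lt_succ_iff_lt_or_eq.mp hq with h | rfl
  · exact (volume_cell hM h).le
  · rw [volume_cell_self _ hM]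
    exact zero_le

/-- The birthday bound. The cell `M`, hit only by the number 1, is counted as well, so a fixed pair
collides with probability at most `(M + 1) / M ^ 2 ≤ 2 / M`. -/
theorem coinMeasure_collision_le {n M : ℕ} (hM : 0 < M) (t : ℕ) :
    coinMeasure n {ω | ¬ Function.Injective fun j => cell M (ω (j, t))} ≤
      ENNReal.ofReal (2 * n ^ 2 / M) := by
  have hM' : (1 : ℝ) ≤ M := by exact_mod_cast hM
  have hpair : ∀ i j : Fin n, i ≠ j → ∀ q < M + 1,
      coinMeasure n {ω | cell M (ω (i, t)) = q ∧ cell M (ω (j, t)) = q} ≤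
        ENNReal.ofReal (1 / M) * ENNReal.ofReal (1 / M) := by
    intro i j hij q hq
    have h := coinMeasure_slot t {i, j} (A := fun _ => {u | cell M u = q})
      fun _ _ => measurableSet_cell M q
    rw [Finset.prod_pair hij] at h
    have hs : {ω : Coins n | cell M (ω (i, t)) = q ∧ cell M (ω (j, t)) = q} =
      {ω | ∀ k ∈ ({i, j} : Finset (Fin n)), ω (k, t) ∈ {u | cell M u = q}} := by
      ext ω; simp
    rw [hs, h]
    exact mul_le_mul' (volume_cell_le hM hq) (volume_cell_le hM hq)
  have hsub : {ω : Coins n | ¬ Function.Injective fun j => cell M (ω (j, t))} ⊆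
      ⋃ x ∈ (Finset.univ ×ˢ Finset.univ : Finset (Fin n × Fin n)).filter fun x => x.1 ≠ x.2,
        ⋃ q ∈ Finset.range (M + 1),
          {ω | cell M (ω (x.1, t)) = q ∧ cell M (ω (x.2, t)) = q} := by
    intro ω hω
    simp only [Function.Injective, Set.mem_ofPred_eq, not_forall] at hω
    obtain ⟨i, j, hij, hne⟩ := hω
    simp only [Set.mem_iUnion, Finset.mem_filter, Finset.mem_product, Finset.mem_univ,
      true_and, Finset.mem_range]
    exact ⟨(i, j), hne, _, cell_lt _ _, hij, rfl⟩
  refine (measure_mono hsub).trans ((measure_biUnion_finset_le _ _).trans ?_)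
  have h1 : ∀ x ∈ (Finset.univ ×ˢ Finset.univ : Finset (Fin n × Fin n)).filter
      fun x => x.1 ≠ x.2, coinMeasure n (⋃ q ∈ Finset.range (M + 1),
        {ω | cell M (ω (x.1, t)) = q ∧ cell M (ω (x.2, t)) = q}) ≤ ENNReal.ofReal (2 / M) := by
    intro x hx
    refine (measure_biUnion_finset_le _ _).trans ((Finset.sum_le_sum fun q hq =>
      hpair x.1 x.2 (Finset.mem_filter.mp hx).2 q (Finset.mem_range.mp hq)).trans ?_)
    rw [Finset.sum_const, Finset.card_range, nsmul_eq_mul, ← ENNReal.ofReal_mul (by positivity),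
      ← ENNReal.ofReal_natCast, ← ENNReal.ofReal_mul (by positivity)]
    refine ENNReal.ofReal_le_ofReal ?_
    push_cast
    rw [div_mul_div_comm, ← mul_div_assoc, div_le_div_iff₀ (by positivity) (by positivity)]
    nlinarith
  refine (Finset.sum_le_card_nsmul _ _ _ h1).trans ?_
  rw [nsmul_eq_mul, ← ENNReal.ofReal_natCast, ← ENNReal.ofReal_mul (by positivity)]
  refine ENNReal.ofReal_le_ofReal ?_
  have h2 : (((Finset.univ ×ˢ Finset.univ : Finset (Fin n × Fin n)).filter
      fun x => x.1 ≠ x.2).card : ℝ) ≤ n ^ 2 := by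
    have := Finset.card_filter_le (Finset.univ ×ˢ Finset.univ : Finset (Fin n × Fin n))
      fun x => x.1 ≠ x.2
    rw [Finset.card_product, Finset.card_univ, Fintype.card_fin] at this
    rw [sq]
    exact_mod_cast this
  calc _ ≤ (n : ℝ) ^ 2 * (2 / M) := by gcongr
    _ = _ := by ring

/-- The probability that exactly one device draws a number in a given set in time slot `t`. -/
theorem coinMeasure_existsUnique_le {n : ℕ} (t : ℕ) {A : Set I} (hA : MeasurableSet A) {p : ℝ}
    (hp : 0 ≤ p) (hp' : p ≤ 1) (hv : volume A = ENNReal.ofReal p) :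
    coinMeasure n {ω | ∃! j, ω (j, t) ∈ A} ≤ ENNReal.ofReal (n * (1 - p) ^ (n - 1)) := by
  have hAc : volume Aᶜ = ENNReal.ofReal (1 - p) := by
    rw [prob_compl_eq_one_sub hA, hv, ENNReal.ofReal_sub _ hp, ENNReal.ofReal_one]
  have hsub : {ω : Coins n | ∃! j, ω (j, t) ∈ A} ⊆
      ⋃ i ∈ (Finset.univ : Finset (Fin n)), {ω | ∀ j ∈ Finset.univ.erase i, ω (j, t) ∈ Aᶜ} := by
    rintro ω ⟨i, -, hi⟩
    simp only [Set.mem_iUnion]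
    refine ⟨i, Finset.mem_univ i, fun j hj hjA => ?_⟩
    exact (Finset.mem_erase.mp hj).1 (hi j hjA)
  refine (measure_mono hsub).trans ((measure_biUnion_finset_le _ _).trans ?_)
  have h1 : ∀ i ∈ (Finset.univ : Finset (Fin n)),
      coinMeasure n {ω | ∀ j ∈ Finset.univ.erase i, ω (j, t) ∈ Aᶜ} ≤
        ENNReal.ofReal ((1 - p) ^ (n - 1)) := by
    intro i _
    rw [coinMeasure_slot t _ fun _ _ => hA.compl, Finset.prod_const,
      Finset.card_erase_of_mem (Finset.mem_univ i), Finset.card_univ, Fintype.card_fin, hAc,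
      ENNReal.ofReal_pow (by linarith)]
  refine (Finset.sum_le_card_nsmul _ _ _ h1).trans ?_
  rw [Finset.card_univ, Fintype.card_fin, nsmul_eq_mul, ← ENNReal.ofReal_natCast,
    ← ENNReal.ofReal_mul (by positivity)]

theorem one_sub_pow_le_exp {p : ℝ} (hp : p ≤ 1) (m : ℕ) :
    (1 - p) ^ m ≤ Real.exp (-(p * m)) := by
  have h1 : 1 - p ≤ Real.exp (-p) := by
    have := Real.add_one_le_exp (-p)
    linarith
  calc (1 - p) ^ m ≤ Real.exp (-p) ^ m := pow_le_pow_left₀ (by linarith) h1 m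
    _ = Real.exp (-(p * m)) := by
      rw [← Real.exp_nat_mul]
      congr 1
      ring

/-- If `n` is much larger than `M`, all cells are crowded: a union bound over the `M` cells of
positive measure and the device that would be alone in one of them. -/
theorem coinMeasure_cell_unique_le {n M : ℕ} (hM : 0 < M) (t : ℕ) :
    coinMeasure n {ω | ∃ q < M + 1, ∃! j, cell M (ω (j, t)) = q} ≤
      ENNReal.ofReal (M * (n * Real.exp (-((n - 1 : ℕ) / M)))) := by
  have hM' : (1 : ℝ) ≤ M := by exact_mod_cast hM
  have hsub : {ω : Coins n | ∃ q < M + 1, ∃! j, cell M (ω (j, t)) = q} ⊆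
      (⋃ q ∈ Finset.range M, {ω | ∃! j, ω (j, t) ∈ {u | cell M u = q}}) ∪
        ⋃ i ∈ (Finset.univ : Finset (Fin n)),
          {ω | ∀ j ∈ ({i} : Finset (Fin n)), ω (j, t) ∈ {u | cell M u = M}} := by
    rintro ω ⟨q, hq, h⟩
    rcases Nat.lt_succ_iff_lt_or_eq.mp hq with h' | rfl
    · left
      simp only [Set.mem_iUnion]
      exact ⟨q, Finset.mem_range.mpr h', h⟩
    · right
      obtain ⟨i, hi, -⟩ := h
      simp only [Set.mem_iUnion]
      exact ⟨i, Finset.mem_univ i, by simpa using hi⟩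
  refine (measure_mono hsub).trans ((measure_union_le _ _).trans ?_)
  have h0 : coinMeasure n (⋃ i ∈ (Finset.univ : Finset (Fin n)),
      {ω | ∀ j ∈ ({i} : Finset (Fin n)), ω (j, t) ∈ {u | cell M u = M}}) = 0 := by
    refine (measure_biUnion_null_iff (Finset.countable_toSet _)).mpr fun i _ => ?_
    rw [coinMeasure_slot t _ fun _ _ => measurableSet_cell M M,
      Finset.prod_singleton, volume_cell_self M hM]
  rw [h0, add_zero]
  have h1 : ∀ q ∈ Finset.range M, coinMeasure n {ω | ∃! j, ω (j, t) ∈ {u | cell M u = q}} ≤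
      ENNReal.ofReal (n * Real.exp (-((n - 1 : ℕ) / M))) := by
    intro q hq
    have hp : 1 / (M : ℝ) ≤ 1 := (div_le_one (by linarith)).mpr hM'
    refine (coinMeasure_existsUnique_le t (measurableSet_cell M q)
      (by positivity) hp (volume_cell hM (Finset.mem_range.mp hq))).trans
      (ENNReal.ofReal_le_ofReal ?_)
    have := one_sub_pow_le_exp hp (n - 1)
    rw [one_div, inv_mul_eq_div] at this
    rw [one_div]
    gcongr
  refine (measure_biUnion_finset_le _ _).trans ((Finset.sum_le_card_nsmul _ _ _ h1).trans ?_)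
  rw [Finset.card_range, nsmul_eq_mul, ← ENNReal.ofReal_natCast,
    ← ENNReal.ofReal_mul (by positivity)]

/-- Trivial-Algorithm. -/
def trivialAlgorithm (N : ℕ) : Subroutine (Option ℕ) :=
  (census N ((N + 1) ^ 4) (((N + 1) ^ 4) ^ 12)).sub

theorem exp_neg_le_div_pow_four {y : ℝ} (hy : 0 < y) : Real.exp (-y) ≤ 24 / y ^ 4 := by
  rw [Real.exp_neg, inv_eq_one_div, div_le_div_iff₀ (Real.exp_pos y) (by positivity), one_mul]
  have := Real.pow_div_factorial_le_exp y hy.le 4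
  rw [div_le_iff₀ (by positivity)] at this
  norm_num [Nat.factorial] at this
  linarith

/-- Put `M = (N + 1) ^ 4`. For `n ≤ N`, identifiers are distinct in both rounds, since `n ^ 4` is at
most either range. For `N < n ≤ M ^ 4` they are still distinct in the second round, whose range `M ^
12` is at least `n ^ 3`. For `n > M ^ 4` the first round is so crowded that no identifier is unique,
and the first count is 0. -/
theorem trivialSpec_trivialAlgorithm (cd : CDModel) : TrivialSpec cd trivialAlgorithm 800 1 := by
  intro N n hn
  have hn1 : (1 : ℝ) ≤ n := by exact_mod_cast hn.1
  rw [Real.rpow_neg_one]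
  rcases Nat.lt_or_ge n 2 with h2 | h2
  · obtain rfl : n = 1 := le_antisymm (by omega) hn.1
    exact prob_le_one.trans (by norm_num)
  set M := (N + 1) ^ 4 with hM
  have hMpos : 0 < M := by positivity
  have hM1 : (1 : ℝ) ≤ M := by exact_mod_cast hMpos
  have hNM : N + 1 ≤ M := Nat.le_self_pow (by norm_num) _
  have hinv : 800 * (n : ℝ)⁻¹ = 800 / n := rfl
  rw [hinv]
  rcases Nat.lt_or_ge N n with hN | hN
  · rcases le_or_gt n (M ^ 4) with hnM | hnM
    · refine (measure_mono (t := {ω | ¬ Function.Injective fun j => cell (M ^ 12) (ω (j, 2))})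
        fun ω hω hinj => absurd (.inl ⟨hN, fun i =>
          census_of_injective_of_lt hN hinj i⟩) hω).trans ?_
      refine (coinMeasure_collision_le (by positivity) 2).trans (ENNReal.ofReal_le_ofReal ?_)
      rw [div_le_div_iff₀ (by positivity) (by positivity)]
      have h3 : (n : ℝ) ^ 3 ≤ ((M ^ 12 : ℕ) : ℝ) := by
        have : n ^ 3 ≤ (M ^ 4) ^ 3 := Nat.pow_le_pow_left hnM 3
        rw [← pow_mul] at this
        exact_mod_cast this
      nlinarith
    · refine (measure_mono (t := {ω | ∃ q < M + 1, ∃! j, cell M (ω (j, 1)) = q})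
        fun ω hω => ?_).trans ?_
      · by_contra hc
        refine absurd (.inl ⟨hN, fun i => census_of_not_unique (fun q hq h => hc ⟨q, hq, h⟩) i⟩) hω
      · refine (coinMeasure_cell_unique_le hMpos 1).trans (ENNReal.ofReal_le_ofReal ?_)
        have hnM' : (M : ℝ) ^ 4 ≤ n := by exact_mod_cast hnM.le
        have hcast : ((n - 1 : ℕ) : ℝ) = n - 1 := by push_cast [Nat.cast_sub hn.1]; ring
        have h2' : (2 : ℝ) ≤ n := by exact_mod_cast h2
        have hy : (n : ℝ) / (2 * M) ≤ ((n - 1 : ℕ) : ℝ) / M := by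
          rw [hcast, div_le_div_iff₀ (by positivity) (by positivity)]
          nlinarith
        have hy0 : 0 < (n : ℝ) / (2 * M) := by positivity
        have h5 : Real.exp (-(((n - 1 : ℕ) : ℝ) / M)) ≤ 24 / ((n : ℝ) / (2 * M)) ^ 4 :=
          (Real.exp_le_exp.mpr (neg_le_neg hy)).trans (exp_neg_le_div_pow_four hy0)
        have h6 : 24 / ((n : ℝ) / (2 * M)) ^ 4 = 384 * (M : ℝ) ^ 4 / (n : ℝ) ^ 4 := by
          field_simp
          ring
        have hMn : (M : ℝ) ≤ n := (le_self_pow₀ hM1 (by norm_num)).trans hnM'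
        calc (M : ℝ) * (n * Real.exp (-(((n - 1 : ℕ) : ℝ) / M)))
            ≤ n * (n * (384 * n / (n : ℝ) ^ 4)) := by
              rw [h6] at h5
              have : 384 * (M : ℝ) ^ 4 / (n : ℝ) ^ 4 ≤ 384 * n / (n : ℝ) ^ 4 := by gcongr
              have := h5.trans this
              gcongr
          _ = 384 / n := by field_simp
          _ ≤ 800 / n := by gcongr; norm_num
  · refine (measure_mono (t := {ω | ¬ Function.Injective fun j => cell M (ω (j, 1))} ∪
      {ω | ¬ Function.Injective fun j => cell (M ^ 12) (ω (j, 2))}) fun ω hω => ?_).trans ?_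
    · by_contra hc
      simp only [Set.mem_union, Set.mem_ofPred_eq, not_or, not_not] at hc
      exact absurd (.inr ⟨n, by linarith, by linarith, fun i =>
        census_of_injective h2 hN hc.1 hc.2 i⟩) hω
    · refine (measure_union_le _ _).trans ((add_le_add (coinMeasure_collision_le hMpos 1)
        (coinMeasure_collision_le (by positivity) 2)).trans ?_)
      rw [← ENNReal.ofReal_add (by positivity) (by positivity)]
      refine ENNReal.ofReal_le_ofReal ?_
      have h4 : (n : ℝ) ^ 4 ≤ M := by
        have : n ^ 4 ≤ M := Nat.pow_le_pow_left (by omega) 4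
        exact_mod_cast this
      have h5 : (n : ℝ) ^ 4 ≤ ((M ^ 12 : ℕ) : ℝ) := by
        push_cast
        exact h4.trans (le_self_pow₀ hM1 (by norm_num))
      have h6 : ∀ K : ℝ, (n : ℝ) ^ 4 ≤ K → 2 * (n : ℝ) ^ 2 / K ≤ 2 / n := fun K hK => by
        calc 2 * (n : ℝ) ^ 2 / K ≤ 2 * (n : ℝ) ^ 2 / (n : ℝ) ^ 4 := by gcongr
          _ = 2 / (n : ℝ) ^ 2 := by field_simp
          _ ≤ 2 / n := by gcongr; nlinarith
      calc _ ≤ 2 / (n : ℝ) + 2 / n := add_le_add (h6 _ h4) (h6 _ h5)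
        _ = 4 / n := by ring
        _ ≤ 800 / n := by gcongr; norm_num

end RadioNetwork
end

noncomputable section
open scoped unitInterval

namespace RadioNetwork

/-! ## Test-Network-Size -/

/-- The states of a device during Test-Network-Size. The time is divided into positions of five
slots each. A `member a j c` is responsible for the positions `a + 1000 * j, …, a + 1000 * j + 999`;
it has joined the token born just before position `a` as the `j`-th member, and as far as it knows,
the token has `c` members. -/
inductive TestState where
  | fresh
  | dead
  | cand
  | helper
  | reg
  | member (a j c : ℕ)

/-- Position `p` is one of those for which member `j` of the token born before `a` is
responsible. -/
def Covers (a j p : ℕ) : Prop := a + 1000 * j ≤ p ∧ p < a + 1000 * j + 1000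

open Classical in
/-- The actions in slot `r` of position `p`. In slot 0, candidates transmit and helpers listen; in
slot 1, helpers that have heard a candidate reply. In slot 2, a registered candidate transmits, and
the member responsible for this position listens; it replies in slot 3. In slot 4, the members
pass on their knowledge. -/
def electionAct (x : ℝ) (r p : ℕ) (s : TestState) (u : I) : Action :=
  match r, s with
  | 0, .fresh =>
    if (u : ℝ) < x⁻¹ then .transmit 0 else if (u : ℝ) < 2 / x then .listen else .idle
  | 1, .cand => .listen
  | 1, .helper => .transmit 0
  | 2, .reg => .transmit 0
  | 2, .member a j _ => if Covers a j p then .listen else .idle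
  | 3, .reg => .listen
  | 3, .member a j c => if Covers a j p then .transmit (Nat.pair a c) else .idle
  | 4, .member a j c =>
    if Covers a j p then (if Covers a j (p + 1) then .idle else .transmit c)
    else if Covers a j (p + 1) then .listen else .idle
  | _, _ => .idle

open Classical in
/-- The state transitions at the end of slot `r` of position `p`. -/
def electionUpd (x : ℝ) (r p : ℕ) (s : TestState) (u : I) (h : Option ℕ) : TestState :=
  match r, s with
  | 0, .fresh =>
    if (u : ℝ) < x⁻¹ then .cand
    else if (u : ℝ) < 2 / x then (if h.isSome then .helper else .dead) else .fresh
  | 1, .cand => if h.isSome then .reg else .dead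
  | 1, .helper => .dead
  | 2, .member a j c => .member a j (tally c h)
  | 3, .reg => h.elim (.member (p + 1) 0 1)
      fun v => .member (Nat.unpair v).1 ((Nat.unpair v).2 - 1) (Nat.unpair v).2
  | 4, .member a j c => .member a j (h.getD c)
  | _, s => s

open Classical in
/-- The member responsible for position `L` is a leader if the token has at least `0.104 L`
members. -/
def TestState.isLeader (L : ℕ) : TestState → Bool
  | .member a j c => decide (Covers a j L ∧ 13 * L ≤ 125 * c)
  | _ => false

def election (x : ℝ) (L : ℕ) : Machine TestState Bool where
  len := 5 * L
  init := .fresh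
  act t := electionAct x (t % 5) (t / 5)
  upd t := electionUpd x (t % 5) (t / 5)
  out := TestState.isLeader L

/-- One slot of the network. -/
def electionStep (cd : CDModel) (x : ℝ) {n : ℕ} (r p : ℕ) (s : Fin n → TestState) (u : Fin n → I)
    (i : Fin n) : TestState :=
  electionUpd x r p (s i) (u i) ((electionAct x r p (s i) (u i)).hears
    (heard cd fun j => electionAct x r p (s j) (u j)))

theorem election_states_succ {cd : CDModel} {x : ℝ} {L n : ℕ} {ω : Coins n} (r p : ℕ)
    (hr : r < 5) :
    (election x L).states cd ω (5 * p + r + 1) =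
      electionStep cd x r p ((election x L).states cd ω (5 * p + r))
        fun i => ω (i, 5 * p + r + 1) := by
  funext i
  have h1 : (5 * p + r) % 5 = r := by omega
  have h2 : (5 * p + r) / 5 = p := by omega
  have ha : (election x L).acts ω (5 * p + r) ((election x L).states cd ω (5 * p + r)) =
      fun j => electionAct x r p ((election x L).states cd ω (5 * p + r) j)
        (ω (j, 5 * p + r + 1)) := by
    funext j
    simp only [Machine.acts, election, h1, h2]
  rw [Machine.states, ha, electionStep]
  simp only [election, h1, h2]

/-- The place of a member in the relay, without its knowledge of the count; uniqueness is a
statement about places only. -/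
def TestState.key : TestState → Option (ℕ × ℕ)
  | .member a j _ => some (a, j)
  | _ => none

/-! ### A single position of the election -/

section Position

variable {cd : CDModel} {x : ℝ} {n : ℕ}

/-- A candidate gets registered: there are exactly one candidate and one helper. -/
def Registers (x : ℝ) (s : Fin n → TestState) (u : Fin n → I) : Prop :=
  (∃! i, s i = .fresh ∧ (u i : ℝ) < x⁻¹) ∧
    ∃! i, s i = .fresh ∧ x⁻¹ ≤ (u i : ℝ) ∧ (u i : ℝ) < 2 / x

/-- The state after registration. -/
def afterRegistration (x : ℝ) (s : Fin n → TestState) (u : Fin n → I) (i : Fin n) : TestState :=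
  open Classical in
  if s i = .fresh then
    if (u i : ℝ) < x⁻¹ then (if Registers x s u then .reg else .dead)
    else if (u i : ℝ) < 2 / x then .dead else .fresh
  else s i

/-- A handshake that works even if transmitters hear nothing. Helpers hear a message only if the
candidate is unique; only then do they reply, and the candidate hears the reply only if the helper
is unique. Everybody else who took a role is dead. -/
theorem electionStep_registration {s : Fin n → TestState}
    (hs : ∀ i, s i ≠ .cand ∧ s i ≠ .helper ∧ s i ≠ .reg) (p : ℕ) (u u' : Fin n → I) :
    electionStep cd x 1 p (electionStep cd x 0 p s u) u' = afterRegistration x s u := by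
  classical
  set A : Fin n → Prop := fun i => s i = .fresh ∧ (u i : ℝ) < x⁻¹ with hA
  set B : Fin n → Prop := fun i => s i = .fresh ∧ x⁻¹ ≤ (u i : ℝ) ∧ (u i : ℝ) < 2 / x with hB
  have h0 : heard cd (fun j => electionAct x 0 p (s j) (u j)) =
      if ∃! i, A i then some 0 else none := by
    refine heard_of_const (fun i hi => ?_) (fun i hi => ?_)
    · simp [electionAct, hi.1, hi.2, Action.sent]
    · rcases hsi : s i with _ | _ | _ | _ | _ | ⟨a, j, c⟩ <;> simp [electionAct, Action.sent]
      have : ¬ (u i : ℝ) < x⁻¹ := fun h => hi ⟨hsi, h⟩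
      rw [if_neg this]
      split_ifs <;> rfl
  set s1 := electionStep cd x 0 p s u with hs1
  have e1 : ∀ i, s1 i = if s i = .fresh then
      if (u i : ℝ) < x⁻¹ then .cand else if (u i : ℝ) < 2 / x then
        (if ∃! i, A i then .helper else .dead) else .fresh else s i := by
    intro i
    rw [hs1, electionStep, h0]
    rcases hsi : s i with _ | _ | _ | _ | _ | ⟨a, j, c⟩ <;> simp [electionUpd, electionAct]
    by_cases h1 : (u i : ℝ) < x⁻¹ <;> by_cases h2 : (u i : ℝ) < 2 / x <;>
      by_cases h3 : ∃! i, A i <;> simp [h1, h2, h3, Action.hears]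
  have hhelp : ∀ i, s1 i = .helper ↔ B i ∧ ∃! i, A i := by
    intro i
    rw [e1]
    by_cases h0 : s i = .fresh
    · by_cases h1 : (u i : ℝ) < x⁻¹
      · simp only [hB, h0, h1, if_true, not_le.mpr h1]
        simp
      · by_cases h2 : (u i : ℝ) < 2 / x <;> by_cases h3 : ∃! i, A i <;>
          simp [hB, h0, h1, h2, h3, not_lt.mp h1]
    · simp [hB, h0, (hs i).2.1]
  have hh1 : heard cd (fun j => electionAct x 1 p (s1 j) (u' j)) =
      if Registers x s u then some 0 else none := by
    have := heard_of_const (cd := cd) (a := fun j => electionAct x 1 p (s1 j) (u' j))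
      (P := fun i => s1 i = .helper) (m := 0) (fun i hi => by simp [electionAct, hi, Action.sent])
      (fun i hi => by
        cases hsi : s1 i <;> first | exact absurd hsi hi | rfl)
    rw [this]
    congr 1
    rw [eq_iff_iff, Registers]
    constructor
    · rintro ⟨i, hi, hu⟩
      exact ⟨((hhelp i).mp hi).2, i, ((hhelp i).mp hi).1,
        fun j hj => hu j ((hhelp j).mpr ⟨hj, ((hhelp i).mp hi).2⟩)⟩
    · rintro ⟨h, i, hi, hu⟩
      exact ⟨i, (hhelp i).mpr ⟨hi, h⟩, fun j hj => hu j ((hhelp j).mp hj).1⟩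
  funext i
  rw [electionStep, hh1, e1, afterRegistration]
  obtain ⟨hc, hh, hr⟩ := hs i
  by_cases h0 : s i = .fresh
  · by_cases h1 : (u i : ℝ) < x⁻¹
    · by_cases hR : Registers x s u <;>
        simp only [h0, h1, hR, if_true, if_false, electionAct, electionUpd, Action.hears] <;> simp
    · by_cases h2 : (u i : ℝ) < 2 / x
      · by_cases h3 : ∃! i, A i <;>
          simp only [h0, h1, h2, h3, if_true, if_false, electionUpd]
      · simp only [h0, h1, h2, if_true, if_false, electionUpd]
  · rw [if_neg h0, if_neg h0]
    cases hsi : s i <;> first | rfl | exact absurd hsi (by assumption)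

/-- The states at the beginning of position `p`, if the latest token has been born before position
`a` and has `m` members. -/
structure TokenInv (p : ℕ) (s : Fin n → TestState) (a m : ℕ) : Prop where
  clean : ∀ i, s i ≠ .cand ∧ s i ≠ .helper ∧ s i ≠ .reg
  member : ∀ i a' j c, s i = .member a' j c → a' + 1000 * j + 1000 ≤ p ∨
    (a' = a ∧ j < m ∧ p < a + 1000 * m ∧ (Covers a j p → c = m))
  unique : p < a + 1000 * m → ∀ j < m, p < a + 1000 * j + 1000 → ∃! i, (s i).key = some (a, j)
  le : a ≤ p

theorem TestState.eq_member_of_key {s : TestState} {a j : ℕ} (h : s.key = some (a, j)) :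
    ∃ c, s = .member a j c := by
  cases s <;> simp [TestState.key] at h
  obtain ⟨rfl, rfl⟩ := h
  exact ⟨_, rfl⟩

/-- The member responsible for the present position. -/
theorem TokenInv.exists_holder {p a m : ℕ} {s : Fin n → TestState} (h : TokenInv p s a m)
    (hp : p < a + 1000 * m) : ∃ i j, s i = .member a j m ∧ Covers a j p ∧
      ∀ i' a' j' c, s i' = .member a' j' c → Covers a' j' p → i' = i := by
  have hle := h.le
  have hj : Covers a ((p - a) / 1000) p := by constructor <;> omega
  have hjm : (p - a) / 1000 < m := by omega
  obtain ⟨i, hi, hu⟩ := h.unique hp _ hjm hj.2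
  obtain ⟨c, hc⟩ := TestState.eq_member_of_key hi
  rcases h.member i _ _ _ hc with h1 | ⟨-, -, -, h1⟩
  · have := hj.2
    omega
  refine ⟨i, _, h1 hj ▸ hc, hj, fun i' a' j' c' hs hcov => hu i' ?_⟩
  rcases h.member i' _ _ _ hs with h2 | ⟨rfl, -, -, -⟩
  · have := hcov.2
    omega
  · have : j' = (p - a') / 1000 := by
      obtain ⟨h3, h4⟩ := hcov
      omega
    rw [hs, this]
    rfl

theorem afterRegistration_eq_reg {s : Fin n → TestState} {u : Fin n → I}
    (hs : ∀ i, s i ≠ .cand ∧ s i ≠ .helper ∧ s i ≠ .reg) (i : Fin n) :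
    afterRegistration x s u i = .reg ↔ (s i = .fresh ∧ (u i : ℝ) < x⁻¹) ∧ Registers x s u := by
  classical
  rw [afterRegistration]
  by_cases h0 : s i = .fresh
  · by_cases h1 : (u i : ℝ) < x⁻¹
    · by_cases hR : Registers x s u <;> simp only [h0, h1, hR] <;> simp
    · by_cases h2 : (u i : ℝ) < 2 / x <;> simp only [h0, h1, h2] <;> simp
  · simp [h0, (hs i).2.2]

theorem existsUnique_reg_iff {s : Fin n → TestState} {u : Fin n → I}
    (hs : ∀ i, s i ≠ .cand ∧ s i ≠ .helper ∧ s i ≠ .reg) :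
    (∃! i, afterRegistration x s u i = .reg) ↔ Registers x s u := by
  simp only [afterRegistration_eq_reg hs]
  constructor
  · rintro ⟨i, hi, -⟩
    exact hi.2
  · intro h
    obtain ⟨i, hi, hu⟩ := h.1
    exact ⟨i, ⟨hi, h⟩, fun j hj => hu j hj.1⟩

theorem afterRegistration_eq_member {s : Fin n → TestState} {u : Fin n → I} {i : Fin n}
    {a j c : ℕ} : afterRegistration x s u i = .member a j c ↔ s i = .member a j c := by
  classical
  rw [afterRegistration]
  by_cases h0 : s i = .fresh
  · by_cases h1 : (u i : ℝ) < x⁻¹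
    · by_cases hR : Registers x s u <;> simp only [h0, h1, hR] <;> simp
    · by_cases h2 : (u i : ℝ) < 2 / x <;> simp only [h0, h1, h2] <;> simp
  · simp [h0]

theorem afterRegistration_clean {s : Fin n → TestState} {u : Fin n → I} {i : Fin n}
    (hs : ∀ i, s i ≠ .cand ∧ s i ≠ .helper ∧ s i ≠ .reg) :
    afterRegistration x s u i ≠ .cand ∧ afterRegistration x s u i ≠ .helper := by
  classical
  rw [afterRegistration]
  by_cases h0 : s i = .fresh
  · by_cases h1 : (u i : ℝ) < x⁻¹
    · by_cases hR : Registers x s u <;> simp only [h0, h1, hR] <;> simp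
    · by_cases h2 : (u i : ℝ) < 2 / x <;> simp only [h0, h1, h2] <;> simp
  · simp [h0, (hs i).1, (hs i).2.1]

open Classical in
/-- Slots 2 to 4, if there is no token alive. -/
theorem electionStep_of_dead {p a m : ℕ} {s : Fin n → TestState} (h : TokenInv p s a m)
    (hp : a + 1000 * m ≤ p) (u u2 u3 u4 : Fin n → I) (i : Fin n) :
    electionStep cd x 4 p (electionStep cd x 3 p (electionStep cd x 2 p
      (afterRegistration x s u) u2) u3) u4 i =
      if afterRegistration x s u i = .reg then .member (p + 1) 0 1
      else afterRegistration x s u i := by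
  set s2 := afterRegistration x s u with hs2
  have hcov : ∀ i a' j c, s2 i = .member a' j c → ¬ Covers a' j p ∧ ¬ Covers a' j (p + 1) := by
    intro i a' j c hi
    rcases h.member i a' j c (afterRegistration_eq_member.mp hi) with h1 | h1
    · exact ⟨fun hc => by have := hc.2; omega, fun hc => by have := hc.2; omega⟩
    · omega
  have hcl : ∀ i, s2 i ≠ .cand ∧ s2 i ≠ .helper := fun i => afterRegistration_clean h.clean
  have e3 : electionStep cd x 2 p s2 u2 = s2 := by
    funext i
    rw [electionStep]
    rcases hsi : s2 i with _ | _ | _ | _ | _ | ⟨a, j, c⟩ <;>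
      simp [electionUpd, electionAct, Action.hears]
    rw [if_neg (hcov i _ _ _ hsi).1]
    rfl
  rw [e3]
  -- No member is responsible for position `p`, so nobody replies in slot 3, and a registered
  -- candidate takes the silence as the order to found a new token at `p + 1`.
  have h3 : heard cd (fun j => electionAct x 3 p (s2 j) (u3 j)) = none := by
    refine heard_of_forall_none fun i => ?_
    rcases hsi : s2 i with _ | _ | _ | _ | _ | ⟨a, j, c⟩ <;> simp [electionAct, Action.sent]
    rw [if_neg (hcov i _ _ _ hsi).1]
  have e4 : electionStep cd x 3 p s2 u3 =
      fun i => if s2 i = .reg then .member (p + 1) 0 1 else s2 i := by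
    funext i
    rw [electionStep, h3]
    rcases hsi : s2 i with _ | _ | _ | _ | _ | ⟨a, j, c⟩ <;>
      simp [electionUpd, electionAct, Action.hears]
  rw [e4]
  have h4 : heard cd (fun j => electionAct x 4 p
      ((fun i => if s2 i = .reg then .member (p + 1) 0 1 else s2 i) j) (u4 j)) = none := by
    refine heard_of_forall_none fun i => ?_
    rcases hsi : s2 i with _ | _ | _ | _ | _ | ⟨a, j, c⟩ <;>
      simp [electionAct, Action.sent, hsi]
    · simp [Covers]
    · rw [if_neg (hcov i _ _ _ hsi).1, if_neg (hcov i _ _ _ hsi).2]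
  rw [electionStep, h4]
  have hnone : ∀ b : Action, b.hears none = none := fun b => by cases b <;> rfl
  rw [hnone]
  rcases hsi : s2 i with _ | _ | _ | _ | _ | ⟨a, j, c⟩ <;> simp [electionUpd]

/-- All old members have expired, so after a registration its candidate is the only member left with
duties. Without a registration the dead token is simply kept. -/
theorem TokenInv.step_of_dead {p a m : ℕ} {s : Fin n → TestState} (h : TokenInv p s a m)
    (hp : a + 1000 * m ≤ p) {u : Fin n → I} {s5 : Fin n → TestState}
    (hs5 : ∀ i, s5 i = open Classical in if afterRegistration x s u i = .reg then
      .member (p + 1) 0 1 else afterRegistration x s u i) :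
    (Registers x s u → TokenInv (p + 1) s5 (p + 1) 1) ∧
      (¬ Registers x s u → TokenInv (p + 1) s5 a m) := by
  classical
  have hle := h.le
  have hreg := fun i => afterRegistration_eq_reg (x := x) (u := u) h.clean i
  have hcl : ∀ i, s5 i ≠ .cand ∧ s5 i ≠ .helper ∧ s5 i ≠ .reg := fun i => by
    rw [hs5]
    have := afterRegistration_clean (x := x) (u := u) (i := i) h.clean
    split_ifs with h1
    · simp
    · exact ⟨this.1, this.2, h1⟩
  have hmem : ∀ i a' j c, s5 i = .member a' j c →
      (afterRegistration x s u i = .reg ∧ a' = p + 1 ∧ j = 0 ∧ c = 1) ∨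
        a' + 1000 * j + 1000 ≤ p := by
    intro i a' j c hi
    rw [hs5] at hi
    split_ifs at hi with h1
    · simp only [TestState.member.injEq] at hi
      exact .inl ⟨h1, hi.1.symm, hi.2.1.symm, hi.2.2.symm⟩
    · rcases h.member i a' j c (afterRegistration_eq_member.mp hi) with h2 | h2
      · exact .inr h2
      · omega
  constructor
  · intro hR
    refine ⟨hcl, fun i a' j c hi => ?_, fun _ j hj _ => ?_, le_rfl⟩
    · rcases hmem i a' j c hi with ⟨-, rfl, rfl, rfl⟩ | h1
      · exact .inr ⟨rfl, zero_lt_one, by omega, fun _ => rfl⟩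
      · exact .inl (by omega)
    · obtain rfl : j = 0 := by omega
      obtain ⟨i, hi, hu⟩ := (existsUnique_reg_iff h.clean).mpr hR
      refine ⟨i, by simp only [hs5, if_pos hi]; rfl, fun i' hi' => hu i' ?_⟩
      obtain ⟨c, hc⟩ := TestState.eq_member_of_key hi'
      rcases hmem _ _ _ _ hc with h1 | h1
      · exact h1.1
      · omega
  · intro hR
    refine ⟨hcl, fun i a' j c hi => ?_, fun h1 => by omega, by omega⟩
    rcases hmem i a' j c hi with ⟨h1, -⟩ | h1
    · exact absurd ((hreg i).mp h1).2 hR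
    · exact .inl (by omega)

open Classical in
/-- Slots 2 to 4, if there is a token alive. -/
theorem electionStep_of_alive {p a m : ℕ} {s : Fin n → TestState} (h : TokenInv p s a m)
    (hp : p < a + 1000 * m) (u u2 u3 u4 : Fin n → I) (i : Fin n) :
    electionStep cd x 4 p (electionStep cd x 3 p (electionStep cd x 2 p
      (afterRegistration x s u) u2) u3) u4 i =
      match afterRegistration x s u i with
      | .reg => .member a m (m + 1)
      | .member a' j c => .member a' j (if Covers a' j p ∨ Covers a' j (p + 1) then
          (if Registers x s u then m + 1 else m) else c)
      | s => s := by
  set s2 := afterRegistration x s u with hs2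
  set m' := if Registers x s u then m + 1 else m with hm'
  obtain ⟨i₀, j₀, hi₀, hcov₀, hu₀⟩ := h.exists_holder hp
  have hi₀' : s2 i₀ = .member a j₀ m := afterRegistration_eq_member.mpr hi₀
  have hu₀' : ∀ i a' j c, s2 i = .member a' j c → Covers a' j p → i = i₀ := fun i a' j c hi =>
    hu₀ i a' j c (afterRegistration_eq_member.mp hi)
  have hmem : ∀ i a' j c, s2 i = .member a' j c → (Covers a' j p ∨ Covers a' j (p + 1)) →
      a' = a ∧ j < m ∧ (Covers a j p → c = m) := by
    intro i a' j c hi hc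
    rcases h.member i a' j c (afterRegistration_eq_member.mp hi) with h1 | h1
    · rcases hc with hc | hc <;> have := hc.2 <;> omega
    · exact ⟨h1.1, h1.2.1, h1.2.2.2⟩
  have hreg := fun i => afterRegistration_eq_reg (x := x) (u := u) h.clean i
  have h2 : heard cd (fun j => electionAct x 2 p (s2 j) (u2 j)) =
      if Registers x s u then some 0 else none := by
    rw [heard_of_const (P := fun i => s2 i = .reg) (m := 0)
      (fun i hi => by simp [electionAct, hi, Action.sent]) (fun i hi => by
        cases hsi : s2 i <;>
          first | exact absurd hsi hi | rfl | (simp only [electionAct]; split_ifs <;> rfl))]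
    simp only [hs2, existsUnique_reg_iff h.clean]
  set s3 : Fin n → TestState := fun i => match s2 i with
    | .member a' j c => .member a' j (if Covers a' j p then m' else c)
    | s => s with hs3
  have e3 : electionStep cd x 2 p s2 u2 = s3 := by
    funext i
    rw [electionStep, h2]
    rcases hsi : s2 i with _ | _ | _ | _ | _ | ⟨a', j, c⟩ <;>
      simp [electionUpd, electionAct, hs3, hsi]
    by_cases hc : Covers a' j p
    · obtain ⟨rfl, -, hcm⟩ := hmem i a' j c hsi (.inl hc)
      rw [if_pos hc, if_pos hc, hcm hc]
      by_cases hR : Registers x s u <;> simp [hR, Action.hears, tally, hm']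
    · rw [if_neg hc, if_neg hc]
      rfl
  rw [e3]
  have hs3mem : ∀ i a' j c, s3 i = .member a' j c → Covers a' j p → i = i₀ := by
    intro i a' j c hi hc
    simp only [hs3] at hi
    rcases hsi : s2 i with _ | _ | _ | _ | _ | ⟨b, k, d⟩ <;> simp [hsi] at hi
    obtain ⟨rfl, rfl, -⟩ := hi
    exact hu₀' i _ _ _ hsi hc
  -- The unique holder `i₀` has already updated its count in slot 2, so the number it sends includes
  -- the new candidate.
  have h3 : heard cd (fun j => electionAct x 3 p (s3 j) (u3 j)) = some (Nat.pair a m') := by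
    refine heard_of_unique (i := i₀) ?_ fun i hi => ?_
    · simp [hs3, hi₀', hcov₀, electionAct, Action.sent]
    · rcases hsi : s3 i with _ | _ | _ | _ | _ | ⟨b, j, c⟩ <;> simp [electionAct, Action.sent]
      rw [if_neg fun hc => hi (hs3mem i _ _ _ hsi hc)]
  set s4 : Fin n → TestState := fun i => match s3 i with
    | .reg => .member a m (m + 1)
    | s => s with hs4
  have e4 : electionStep cd x 3 p s3 u3 = s4 := by
    funext i
    rw [electionStep, h3]
    rcases hsi : s3 i with _ | _ | _ | _ | _ | ⟨b, j, c⟩ <;>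
      simp [electionUpd, electionAct, hs4, hsi, Action.hears]
    have hR : Registers x s u := by
      refine ((hreg i).mp ?_).2
      simp only [hs3] at hsi
      rcases hsj : s2 i with _ | _ | _ | _ | _ | ⟨b, k, d⟩ <;> simp [hsj] at hsi
      exact hsj
    simp [hm', hR]
  rw [e4]
  have hj₀m : j₀ < m := (hmem i₀ a j₀ m hi₀' (.inl hcov₀)).2.1
  have hs4mem : ∀ i a' j c, s4 i = .member a' j c → Covers a' j p → i = i₀ ∧ c = m' := by
    intro i a' j c hi hc
    simp only [hs4, hs3] at hi
    rcases hsi : s2 i with _ | _ | _ | _ | _ | ⟨b, k, d⟩ <;> simp [hsi] at hi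
    · obtain ⟨rfl, rfl, -⟩ := hi
      have := hc.1
      omega
    · obtain ⟨rfl, rfl, rfl⟩ := hi
      exact ⟨hu₀' i _ _ _ hsi hc, if_pos hc⟩
  have hi₀4 : s4 i₀ = .member a j₀ m' := by
    simp [hs4, hs3, hi₀', hcov₀]
  -- The counter is handed over only when the holder's block of 1000 positions ends at `p`.
  have h4 : heard cd (fun j => electionAct x 4 p (s4 j) (u4 j)) =
      if Covers a j₀ (p + 1) then none else some m' := by
    split_ifs with hc
    · refine heard_of_forall_none fun i => ?_
      rcases hsi : s4 i with _ | _ | _ | _ | _ | ⟨b, j, c⟩ <;> simp [electionAct, Action.sent]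
      by_cases hc' : Covers b j p
      · obtain ⟨rfl, rfl⟩ := hs4mem i _ _ _ hsi hc'
        rw [hi₀4] at hsi
        simp only [TestState.member.injEq] at hsi
        obtain ⟨rfl, rfl, -⟩ := hsi
        simp [hc, hc']
      · simp only [hc', if_false]
        split_ifs <;> rfl
    · refine heard_of_unique (i := i₀) ?_ fun i hi => ?_
      · simp [hi₀4, hcov₀, hc, electionAct, Action.sent]
      · rcases hsi : s4 i with _ | _ | _ | _ | _ | ⟨b, j, c⟩ <;> simp [electionAct, Action.sent]
        have hc' : ¬ Covers b j p := fun hc' => hi (hs4mem i _ _ _ hsi hc').1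
        simp only [hc', if_false]
        split_ifs <;> rfl
  rw [electionStep, h4]
  rcases hsi : s2 i with _ | _ | _ | _ | _ | ⟨b, j, c⟩ <;>
    simp [electionUpd, hs4, hs3, hsi, electionAct]
  · have hR : Registers x s u := ((hreg i).mp hsi).2
    have hm1 : m' = m + 1 := by simp [hm', hR]
    rw [hm1]
    -- The new member's block starts at `a + 1000 * m`, which lies beyond `p` since the token is
    -- alive.
    by_cases hc : Covers a m p
    · have := hc.1
      omega
    · rw [if_neg hc]
      split_ifs <;> rfl
  · by_cases hc : Covers b j p
    · simp only [hc, true_or, if_true]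
      split_ifs <;> rfl
    · by_cases hc1 : Covers b j (p + 1)
      · obtain ⟨rfl, -, -⟩ := hmem i b j c hsi (.inr hc1)
        -- A member of the token that covers `p + 1` but not `p` starts at `p + 1`. The holder's
        -- block therefore ends at `p`, so the holder transmits and this member learns the count.
        have hn : ¬ Covers b j₀ (p + 1) := by
          intro h5
          apply hc
          simp only [Covers] at *
          omega
        simp [hc, hc1, hn, Action.hears]
      · simp [hc, hc1, Action.hears]

-- A newcomer takes place `m`, beyond all existing places, so places stay unique. Whoever covers `p
-- + 1` is the old holder, the successor informed in slot 4, or the newcomer, and each of them knows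
-- the new count.
open Classical in
theorem TokenInv.step_of_alive {p a m : ℕ} {s : Fin n → TestState} (h : TokenInv p s a m)
    (hp : p < a + 1000 * m) {u : Fin n → I} {s5 : Fin n → TestState}
    (hs5 : ∀ i, s5 i = match afterRegistration x s u i with
      | .reg => .member a m (m + 1)
      | .member a' j c => .member a' j (if Covers a' j p ∨ Covers a' j (p + 1) then
          (if Registers x s u then m + 1 else m) else c)
      | s => s) :
    TokenInv (p + 1) s5 a (if Registers x s u then m + 1 else m) := by
  set m' := if Registers x s u then m + 1 else m with hm'
  have hle := h.le
  have hmm' : m ≤ m' := by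
    rw [hm']
    split_ifs <;> omega
  have hreg := fun i => afterRegistration_eq_reg (x := x) (u := u) h.clean i
  have hcl : ∀ i, s5 i ≠ .cand ∧ s5 i ≠ .helper ∧ s5 i ≠ .reg := fun i => by
    rw [hs5]
    have := afterRegistration_clean (x := x) (u := u) (i := i) h.clean
    cases hsi : afterRegistration x s u i <;> first | exact absurd hsi this.1 | exact absurd hsi this.2 | simp
  have hmem : ∀ i a' j c, s5 i = .member a' j c →
      (afterRegistration x s u i = .reg ∧ a' = a ∧ j = m ∧ c = m + 1) ∨
        ∃ c', s i = .member a' j c' ∧ c = if Covers a' j p ∨ Covers a' j (p + 1) then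
          m' else c' := by
    intro i a' j c hi
    rw [hs5] at hi
    rcases hsi : afterRegistration x s u i with _ | _ | _ | _ | _ | ⟨b, k, d⟩ <;> simp [hsi] at hi
    · exact .inl ⟨rfl, hi.1.symm, hi.2.1.symm, hi.2.2.symm⟩
    · obtain ⟨rfl, rfl, rfl⟩ := hi
      exact .inr ⟨d, afterRegistration_eq_member.mp hsi, rfl⟩
  refine ⟨hcl, fun i a' j c hi => ?_, fun h1 j hj h2 => ?_, by omega⟩
  · rcases hmem i a' j c hi with ⟨h1, rfl, rfl, rfl⟩ | ⟨c', hc', hc⟩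
    · have hR := ((hreg i).mp h1).2
      have : m' = j + 1 := by simp [hm', hR]
      right
      refine ⟨rfl, by omega, by omega, fun _ => this.symm⟩
    · by_cases hexp : a' + 1000 * j + 1000 ≤ p + 1
      · exact .inl hexp
      · rcases h.member i a' j c' hc' with h3 | ⟨rfl, h3, h4, h5⟩
        · omega
        · refine .inr ⟨rfl, by omega, by omega, fun h6 => ?_⟩
          rw [hc, if_pos (.inr h6)]
  · rcases Nat.lt_or_ge j m with hjm | hjm
    · obtain ⟨i, hi, hu⟩ := h.unique hp j hjm (by omega)
      refine ⟨i, ?_, fun i' hi' => hu i' ?_⟩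
      · obtain ⟨c, hc⟩ := TestState.eq_member_of_key hi
        simp only [hs5, afterRegistration_eq_member.mpr hc]
        rfl
      · obtain ⟨c, hc⟩ := TestState.eq_member_of_key hi'
        rcases hmem i' _ _ _ hc with ⟨-, -, h3, -⟩ | ⟨c', hc', -⟩
        · omega
        · rw [hc']
          rfl
    · have hR : Registers x s u := by
        by_contra hR
        simp only [hm', hR, if_false] at hj
        omega
      have hm1 : m' = m + 1 := by simp [hm', hR]
      obtain rfl : j = m := by omega
      obtain ⟨i, hi, hu⟩ := (existsUnique_reg_iff h.clean).mpr hR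
      refine ⟨i, by simp only [hs5, hi]; rfl, fun i' hi' => hu i' ?_⟩
      obtain ⟨c, hc⟩ := TestState.eq_member_of_key hi'
      rcases hmem i' _ _ _ hc with ⟨h3, -⟩ | ⟨c', hc', -⟩
      · exact h3
      · rcases h.member i' _ _ _ hc' with h3 | h3
        · omega
        · omega

end Position

end RadioNetwork
end

/-! ### The relay over a whole election -/

noncomputable section
open scoped unitInterval

namespace RadioNetwork

open Classical in
/-- The birth place and the number of members of the latest token, if the positions with a
registered candidate are given by `R`. -/
def token (R : ℕ → Prop) : ℕ → ℕ × ℕ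
  | 0 => (0, 0)
  | p + 1 =>
    if R p then
      if p < (token R p).1 + 1000 * (token R p).2 then ((token R p).1, (token R p).2 + 1)
      else (p + 1, 1)
    else token R p

-- Each registration extends the covered range `a + 1000 * m` by 1000: either the token gains a
-- member, or the token is dead, so that the range ended at or before `p`, and a new one covers 1000
-- positions from `p + 1`. Members lost with dead tokens are thus paid for by the birth place `a`.
open Classical in
theorem token_count (R : ℕ → Prop) (p : ℕ) :
    (token R p).2 ≤ Nat.count R p ∧
      1000 * Nat.count R p ≤ (token R p).1 + 1000 * (token R p).2 ∧ (token R p).1 ≤ p := by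
  induction p with
  | zero => simp [token]
  | succ p ih =>
    rw [token, Nat.count_succ]
    split_ifs <;> refine ⟨?_, ?_, ?_⟩ <;> omega

section Election

variable {cd : CDModel} {x : ℝ} {L n : ℕ} {ω : Coins n}

/-- At position `p`, there are exactly one new candidate and one new helper. -/
def Registered (x : ℝ) {n : ℕ} (ω : Coins n) (p : ℕ) : Prop :=
  (∃! i, (∀ q < p, 2 / x ≤ (ω (i, 5 * q + 1) : ℝ)) ∧ (ω (i, 5 * p + 1) : ℝ) < x⁻¹) ∧
    ∃! i, (∀ q < p, 2 / x ≤ (ω (i, 5 * q + 1) : ℝ)) ∧ x⁻¹ ≤ (ω (i, 5 * p + 1) : ℝ) ∧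
      (ω (i, 5 * p + 1) : ℝ) < 2 / x

theorem afterRegistration_eq_fresh {s : Fin n → TestState} {u : Fin n → I} (hx : 0 < x)
    (i : Fin n) : afterRegistration x s u i = .fresh ↔ s i = .fresh ∧ 2 / x ≤ (u i : ℝ) := by
  classical
  have h2x : x⁻¹ ≤ 2 / x := by
    rw [inv_eq_one_div]
    gcongr
    norm_num
  rw [afterRegistration]
  by_cases h0 : s i = .fresh
  · by_cases h1 : (u i : ℝ) < x⁻¹
    · have : ¬ 2 / x ≤ (u i : ℝ) := not_le.mpr (h1.trans_le h2x)
      by_cases hR : Registers x s u <;> simp only [h0, h1, hR, this] <;> simp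
    · by_cases h2 : (u i : ℝ) < 2 / x
      · simp only [h0, h1, h2, not_le.mpr h2]
        simp
      · simp only [h0, h1, h2, not_lt.mp h2]
        simp
  · simp [h0]

theorem election_position (p : ℕ) :
    (election x L).states cd ω (5 * (p + 1)) =
      electionStep cd x 4 p (electionStep cd x 3 p (electionStep cd x 2 p
        (electionStep cd x 1 p (electionStep cd x 0 p ((election x L).states cd ω (5 * p))
          fun i => ω (i, 5 * p + 1)) fun i => ω (i, 5 * p + 2)) fun i => ω (i, 5 * p + 3))
          fun i => ω (i, 5 * p + 4)) fun i => ω (i, 5 * p + 5) := by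
  have h := fun r hr => election_states_succ (cd := cd) (x := x) (L := L) (ω := ω) r p hr
  have h0 := h 0 (by norm_num)
  have h1 := h 1 (by norm_num)
  have h2 := h 2 (by norm_num)
  have h3 := h 3 (by norm_num)
  have h4 := h 4 (by norm_num)
  simp only [add_zero, add_assoc, Nat.reduceAdd] at h0 h1 h2 h3 h4
  rw [mul_add, mul_one, h4, h3, h2, h1, h0]

/-- The network carries out the recursion `token`. Freshness is expressed by the random numbers
alone, which turns registration into an event that does not mention the states. -/
theorem election_invariant (hx : 0 < x) (p : ℕ) :
    TokenInv p ((election x L).states cd ω (5 * p)) (token (Registered x ω) p).1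
        (token (Registered x ω) p).2 ∧
      ∀ i, (election x L).states cd ω (5 * p) i = .fresh ↔
        ∀ q < p, 2 / x ≤ (ω (i, 5 * q + 1) : ℝ) := by
  classical
  induction p with
  | zero =>
    refine ⟨⟨fun i => ?_, fun i a j c h => ?_, fun h => ?_, le_rfl⟩, fun i => ?_⟩
    · simp [Machine.states, election]
    · simp [Machine.states, election] at h
    · simp [token] at h
    · simp [Machine.states, election]
  | succ p ih =>
    obtain ⟨hinv, hfresh⟩ := ih
    set s := (election x L).states cd ω (5 * p) with hs
    set u : Fin n → I := fun i => ω (i, 5 * p + 1) with hu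
    have hR : Registers x s u ↔ Registered x ω p := by
      simp only [Registers, Registered, hfresh, hu]
    have hpos := election_position (cd := cd) (x := x) (L := L) (ω := ω) p
    rw [← hs, electionStep_registration hinv.clean] at hpos
    have hfr : ∀ s5 : Fin n → TestState,
        (∀ i, s5 i = .fresh ↔ afterRegistration x s u i = .fresh) →
        ∀ i, s5 i = .fresh ↔ ∀ q < p + 1, 2 / x ≤ (ω (i, 5 * q + 1) : ℝ) := by
      intro s5 h5 i
      rw [h5, afterRegistration_eq_fresh hx, hfresh, Nat.forall_lt_succ_right]
    by_cases hal : p < (token (Registered x ω) p).1 + 1000 * (token (Registered x ω) p).2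
    · have h5 := fun i => electionStep_of_alive (cd := cd) (x := x) hinv hal u
        (fun i => ω (i, 5 * p + 3)) (fun i => ω (i, 5 * p + 4)) (fun i => ω (i, 5 * p + 5)) i
      rw [← hpos] at h5
      have h6 := hinv.step_of_alive hal h5
      refine ⟨?_, hfr _ fun i => ?_⟩
      · rw [token]
        by_cases hr : Registered x ω p
        · rw [if_pos (hR.mpr hr)] at h6
          rw [if_pos hr, if_pos hal]
          exact h6
        · rw [if_neg (mt hR.mp hr)] at h6
          rw [if_neg hr]
          exact h6
      · rw [h5 i]
        cases afterRegistration x s u i <;> simp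
    · have h5 := fun i => electionStep_of_dead (cd := cd) (x := x) hinv (not_lt.mp hal) u
        (fun i => ω (i, 5 * p + 3)) (fun i => ω (i, 5 * p + 4)) (fun i => ω (i, 5 * p + 5)) i
      rw [← hpos] at h5
      have h6 := hinv.step_of_dead (not_lt.mp hal) h5
      refine ⟨?_, hfr _ fun i => ?_⟩
      · rw [token]
        by_cases hr : Registered x ω p
        · rw [if_pos hr, if_neg hal]
          exact h6.1 (hR.mpr hr)
        · rw [if_neg hr]
          exact h6.2 (mt hR.mp hr)
      · rw [h5 i]
        cases afterRegistration x s u i <;> simp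

theorem mem_leaders_election (i : Fin n) :
    i ∈ leaders cd (election x L).sub ω ↔
      ∃ a j c, (election x L).states cd ω (5 * L) i = .member a j c ∧ Covers a j L ∧
        13 * L ≤ 125 * c := by
  have h1 : i ∈ leaders cd (election x L).sub ω ↔
      (election x L).sub.run.device.result cd ω (election x L).sub.len i = some true := Iff.rfl
  have h2 : (election x L).states cd ω (election x L).len = (election x L).states cd ω (5 * L) :=
    rfl
  rw [h1, Machine.result_eq, h2, Option.some_inj]
  simp only [election]
  cases Machine.states _ cd ω (5 * L) i <;> simp [TestState.isLeader]

open Classical in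
/-- The outcome of the election, depending on the number of registered candidates. -/
theorem election_leaders (hx : 0 < x) (hL : 0 < L) :
    (leaders cd (election x L).sub ω).ncard ≤ 1 ∧
      (105 * L ≤ 1000 * Nat.count (Registered x ω) L →
        (leaders cd (election x L).sub ω).ncard = 1) ∧
      (1000 * Nat.count (Registered x ω) L < 104 * L →
        (leaders cd (election x L).sub ω).ncard = 0) := by
  obtain ⟨hinv, -⟩ := election_invariant (cd := cd) (L := L) (ω := ω) hx L
  have hcount := token_count (Registered x ω) L
  set a := (token (Registered x ω) L).1
  set m := (token (Registered x ω) L).2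
  by_cases hal : L < a + 1000 * m
  · obtain ⟨i, j, hi, hcov, hu⟩ := hinv.exists_holder hal
    have hsub : leaders cd (election x L).sub ω ⊆ {i} := fun i' hi' => by
      obtain ⟨a', j', c, h1, h2, -⟩ := (mem_leaders_election i').mp hi'
      exact hu i' a' j' c h1 h2
    have hle : (leaders cd (election x L).sub ω).ncard ≤ 1 := by
      simpa using Set.ncard_le_ncard hsub
    refine ⟨hle, fun h => ?_, fun h => ?_⟩
    · have : i ∈ leaders cd (election x L).sub ω :=
        -- From `105 * L ≤ a + 1000 * m` and `a ≤ L` follows `104 * L ≤ 1000 * m`, the threshold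
        -- `0.104 L`.
        (mem_leaders_election i).mpr ⟨a, j, m, hi, hcov, by omega⟩
      rw [Set.Subset.antisymm hsub (Set.singleton_subset_iff.mpr this), Set.ncard_singleton]
    · rw [Set.ncard_eq_zero, Set.eq_empty_iff_forall_notMem]
      intro i' hi'
      obtain ⟨a', j', c, h1, h2, h3⟩ := (mem_leaders_election i').mp hi'
      obtain rfl := hu i' a' j' c h1 h2
      rw [hi] at h1
      simp only [TestState.member.injEq] at h1
      omega
  · have : leaders cd (election x L).sub ω = ∅ := by
      rw [Set.eq_empty_iff_forall_notMem]
      intro i' hi'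
      obtain ⟨a', j', c, h1, h2, h3⟩ := (mem_leaders_election i').mp hi'
      rcases hinv.member i' a' j' c h1 with h4 | h4
      · have := h2.2
        omega
      · omega
    rw [this, Set.ncard_empty]
    -- A dead token has `a + 1000 * m ≤ L`, which leaves room for at most `L / 1000` registrations,
    -- far fewer than `0.105 L`.
    exact ⟨zero_le_one, fun h => by omega, fun _ => rfl⟩

/-- A bound on the energy that a device may still spend. -/
def TestState.potential (t : ℕ) : TestState → ℕ
  | .fresh => 3005
  | .dead => 0
  | .cand => 3004
  | .helper => 1
  | .reg => if t % 5 = 3 then 3002 else 3003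
  | .member a j _ =>
    3 * (a + 1000 * j + 1000 - max (t / 5) (a + 1000 * j)) -
        (if a + 1000 * j ≤ t / 5 then t % 5 - 2 else 0) +
      if t / 5 < a + 1000 * j then 1 else 0

theorem potential_member_le (t a j c : ℕ) : (TestState.member a j c).potential t ≤ 3001 := by
  simp only [TestState.potential]
  split_ifs <;> omega

/-- A member is allotted 3 units for each position of its block (listening, replying, and possibly
the hand-over) and 1 for listening just before the block: 3001 in total. Registration adds 2 for
`reg`, 1 more for `cand` and 1 more for `fresh`. -/
theorem election_potential (t : ℕ) (s : TestState) (u : I) (h : Option ℕ) :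
    (electionAct x (t % 5) (t / 5) s u).cost +
      (electionUpd x (t % 5) (t / 5) s u h).potential (t + 1) ≤ s.potential t := by
  obtain ⟨p, r, hr, rfl⟩ : ∃ p r, r < 5 ∧ t = 5 * p + r := ⟨t / 5, t % 5, by omega, by omega⟩
  have h1 : (5 * p + r) % 5 = r := by omega
  have h2 : (5 * p + r) / 5 = p := by omega
  rw [h1, h2]
  have hm : ∀ a j c c', (TestState.member a j c).potential (5 * p + r + 1) ≤
      (TestState.member a j c').potential (5 * p + r) := by
    intro a j c c'
    simp only [TestState.potential, h1, h2]
    split_ifs <;> omega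
  have hm1 : ∀ a j c c', (r = 2 ∨ r = 3) → Covers a j p →
      1 + (TestState.member a j c).potential (5 * p + r + 1) ≤
      (TestState.member a j c').potential (5 * p + r) := by
    rintro a j c c' h3 ⟨h4, h5⟩
    simp only [TestState.potential, h1, h2]
    split_ifs <;> omega
  have hm2 : ∀ a j c c', r = 4 → (Covers a j p ∧ ¬ Covers a j (p + 1) ∨
      ¬ Covers a j p ∧ Covers a j (p + 1)) →
      1 + (TestState.member a j c).potential (5 * p + r + 1) ≤
      (TestState.member a j c').potential (5 * p + r) := by
    rintro a j c c' rfl h4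
    simp only [Covers] at h4
    simp only [TestState.potential, h1, h2]
    split_ifs <;> omega
  cases s with
  | fresh =>
    interval_cases r <;> simp only [electionAct, electionUpd]
    · split_ifs <;> simp [TestState.potential, Action.cost]
    all_goals simp [TestState.potential, Action.cost]
  | dead => interval_cases r <;> simp [electionAct, electionUpd, TestState.potential, Action.cost]
  | cand =>
    interval_cases r <;> simp only [electionAct, electionUpd]
    · simp [TestState.potential, Action.cost]
    · cases h <;> simp [TestState.potential, Action.cost]
      split_ifs <;> omega
    all_goals simp [TestState.potential, Action.cost]
  | helper => interval_cases r <;> simp [electionAct, electionUpd, TestState.potential, Action.cost]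
  | reg =>
    interval_cases r <;> simp only [electionAct, electionUpd]
    · simp only [TestState.potential, Action.cost]
      split_ifs <;> omega
    · simp only [TestState.potential, Action.cost]
      split_ifs <;> omega
    · simp only [TestState.potential, Action.cost]
      split_ifs <;> omega
    · have hreg : TestState.reg.potential (5 * p + 3) = 3002 := by
        simp [TestState.potential, h1]
      rw [hreg]
      cases h with
      | none =>
        have := potential_member_le (5 * p + 3 + 1) (p + 1) 0 1
        simp only [Option.elim, Action.cost]
        omega
      | some v =>
        have := potential_member_le (5 * p + 3 + 1) (Nat.unpair v).1 ((Nat.unpair v).2 - 1)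
          (Nat.unpair v).2
        simp only [Option.elim, Action.cost]
        omega
    · simp only [TestState.potential, Action.cost]
      split_ifs <;> omega
  | member a j c =>
    interval_cases r <;> simp only [electionAct, electionUpd]
    · simpa [Action.cost] using hm a j c c
    · simpa [Action.cost] using hm a j c c
    · split_ifs with hc
      · exact hm1 a j _ c (.inl rfl) hc
      · simpa [Action.cost] using hm a j _ c
    · split_ifs with hc
      · exact hm1 a j _ c (.inr rfl) hc
      · simpa [Action.cost] using hm a j _ c
    · split_ifs with hc hc' hc'
      · simpa [Action.cost] using hm a j _ c
      · exact hm2 a j _ c rfl (.inl ⟨hc, hc'⟩)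
      · exact hm2 a j _ c rfl (.inr ⟨hc, hc'⟩)
      · simpa [Action.cost] using hm a j _ c

theorem election_energyLe : (election x L).sub.run.EnergyLe 3005 :=
  (election x L).energyLe_runFrom (Φ := fun t s => s.potential t)
    (fun t s u h => election_potential t s u h) _ []

end Election

end RadioNetwork
end

/-! ### Independence, Hoeffding bounds and the probability of a unique pair -/

noncomputable section
open scoped unitInterval

namespace RadioNetwork

/-- Families of coordinates with disjoint index sets are independent. -/
theorem iIndepFun_blocks {ι κ J : Type*} {e : ι × κ → J} (he : Function.Injective e) :
    ProbabilityTheory.iIndepFun (fun (i : ι) (ω : J → I) (k : κ) => ω (e (i, k)))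
      (Measure.infinitePi fun _ : J => (volume : Measure I)) := by
  rw [ProbabilityTheory.iIndepFun_iff_map_fun_eq_infinitePi_map (by fun_prop)]
  have h1 := Measure.map_infinitePi_infinitePi_of_inj
    (P := fun _ : J => (volume : Measure I)) he
  have h2 : ∀ i : ι, (Measure.infinitePi fun _ : J => (volume : Measure I)).map
      (fun ω k => ω (e (i, k))) = Measure.infinitePi fun _ : κ => (volume : Measure I) := fun i =>
    Measure.map_infinitePi_infinitePi_of_inj
      (P := fun _ : J => (volume : Measure I)) (f := fun k => e (i, k))
      fun k l h => (Prod.mk.inj (he h)).2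
  simp only [h2]
  rw [← Measure.infinitePi_map_curry (fun _ _ => (volume : Measure I)), ← h1,
    Measure.map_map (by fun_prop) (by fun_prop)]
  rfl

section Hoeffding

open Classical in
theorem count_eq_sum_indicator {Ω : Type*} (E : ℕ → Set Ω) (L : ℕ) (ω : Ω) :
    (Nat.count (fun p => ω ∈ E p) L : ℝ) =
      ∑ p ∈ Finset.range L, (E p).indicator (fun _ => (1 : ℝ)) ω := by
  rw [Nat.count_eq_card_filter_range, Finset.card_filter]
  push_cast
  exact Finset.sum_congr rfl fun p _ => by simp [Set.indicator_apply]

variable {Ω : Type*} [MeasurableSpace Ω] {μ : Measure Ω} [IsProbabilityMeasure μ]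
  {E : ℕ → Set Ω} {q δ : ℝ}

/-- Hoeffding's lemma for a variable with values in `[0, 1]`; the parameter is the squared
half-length of the interval. -/
theorem hasSubgaussianMGF_indicator {F : Set Ω} (hF : MeasurableSet F) :
    ProbabilityTheory.HasSubgaussianMGF
      (fun ω => F.indicator (fun _ => (1 : ℝ)) ω - μ.real F) (1 / 4) μ := by
  have h := ProbabilityTheory.hasSubgaussianMGF_of_mem_Icc (μ := μ) (a := 0) (b := 1)
    (X := F.indicator fun _ => (1 : ℝ)) (measurable_const.indicator hF).aemeasurable
    (ae_of_all _ fun ω => by by_cases h : ω ∈ F <;> simp [h])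
  have h1 : ((‖(1 : ℝ) - 0‖₊ / 2) ^ 2 : NNReal) = 1 / 4 := by
    rw [sub_zero, nnnorm_one]
    norm_num [div_pow]
  rwa [h1, integral_indicator_const _ hF, smul_eq_mul, mul_one] at h

open Classical in
theorem measure_count_ge_le (hE : ∀ p, MeasurableSet (E p))
    (hind : ProbabilityTheory.iIndepFun (fun p => (E p).indicator fun _ => (1 : ℝ)) μ)
    (hq : ∀ p, μ.real (E p) ≤ q) (hδ : 0 ≤ δ) (L : ℕ) :
    μ.real {ω | (q + δ) * L ≤ Nat.count (fun p => ω ∈ E p) L} ≤ Real.exp (-(2 * δ ^ 2 * L)) := by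
  have hi : ProbabilityTheory.iIndepFun
      (fun p ω => (E p).indicator (fun _ => (1 : ℝ)) ω - μ.real (E p)) μ :=
    hind.comp (fun p y => y - μ.real (E p)) fun p => by fun_prop
  have h := ProbabilityTheory.HasSubgaussianMGF.measure_sum_range_ge_le_of_iIndepFun hi (c := 1 / 4) (n := L)
    (fun p _ => hasSubgaussianMGF_indicator (hE p)) (ε := δ * L) (by positivity)
  refine (measureReal_mono fun ω hω => ?_).trans (h.trans (Real.exp_le_exp.mpr ?_))
  · have hω : (q + δ) * L ≤ Nat.count (fun p => ω ∈ E p) L := hω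
    have h1 : ∑ p ∈ Finset.range L, μ.real (E p) ≤ L * q := by
      simpa using Finset.sum_le_card_nsmul (Finset.range L) _ q fun p _ => hq p
    rw [count_eq_sum_indicator] at hω
    rw [Set.mem_ofPred_eq, Finset.sum_sub_distrib]
    linarith
  · rcases Nat.eq_zero_or_pos L with rfl | hL
    · simp
    · have : (0 : ℝ) < L := Nat.cast_pos.mpr hL
      apply le_of_eq
      push_cast
      field_simp
      ring

open Classical in
theorem measure_count_le_le (hE : ∀ p, MeasurableSet (E p))
    (hind : ProbabilityTheory.iIndepFun (fun p => (E p).indicator fun _ => (1 : ℝ)) μ)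
    (hq : ∀ p, q ≤ μ.real (E p)) (hδ : 0 ≤ δ) (L : ℕ) :
    μ.real {ω | (Nat.count (fun p => ω ∈ E p) L : ℝ) ≤ (q - δ) * L} ≤
      Real.exp (-(2 * δ ^ 2 * L)) := by
  have hi : ProbabilityTheory.iIndepFun
      (fun p ω => -((E p).indicator (fun _ => (1 : ℝ)) ω - μ.real (E p))) μ :=
    hind.comp (fun p y => -(y - μ.real (E p))) fun p => by fun_prop
  have h := ProbabilityTheory.HasSubgaussianMGF.measure_sum_range_ge_le_of_iIndepFun hi (c := 1 / 4) (n := L)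
    (fun p _ => (hasSubgaussianMGF_indicator (hE p)).neg) (ε := δ * L) (by positivity)
  refine (measureReal_mono fun ω hω => ?_).trans (h.trans (Real.exp_le_exp.mpr ?_))
  · have hω : (Nat.count (fun p => ω ∈ E p) L : ℝ) ≤ (q - δ) * L := hω
    have h1 : L * q ≤ ∑ p ∈ Finset.range L, μ.real (E p) := by
      simpa using Finset.card_nsmul_le_sum (Finset.range L) _ q fun p _ => hq p
    rw [count_eq_sum_indicator] at hω
    rw [Set.mem_ofPred_eq, Finset.sum_neg_distrib, Finset.sum_sub_distrib]
    linarith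
  · rcases Nat.eq_zero_or_pos L with rfl | hL
    · simp
    · have : (0 : ℝ) < L := Nat.cast_pos.mpr hL
      apply le_of_eq
      push_cast
      field_simp
      ring

end Hoeffding

/-- The probability that in one slot exactly one random number lies in `A` and exactly one
in `B`. -/
theorem coinMeasure_unique_unique {n : ℕ} (t : ℕ) {A B : Set I} (hA : MeasurableSet A)
    (hB : MeasurableSet B) (hAB : Disjoint A B) {p : ℝ} (hp : 0 ≤ p) (hp2 : 2 * p ≤ 1)
    (hvA : volume A = ENNReal.ofReal p) (hvB : volume B = ENNReal.ofReal p) :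
    coinMeasure n {ω | (∃! i, ω (i, t) ∈ A) ∧ ∃! i, ω (i, t) ∈ B} =
      ENNReal.ofReal (n * (n - 1 : ℕ) * p ^ 2 * (1 - 2 * p) ^ (n - 2)) := by
  classical
  set D : Fin n × Fin n → Fin n → Set I := fun x i =>
    if i = x.1 then A else if i = x.2 then B else (A ∪ B)ᶜ with hD
  have hDm : ∀ x i, MeasurableSet (D x i) := by
    intro x i
    simp only [hD]
    split_ifs
    exacts [hA, hB, (hA.union hB).compl]
  have hset : {ω : Coins n | (∃! i, ω (i, t) ∈ A) ∧ ∃! i, ω (i, t) ∈ B} =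
      ⋃ x ∈ (Finset.univ : Finset (Fin n)).offDiag,
        {ω | ∀ i ∈ Finset.univ, ω (i, t) ∈ D x i} := by
    ext ω
    simp only [Set.mem_ofPred_eq, Set.mem_iUnion, Finset.mem_offDiag, Finset.mem_univ, true_and,
      forall_const, exists_prop]
    constructor
    · rintro ⟨⟨i, hi, hi'⟩, j, hj, hj'⟩
      have hij : i ≠ j := fun h => hAB.le_bot ⟨hi, h ▸ hj⟩
      refine ⟨(i, j), hij, fun k => ?_⟩
      simp only [hD]
      split_ifs with h1 h2
      · rwa [h1]
      · rwa [h2]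
      · rintro (h | h)
        · exact h1 (hi' k h)
        · exact h2 (hj' k h)
    · rintro ⟨⟨i, j⟩, hij, h⟩
      simp only [hD] at h hij
      have hi := h i
      have hj := h j
      rw [if_pos rfl] at hi
      rw [if_neg hij.symm, if_pos rfl] at hj
      refine ⟨⟨i, hi, fun k hk => ?_⟩, j, hj, fun k hk => ?_⟩
      · by_contra hki
        have := h k
        rw [if_neg hki] at this
        split_ifs at this
        · exact hAB.le_bot ⟨hk, this⟩
        · exact this (.inl hk)
      · by_contra hkj
        have := h k
        rw [if_neg hkj] at this
        split_ifs at this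
        · exact hAB.le_bot ⟨this, hk⟩
        · exact this (.inr hk)
  have hvC : volume (A ∪ B)ᶜ = ENNReal.ofReal (1 - 2 * p) := by
    rw [prob_compl_eq_one_sub (hA.union hB), measure_union hAB hB, hvA, hvB,
      ← ENNReal.ofReal_add hp hp, ENNReal.ofReal_sub _ (by positivity), ENNReal.ofReal_one, two_mul]
  have hprod : ∀ x ∈ (Finset.univ : Finset (Fin n)).offDiag,
      coinMeasure n {ω | ∀ i ∈ Finset.univ, ω (i, t) ∈ D x i} =
        ENNReal.ofReal (p ^ 2 * (1 - 2 * p) ^ (n - 2)) := by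
    rintro ⟨i, j⟩ hx
    have hij : i ≠ j := (Finset.mem_offDiag.mp hx).2.2
    rw [coinMeasure_slot t Finset.univ fun i _ => hDm _ i,
      ← Finset.mul_prod_erase _ _ (Finset.mem_univ i),
      ← Finset.mul_prod_erase _ _ (Finset.mem_erase.mpr ⟨hij.symm, Finset.mem_univ j⟩)]
    rw [Finset.prod_congr rfl (g := fun _ => ENNReal.ofReal (1 - 2 * p)) fun k hk => by
      rw [Finset.mem_erase, Finset.mem_erase] at hk
      simp only [hD, if_neg hk.1, if_neg hk.2.1, hvC]]
    simp only [hD, if_neg hij.symm, if_true, hvA, hvB, Finset.prod_const]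
    rw [Finset.card_erase_of_mem (Finset.mem_erase.mpr ⟨hij.symm, Finset.mem_univ j⟩),
      Finset.card_erase_of_mem (Finset.mem_univ i), Finset.card_univ, Fintype.card_fin,
      ← ENNReal.ofReal_pow (by linarith), ← ENNReal.ofReal_mul hp, ← ENNReal.ofReal_mul hp,
      Nat.sub_sub, pow_two, mul_assoc]
  rw [hset, measure_biUnion_finset]
  · rw [Finset.sum_congr rfl hprod, Finset.sum_const, Finset.offDiag_card, Finset.card_univ,
      Fintype.card_fin, nsmul_eq_mul, ← ENNReal.ofReal_natCast, ← ENNReal.ofReal_mul (by positivity),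
      ← Nat.mul_sub_one]
    push_cast
    congr 1
    ring
  · intro x hx y hy hne
    refine Set.disjoint_left.mpr fun ω h h' => hne ?_
    -- The outcome determines the ordered pair: the first entry is the device whose number lies in
    -- `A`, the second the one in `B`. Hence the events for different pairs are disjoint.
    have hAi : ∀ x : Fin n × Fin n, ω ∈ {ω : Coins n | ∀ i ∈ Finset.univ, ω (i, t) ∈ D x i} →
        x.1 ≠ x.2 → ∀ k, (ω (k, t) ∈ A ↔ k = x.1) ∧ (ω (k, t) ∈ B ↔ k = x.2) := by
      intro x hx hne k
      have hk := hx k (Finset.mem_univ k)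
      simp only [hD] at hk
      split_ifs at hk with h1 h2
      · exact ⟨iff_of_true hk h1, iff_of_false (fun h => hAB.le_bot ⟨hk, h⟩) (h1 ▸ hne)⟩
      · exact ⟨iff_of_false (fun h => hAB.le_bot ⟨h, hk⟩) h1, iff_of_true hk h2⟩
      · exact ⟨iff_of_false (fun h => hk (.inl h)) h1, iff_of_false (fun h => hk (.inr h)) h2⟩
    have hx' := hAi x h (Finset.mem_offDiag.mp (Finset.mem_coe.mp hx)).2.2
    have hy' := hAi y h' (Finset.mem_offDiag.mp (Finset.mem_coe.mp hy)).2.2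
    exact Prod.ext ((hy' x.1).1.mp ((hx' x.1).1.mpr rfl)) ((hy' x.2).2.mp ((hx' x.2).2.mpr rfl))
  · intro x _
    have : {ω : Coins n | ∀ i ∈ Finset.univ, ω (i, t) ∈ D x i} =
        ⋂ i, (fun ω => ω (i, t)) ⁻¹' D x i := by
      ext ω
      simp
    rw [this]
    exact MeasurableSet.iInter fun i => (hDm x i).preimage (by fun_prop)

end RadioNetwork
end

noncomputable section
open scoped unitInterval

namespace RadioNetwork

/-! ### Test-Network-Size -/

/-- By convexity `exp` lies below its chord on `[2/3, 3/2]`. It therefore suffices to compare `exp`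
with `l / 0.33` at the two end points, where the bounds 2.02 and 4.545 just work. -/
theorem le_mul_exp_neg {l : ℝ} (h1 : 2 / 3 ≤ l) (h2 : l ≤ 3 / 2) : 0.33 ≤ l * Real.exp (-l) := by
  have he : Real.exp 1 ≤ 2.7182818286 := Real.exp_one_lt_d9.le
  have hp := Real.exp_pos
  have e1 : Real.exp (2 / 3) ≤ 2.02 := by
    have : Real.exp (2 / 3) ^ 3 ≤ 2.02 ^ 3 := by
      rw [← Real.exp_nat_mul, show ((3 : ℕ) : ℝ) * (2 / 3) = ((2 : ℕ) : ℝ) * 1 by norm_num,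
        Real.exp_nat_mul]
      calc Real.exp 1 ^ 2 ≤ 2.7182818286 ^ 2 := by gcongr
        _ ≤ _ := by norm_num
    exact le_of_pow_le_pow_left₀ (by norm_num) (by norm_num) this
  have e2 : Real.exp (3 / 2) ≤ 4.545 := by
    have : Real.exp (3 / 2) ^ 2 ≤ 4.545 ^ 2 := by
      rw [← Real.exp_nat_mul, show ((2 : ℕ) : ℝ) * (3 / 2) = ((3 : ℕ) : ℝ) * 1 by norm_num,
        Real.exp_nat_mul]
      calc Real.exp 1 ^ 3 ≤ 2.7182818286 ^ 3 := by gcongr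
        _ ≤ _ := by norm_num
    exact le_of_pow_le_pow_left₀ (by norm_num) (by norm_num) this
  have hc := convexOn_exp.2 (Set.mem_univ (2 / 3 : ℝ)) (Set.mem_univ (3 / 2 : ℝ))
    (show (0 : ℝ) ≤ (9 - 6 * l) / 5 by linarith) (show (0 : ℝ) ≤ (6 * l - 4) / 5 by linarith)
    (by ring)
  simp only [smul_eq_mul] at hc
  rw [show (9 - 6 * l) / 5 * (2 / 3) + (6 * l - 4) / 5 * (3 / 2) = l by ring] at hc
  have h3 : (9 - 6 * l) / 5 * Real.exp (2 / 3) ≤ (9 - 6 * l) / 5 * 2.02 :=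
    mul_le_mul_of_nonneg_left e1 (by linarith)
  have h4 : (6 * l - 4) / 5 * Real.exp (3 / 2) ≤ (6 * l - 4) / 5 * 4.545 :=
    mul_le_mul_of_nonneg_left e2 (by linarith)
  rw [Real.exp_neg, ← div_eq_mul_inv, le_div_iff₀ (hp l)]
  linarith

/-- To the right of 1.9, `exp` lies above the line `6 * (l - 0.9)`, obtained from `exp 1.9 ≥ 6`; to
the left of `1 / 1.9` the quadratic Taylor bound is enough. -/
theorem mul_exp_neg_le {l : ℝ} (h0 : 0 ≤ l) (h : 1.9 ≤ l ∨ l ≤ 1 / 1.9) :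
    l * Real.exp (-l) ≤ 0.317 := by
  have hp := Real.exp_pos
  rw [Real.exp_neg, ← div_eq_mul_inv, div_le_iff₀ (hp l)]
  rcases h with h | h
  · have e1 : (6 : ℝ) ≤ Real.exp 1.9 := by
      have h1 : (2.7 : ℝ) ≤ Real.exp 1 := by
        have := Real.exp_one_gt_d9
        linarith
      have h2 := Real.add_one_le_exp (-0.1 : ℝ)
      have h3 : Real.exp 1.9 = Real.exp 1 * Real.exp 1 * Real.exp (-0.1) := by
        rw [← Real.exp_add, ← Real.exp_add]
        norm_num
      rw [h3]
      calc (6 : ℝ) ≤ 2.7 * 2.7 * 0.9 := by norm_num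
        _ ≤ _ := by
          gcongr
          linarith
    have e2 : Real.exp l = Real.exp 1.9 * Real.exp (l - 1.9) := by
      rw [← Real.exp_add]
      ring_nf
    have e3 := Real.add_one_le_exp (l - 1.9)
    have : 6 * (l - 1.9 + 1) ≤ Real.exp l := by
      rw [e2]
      exact mul_le_mul e1 e3 (by linarith) (hp _).le
    linarith
  · have e1 := Real.quadratic_le_exp_of_nonneg h0
    norm_num at h ⊢
    nlinarith

/-- The probability that `n` devices have, with probability `1 / x` each, exactly one candidate
and exactly one helper. -/
def pairProb (n : ℕ) (x : ℝ) : ℝ := n * (n - 1 : ℕ) * x⁻¹ ^ 2 * (1 - 2 * x⁻¹) ^ (n - 2)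

/-- The probability is `(l * exp (-l)) ^ 2` up to the corrections `1 - 1 / n` and `exp (-(4 * l / (x
- 2)))`, both very close to 1 when `x ≥ 10000`; `0.33 ^ 2 = 0.1089` leaves room for them. -/
theorem le_pairProb {n : ℕ} {x : ℝ} (hx : 10000 ≤ x) (h1 : (n : ℝ) / 1.5 ≤ x) (h2 : x ≤ 1.5 * n) :
    0.107 ≤ pairProb n x := by
  have hx0 : 0 < x := by linarith
  have hn : (6666 : ℝ) ≤ n := by linarith
  have hn1 : 1 ≤ n := by exact_mod_cast (by linarith : (1 : ℝ) ≤ n)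
  set l : ℝ := n / x with hl
  have hl1 : 2 / 3 ≤ l := by
    rw [hl, le_div_iff₀ hx0]
    linarith
  have hl2 : l ≤ 3 / 2 := by
    rw [hl, div_le_iff₀ hx0]
    rw [div_le_iff₀ (by norm_num)] at h1
    linarith
  have hl0 := le_mul_exp_neg hl1 hl2
  -- This is `1 + t ≤ exp t` at `t = 2 / (x - 2)`, since `1 + t` is the inverse of `1 - 2 / x`.
  have hb : Real.exp (-(2 / (x - 2))) ≤ 1 - 2 * x⁻¹ := by
    have := Real.add_one_le_exp (2 / (x - 2))
    rw [Real.exp_neg, inv_le_comm₀ (Real.exp_pos _)]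
    · refine le_trans (le_of_eq ?_) this
      have : x - 2 ≠ 0 := by linarith
      field_simp
      ring
    · rw [sub_pos, ← div_eq_mul_inv, div_lt_one hx0]
      linarith
  have hpow : Real.exp (-(2 * l)) * (1 - 0.0007) ≤ (1 - 2 * x⁻¹) ^ (n - 2) := by
    have h3 : Real.exp (-(2 / (x - 2))) ^ n ≤ (1 - 2 * x⁻¹) ^ n := by gcongr
    have h4 : (1 - 2 * x⁻¹) ^ n ≤ (1 - 2 * x⁻¹) ^ (n - 2) := by
      refine pow_le_pow_of_le_one ((Real.exp_pos _).le.trans hb) ?_ (Nat.sub_le _ _)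
      have := inv_pos.mpr hx0
      linarith
    refine le_trans ?_ (h3.trans h4)
    have h5 : Real.exp (-(2 / (x - 2))) ^ n =
        Real.exp (-(2 * l)) * Real.exp (-(4 * l / (x - 2))) := by
      rw [← Real.exp_nat_mul, ← Real.exp_add, hl]
      congr 1
      have : x - 2 ≠ 0 := by linarith
      field_simp
      ring
    rw [h5]
    have h6 := Real.add_one_le_exp (-(4 * l / (x - 2)))
    have h7 : 4 * l / (x - 2) ≤ 0.0007 := by
      rw [div_le_iff₀ (by linarith)]
      linarith
    gcongr
    linarith
  have h8 : (l * Real.exp (-l)) ^ 2 = l ^ 2 * Real.exp (-(2 * l)) := by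
    rw [mul_pow, ← Real.exp_nat_mul]
    push_cast
    ring_nf
  have h9 : (n : ℝ) * (n - 1 : ℕ) * x⁻¹ ^ 2 = l ^ 2 * (1 - 1 / n) := by
    rw [hl, Nat.cast_sub hn1]
    field_simp
    push_cast
    ring
  have h10 : (1 : ℝ) / n ≤ 0.0002 := by
    rw [div_le_iff₀ (by linarith)]
    linarith
  rw [pairProb, h9]
  calc (0.107 : ℝ) ≤ 0.33 ^ 2 * (1 - 0.0002) * (1 - 0.0007) := by norm_num
    _ ≤ (l * Real.exp (-l)) ^ 2 * (1 - 1 / n) * (1 - 0.0007) := by gcongr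
    _ = l ^ 2 * (1 - 1 / n) * (Real.exp (-(2 * l)) * (1 - 0.0007)) := by
      rw [h8]
      ring
    _ ≤ _ := by
      gcongr
      have : (0 : ℝ) ≤ 1 - 1 / n := by linarith
      positivity

theorem pairProb_le {n : ℕ} {x : ℝ} (hx : 10000 ≤ x) (h : 1.9 * n ≤ x ∨ x ≤ n / 1.9) :
    pairProb n x ≤ 0.102 := by
  have hx0 : 0 < x := by linarith
  rcases lt_or_ge n 2 with hn | hn
  -- Fewer than two devices never form a pair; this case is separated because `n - 2` is truncated
  -- subtraction.
  · have : (n : ℝ) * (n - 1 : ℕ) = 0 := by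
      interval_cases n <;> simp
    rw [pairProb, this]
    norm_num
  set l : ℝ := n / x with hl
  have hl0 := mul_exp_neg_le (l := l) (by positivity) (by
    rcases h with h | h
    · right
      rw [hl, div_le_div_iff₀ hx0 (by norm_num)]
      linarith
    · left
      rw [hl, le_div_iff₀ hx0]
      rw [le_div_iff₀ (by norm_num)] at h
      linarith)
  have hinv : 2 * x⁻¹ ≤ 1 := by
    rw [← div_eq_mul_inv, div_le_one hx0]
    linarith
  have h1 := one_sub_pow_le_exp hinv (n - 2)
  have h2 : Real.exp (-(2 * x⁻¹ * (n - 2 : ℕ))) = Real.exp (-(2 * l)) * Real.exp (4 / x) := by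
    rw [← Real.exp_add, hl, Nat.cast_sub hn]
    congr 1
    push_cast
    field_simp
    ring
  have h3 : Real.exp (4 / x) ≤ 1.001 := by
    have h4 := Real.add_one_le_exp (-(4 / x))
    have h5 : 4 / x ≤ 0.0005 := by
      rw [div_le_iff₀ hx0]
      linarith
    rw [Real.exp_neg] at h4
    have h6 : (0.9995 : ℝ) ≤ (Real.exp (4 / x))⁻¹ := by linarith
    rw [le_inv_comm₀ (by norm_num) (Real.exp_pos _)] at h6
    refine h6.trans (by norm_num)
  have h8 : (l * Real.exp (-l)) ^ 2 = l ^ 2 * Real.exp (-(2 * l)) := by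
    rw [mul_pow, ← Real.exp_nat_mul]
    push_cast
    ring_nf
  have h9 : (n : ℝ) * (n - 1 : ℕ) * x⁻¹ ^ 2 ≤ l ^ 2 := by
    rw [hl, div_pow, div_eq_mul_inv, ← inv_pow, sq (n : ℝ)]
    gcongr
    exact Nat.sub_le _ _
  rw [pairProb]
  calc _ ≤ l ^ 2 * (Real.exp (-(2 * l)) * Real.exp (4 / x)) := by
        rw [← h2]
        exact mul_le_mul h9 h1 (pow_nonneg (by linarith) _) (by positivity)
    _ = (l * Real.exp (-l)) ^ 2 * Real.exp (4 / x) := by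
      rw [h8]
      ring
    _ ≤ 0.317 ^ 2 * 1.001 := by
      have : 0 ≤ l * Real.exp (-l) := by positivity
      gcongr
    _ ≤ _ := by norm_num

theorem pow_nine_mul_exp_neg_le {y : ℝ} (hy : 0 < y) : Real.exp (-y) ≤ 362880 / y ^ 9 := by
  rw [Real.exp_neg, inv_eq_one_div, div_le_div_iff₀ (Real.exp_pos y) (by positivity), one_mul]
  have := Real.pow_div_factorial_le_exp y hy.le 9
  rw [div_le_iff₀ (by positivity)] at this
  norm_num [Nat.factorial] at this
  linarith

section

variable {x : ℝ} {n : ℕ}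

/-- No device picks a role twice, apart from an event of small probability. -/
theorem coinMeasure_twice_le (hx : 2 ≤ x) (L : ℕ) :
    coinMeasure n {ω | ∃ i, ∃ p < L, ∃ q < p, (ω (i, 5 * q + 1) : ℝ) < 2 / x ∧
      (ω (i, 5 * p + 1) : ℝ) < 2 / x} ≤ ENNReal.ofReal (4 * n * L ^ 2 / x ^ 2) := by
  have hx0 : 0 < x := by linarith
  have h1 : 2 / x ≤ 1 := by rwa [div_le_one hx0]
  have hv : volume {u : I | (u : ℝ) < 2 / x} = ENNReal.ofReal (2 / x) := by
    have := volume_Ico (a := 0) (b := 2 / x) le_rfl h1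
    rw [sub_zero] at this
    rw [← this]
    congr 1
    ext u
    simp [u.2.1]
  have hm : MeasurableSet {u : I | (u : ℝ) < 2 / x} :=
    measurableSet_lt (by fun_prop) measurable_const
  have hpair : ∀ (i : Fin n) (p q : ℕ), q < p →
      coinMeasure n {ω | (ω (i, 5 * q + 1) : ℝ) < 2 / x ∧ (ω (i, 5 * p + 1) : ℝ) < 2 / x} =
        ENNReal.ofReal (4 / x ^ 2) := by
    intro i p q hqp
    have h := coinMeasure_pi {(i, 5 * q + 1), (i, 5 * p + 1)}
      (A := fun _ => {u : I | (u : ℝ) < 2 / x}) fun _ _ => hm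
    have hne : ((i, 5 * q + 1) : Fin n × ℕ) ≠ (i, 5 * p + 1) := by
      simp
      omega
    rw [Finset.prod_pair hne, hv, ← ENNReal.ofReal_mul (by positivity)] at h
    convert h using 2
    · ext ω
      simp
    · field_simp
      norm_num
  have hsub : {ω : Coins n | ∃ i, ∃ p < L, ∃ q < p, (ω (i, 5 * q + 1) : ℝ) < 2 / x ∧
      (ω (i, 5 * p + 1) : ℝ) < 2 / x} ⊆
      ⋃ i ∈ (Finset.univ : Finset (Fin n)), ⋃ p ∈ Finset.range L, ⋃ q ∈ Finset.range p,
        {ω | (ω (i, 5 * q + 1) : ℝ) < 2 / x ∧ (ω (i, 5 * p + 1) : ℝ) < 2 / x} := by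
    rintro ω ⟨i, p, hp, q, hq, h⟩
    simp only [Set.mem_iUnion, Finset.mem_range]
    exact ⟨i, Finset.mem_univ i, p, hp, q, hq, h⟩
  refine (measure_mono hsub).trans ?_
  calc _ ≤ ∑ i : Fin n, ∑ p ∈ Finset.range L, ∑ q ∈ Finset.range p,
        ENNReal.ofReal (4 / x ^ 2) := by
        refine (measure_biUnion_finset_le _ _).trans (Finset.sum_le_sum fun i _ => ?_)
        refine (measure_biUnion_finset_le _ _).trans (Finset.sum_le_sum fun p _ => ?_)
        refine (measure_biUnion_finset_le _ _).trans (Finset.sum_le_sum fun q hq => ?_)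
        exact (hpair i p q (Finset.mem_range.mp hq)).le
    _ ≤ ∑ i : Fin n, ∑ p ∈ Finset.range L, L * ENNReal.ofReal (4 / x ^ 2) := by
        refine Finset.sum_le_sum fun i _ => Finset.sum_le_sum fun p hp => ?_
        rw [Finset.sum_const, Finset.card_range, nsmul_eq_mul]
        gcongr
        exact (Finset.mem_range.mp hp).le
    _ = ENNReal.ofReal (4 * n * L ^ 2 / x ^ 2) := by
        simp only [Finset.sum_const, Finset.card_range, Finset.card_univ, Fintype.card_fin,
          nsmul_eq_mul]
        rw [← ENNReal.ofReal_natCast, ← ENNReal.ofReal_natCast,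
          ← ENNReal.ofReal_mul (by positivity), ← ENNReal.ofReal_mul (by positivity),
          ← ENNReal.ofReal_mul (by positivity)]
        congr 1
        ring

/-- A large network does not register any candidate, apart from an event of small probability. -/
theorem coinMeasure_registered_le (hx : 2 ≤ x) {p : ℕ} (hp : 4 * p ≤ x) :
    coinMeasure n {ω | Registered x ω p} ≤
      ENNReal.ofReal (n * Real.exp (-(1 / (2 * x) * (n - 1 : ℕ)))) := by
  have hx0 : 0 < x := by linarith
  have h2x : 2 / x ≤ 1 := by rwa [div_le_one hx0]
  have h1x : x⁻¹ ≤ 1 := inv_le_one_of_one_le₀ (by linarith)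
  -- The random numbers of a device that takes no role before position `p` and becomes a candidate
  -- there.
  set B : Set (ℕ → I) := {u | (∀ q < p, 2 / x ≤ (u (5 * q + 1) : ℝ)) ∧ (u (5 * p + 1) : ℝ) < x⁻¹}
    with hB
  have hBm : MeasurableSet B := by
    have : B = (⋂ q ∈ Finset.range p, {u : ℕ → I | 2 / x ≤ (u (5 * q + 1) : ℝ)}) ∩
        {u : ℕ → I | (u (5 * p + 1) : ℝ) < x⁻¹} := by
      ext u
      simp [hB]
    rw [this]
    refine (Finset.measurableSet_biInter _ fun q _ => ?_).inter ?_
    · exact measurableSet_le measurable_const (by fun_prop)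
    · exact measurableSet_lt (by fun_prop) measurable_const
  have hBp : ∀ i : Fin n, ENNReal.ofReal (1 / (2 * x)) ≤
      coinMeasure n ((fun ω t => ω (i, t)) ⁻¹' B) := by
    intro i
    let e : ℕ ↪ Fin n × ℕ := ⟨fun q => (i, 5 * q + 1), fun a b h => by simpa using h⟩
    have he' : ∀ q, e q = (i, 5 * q + 1) := fun _ => rfl
    have he : ∀ q, (e q).2 = 5 * q + 1 := fun _ => rfl
    have h := coinMeasure_pi ((Finset.range (p + 1)).map e)
      (A := fun y => if y.2 = 5 * p + 1 then {u : I | 0 ≤ (u : ℝ) ∧ (u : ℝ) < x⁻¹}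
        else {u : I | (u : ℝ) < 2 / x}ᶜ) fun y _ => by
        split_ifs
        · exact (measurableSet_le measurable_const measurable_subtype_coe).inter
            (measurableSet_lt measurable_subtype_coe measurable_const)
        · exact (measurableSet_lt measurable_subtype_coe measurable_const).compl
    rw [Finset.prod_map, Finset.prod_range_succ, if_pos (he p)] at h
    have hv : volume {u : I | (u : ℝ) < 2 / x}ᶜ = ENNReal.ofReal (1 - 2 / x) := by
      have := volume_Ico (a := 0) (b := 2 / x) le_rfl h2x
      rw [sub_zero] at this
      rw [prob_compl_eq_one_sub (measurableSet_lt (by fun_prop) measurable_const),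
        ENNReal.ofReal_sub _ (by positivity), ENNReal.ofReal_one, ← this]
      congr 2
      ext u
      simp [u.2.1]
    rw [volume_Ico le_rfl h1x, sub_zero, Finset.prod_congr rfl
      (g := fun _ => ENNReal.ofReal (1 - 2 / x)) fun q hq => by
        rw [if_neg (by have := Finset.mem_range.mp hq; rw [he]; omega), hv], Finset.prod_const,
      Finset.card_range, ← ENNReal.ofReal_pow (by linarith),
      ← ENNReal.ofReal_mul (pow_nonneg (by linarith) _)] at h
    have hset : ((fun (ω : Coins n) t => ω (i, t)) ⁻¹' B) =
        {ω | ∀ y ∈ (Finset.range (p + 1)).map e, ω y ∈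
          if y.2 = 5 * p + 1 then {u : I | 0 ≤ (u : ℝ) ∧ (u : ℝ) < x⁻¹}
            else {u : I | (u : ℝ) < 2 / x}ᶜ} := by
      ext ω
      simp only [hB, Set.mem_preimage, Set.mem_ofPred_eq, Finset.mem_map, Finset.mem_range,
        forall_exists_index, and_imp, forall_apply_eq_imp_iff₂]
      rw [Nat.forall_lt_succ_right]
      refine and_congr (forall₂_congr fun q hq => ?_) ?_
      · rw [if_neg (by rw [he]; omega)]
        simp [he']
      · rw [if_pos (he p)]
        simp [he', (ω (i, 5 * p + 1)).2.1]
    rw [hset, h]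
    refine ENNReal.ofReal_le_ofReal ?_
    -- Bernoulli's inequality: as `4 * p ≤ x`, a device is still fresh at position `p` with
    -- probability at least `1 / 2`.
    have h3 := one_add_mul_le_pow (a := -(2 / x)) (by linarith) p
    have h4 : (p : ℝ) * (2 / x) ≤ 1 / 2 := by
      rw [mul_div_assoc', div_le_iff₀ hx0]
      linarith
    have h5 : 1 / 2 ≤ (1 - 2 / x) ^ p := by
      rw [sub_eq_add_neg]
      linarith
    calc 1 / (2 * x) = 1 / 2 * x⁻¹ := by field_simp
      _ ≤ _ := by gcongr
  -- Only the unique candidate is used here, the helper is dropped: all devices but one must avoid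
  -- `B`, and distinct devices are independent.
  have hsub : {ω : Coins n | Registered x ω p} ⊆
      ⋃ i ∈ (Finset.univ : Finset (Fin n)), ⋂ j ∈ Finset.univ.erase i,
        (fun ω t => ω (j, t)) ⁻¹' Bᶜ := by
    rintro ω ⟨⟨i, -, h⟩, -⟩
    simp only [Set.mem_iUnion, Set.mem_iInter]
    exact ⟨i, Finset.mem_univ i, fun j hj hjB => (Finset.mem_erase.mp hj).1 (h j hjB)⟩
  have hind := iIndepFun_blocks (e := (id : Fin n × ℕ → Fin n × ℕ)) Function.injective_id
  refine (measure_mono hsub).trans ((measure_biUnion_finset_le _ _).trans ?_)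
  have hterm : ∀ i : Fin n, coinMeasure n (⋂ j ∈ Finset.univ.erase i,
      (fun ω t => ω (j, t)) ⁻¹' Bᶜ) ≤ ENNReal.ofReal (Real.exp (-(1 / (2 * x) * (n - 1 : ℕ)))) := by
    intro i
    have h := hind.measure_inter_preimage_eq_mul (Finset.univ.erase i) (sets := fun _ => Bᶜ)
      fun _ _ => hBm.compl
    rw [coinMeasure]
    refine (le_of_eq h).trans ?_
    have h2 : ∀ j : Fin n, Measure.infinitePi (fun _ : Fin n × ℕ => (volume : Measure I))
        ((fun (ω : Coins n) t => ω (j, t)) ⁻¹' Bᶜ) ≤ ENNReal.ofReal (1 - 1 / (2 * x)) := by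
      intro j
      rw [Set.preimage_compl, prob_compl_eq_one_sub (hBm.preimage (by fun_prop)),
        ENNReal.ofReal_sub _ (by positivity), ENNReal.ofReal_one]
      exact tsub_le_tsub_left (hBp j) 1
    refine (Finset.prod_le_prod' fun j _ => h2 j).trans ?_
    have h3 : 1 / (2 * x) ≤ 1 := by
      rw [div_le_one (by positivity)]
      linarith
    rw [Finset.prod_const, Finset.card_erase_of_mem (Finset.mem_univ i), Finset.card_univ,
      Fintype.card_fin, ← ENNReal.ofReal_pow (by linarith)]
    exact ENNReal.ofReal_le_ofReal (one_sub_pow_le_exp h3 _)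
  refine (Finset.sum_le_sum fun i _ => hterm i).trans ?_
  rw [Finset.sum_const, Finset.card_univ, Fintype.card_fin, nsmul_eq_mul,
    ENNReal.ofReal_mul (by positivity), ENNReal.ofReal_natCast]

end

end RadioNetwork
end

/-! ### The specification of Test-Network-Size -/

noncomputable section
open scoped unitInterval

namespace RadioNetwork

/-- The number of positions in an election with guess `x`. -/
def positions (x : ℝ) : ℕ := ⌈Real.logb 2 x⌉₊

/-- The subroutine Test-Network-Size with guess `x`. -/
def testNetworkSize (x : ℝ) : Subroutine Bool := (election x (positions x)).sub

section

variable {x : ℝ} {n : ℕ}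

theorem log_le_logb_two (hx : 1 ≤ x) : Real.log x ≤ Real.logb 2 x := by
  have h2 : 0 < Real.log 2 := Real.log_pos (by norm_num)
  rw [Real.logb, le_div_iff₀ h2]
  have := Real.log_two_lt_d9
  exact mul_le_of_le_one_right (Real.log_nonneg hx) (by linarith)

theorem logb_two_le (hx : 1 ≤ x) : Real.logb 2 x ≤ 1.45 * Real.log x := by
  have h2 : 0 < Real.log 2 := Real.log_pos (by norm_num)
  rw [Real.logb, div_le_iff₀ h2]
  have := Real.log_two_gt_d9
  have := Real.log_nonneg hx
  nlinarith

theorem one_le_logb_two (hx : 2 ≤ x) : 1 ≤ Real.logb 2 x := by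
  rw [Real.le_logb_iff_rpow_le (by norm_num) (by linarith)]
  simpa using hx

theorem logb_le_positions : Real.logb 2 x ≤ positions x := Nat.le_ceil _

theorem positions_le (hx : 2 ≤ x) : (positions x : ℝ) ≤ 2 * Real.logb 2 x := by
  have h1 := one_le_logb_two hx
  have := Nat.ceil_lt_add_one (show 0 ≤ Real.logb 2 x by linarith)
  rw [positions]
  linarith

theorem four_mul_positions_le (hx : 100 ≤ x) : 4 * (positions x : ℝ) ≤ x := by
  have h1 := one_le_logb_two (x := x) (by linarith)
  have h2 := Nat.ceil_lt_add_one (show 0 ≤ Real.logb 2 x by linarith)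
  -- Splitting off the factor 32 makes the crude bound `log y ≤ y - 1` at `y = x / 32` strong
  -- enough.
  have h3 : Real.logb 2 x = 5 + Real.logb 2 (x / 32) := by
    rw [Real.logb_div (by linarith) (by norm_num), show (32 : ℝ) = 2 ^ (5 : ℕ) by norm_num,
      Real.logb_pow, Real.logb_self_eq_one (by norm_num)]
    norm_num
  have h4 := logb_two_le (x := x / 32) (by linarith)
  have h5 := Real.log_le_sub_one_of_pos (show 0 < x / 32 by linarith)
  rw [positions]
  linarith

/-- At position `p`, exactly one device has the random number of a candidate, and exactly one that
of a helper. -/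
def pairEvent (x : ℝ) (n p : ℕ) : Set (Coins n) :=
  {ω | (∃! i, ω (i, 5 * p + 1) ∈ {u : I | (u : ℝ) < x⁻¹}) ∧
    ∃! i, ω (i, 5 * p + 1) ∈ {u : I | x⁻¹ ≤ (u : ℝ) ∧ (u : ℝ) < 2 / x}}

theorem measurableSet_existsUnique {n : ℕ} {A : Set I} (hA : MeasurableSet A) :
    MeasurableSet {u : Fin n → I | ∃! i, u i ∈ A} := by
  have : {u : Fin n → I | ∃! i, u i ∈ A} =
      ⋃ i, ((fun u => u i) ⁻¹' A ∩ ⋂ j, ⋂ _ : j ≠ i, (fun u => u j) ⁻¹' Aᶜ) := by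
    ext u
    simp only [ExistsUnique, Set.mem_ofPred_eq, Set.mem_iUnion, Set.mem_inter_iff, Set.mem_preimage,
      Set.mem_iInter, Set.mem_compl_iff]
    exact exists_congr fun i => and_congr_right fun _ => forall_congr' fun j => not_imp_not.symm
  rw [this]
  refine MeasurableSet.iUnion fun i => (hA.preimage (by fun_prop)).inter
    (MeasurableSet.iInter fun j => MeasurableSet.iInter fun _ => hA.compl.preimage (by fun_prop))

theorem measurableSet_candidate : MeasurableSet {u : I | (u : ℝ) < x⁻¹} :=
  measurableSet_lt measurable_subtype_coe measurable_const

theorem measurableSet_helper : MeasurableSet {u : I | x⁻¹ ≤ (u : ℝ) ∧ (u : ℝ) < 2 / x} :=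
  (measurableSet_le measurable_const measurable_subtype_coe).inter
    (measurableSet_lt measurable_subtype_coe measurable_const)

theorem measurableSet_pairEvent (p : ℕ) : MeasurableSet (pairEvent x n p) :=
  ((measurableSet_existsUnique measurableSet_candidate).preimage
      (f := fun (ω : Coins n) i => ω (i, 5 * p + 1)) (by fun_prop)).inter
    ((measurableSet_existsUnique measurableSet_helper).preimage
      (f := fun (ω : Coins n) i => ω (i, 5 * p + 1)) (by fun_prop))

/-- Different positions use different time slots. This fails for `Registered`, which depends on
earlier positions through the freshness of devices; hence the detour through `pairEvent`. -/
theorem iIndepFun_pairEvent :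
    ProbabilityTheory.iIndepFun (fun p => (pairEvent x n p).indicator fun _ => (1 : ℝ))
      (coinMeasure n) := by
  have h := iIndepFun_blocks (e := fun y : ℕ × Fin n => ((y.2, 5 * y.1 + 1) : Fin n × ℕ))
    fun y z h => by
      simp only [Prod.mk.injEq] at h
      exact Prod.ext (by omega) h.1
  have h2 := h.comp (fun _ => ({u : Fin n → I | (∃! i, u i ∈ {u : I | (u : ℝ) < x⁻¹}) ∧
    ∃! i, u i ∈ {u : I | x⁻¹ ≤ (u : ℝ) ∧ (u : ℝ) < 2 / x}}).indicator fun _ => (1 : ℝ))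
    fun _ => measurable_const.indicator ((measurableSet_existsUnique measurableSet_candidate).inter
      (measurableSet_existsUnique measurableSet_helper))
  exact h2

theorem coinMeasure_pairEvent (hx : 2 ≤ x) (p : ℕ) :
    (coinMeasure n).real (pairEvent x n p) = pairProb n x := by
  have hx0 : 0 < x := by linarith
  have h1 : x⁻¹ + x⁻¹ ≤ 1 := by
    rw [← two_mul, ← div_eq_mul_inv, div_le_one hx0]
    exact hx
  have hi := inv_pos.mpr hx0
  have h := coinMeasure_unique_unique (n := n) (5 * p + 1) (measurableSet_candidate (x := x))
    (measurableSet_helper (x := x))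
    (Set.disjoint_left.mpr fun u (hu : (u : ℝ) < x⁻¹) hu' => absurd hu'.1 (not_le.mpr hu))
    hi.le (by linarith) (by
      have := volume_Ico (a := 0) (b := x⁻¹) le_rfl (by linarith)
      rw [sub_zero] at this
      rw [← this]
      congr 1
      ext u
      simp [u.2.1]) (by
      have := volume_Ico (a := x⁻¹) (b := 2 / x) hi.le (by rw [div_eq_mul_inv]; linarith)
      rw [this]
      congr 1
      rw [div_eq_mul_inv]
      ring)
  rw [Measure.real, pairEvent, h, ENNReal.toReal_ofReal, pairProb]
  have : 0 ≤ 1 - 2 * x⁻¹ := by linarith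
  positivity

/-- If no device draws a role twice, every device that draws one at position `p` was fresh until
then. -/
theorem registered_iff_pairEvent {ω : Coins n} {L p : ℕ} (hp : p < L) (hx : 0 < x)
    (h : ¬ ∃ i, ∃ p < L, ∃ q < p, (ω (i, 5 * q + 1) : ℝ) < 2 / x ∧
      (ω (i, 5 * p + 1) : ℝ) < 2 / x) : Registered x ω p ↔ ω ∈ pairEvent x n p := by
  have h2x : x⁻¹ ≤ 2 / x := by
    rw [inv_eq_one_div]
    gcongr
    norm_num
  have key : ∀ i, (ω (i, 5 * p + 1) : ℝ) < 2 / x → ∀ q < p, 2 / x ≤ (ω (i, 5 * q + 1) : ℝ) := by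
    intro i hi q hq
    by_contra hlt
    exact h ⟨i, p, hp, q, hq, not_le.mp hlt, hi⟩
  have k1 : ∀ i, ((∀ q < p, 2 / x ≤ (ω (i, 5 * q + 1) : ℝ)) ∧ (ω (i, 5 * p + 1) : ℝ) < x⁻¹) ↔
      ω (i, 5 * p + 1) ∈ {u : I | (u : ℝ) < x⁻¹} := fun i =>
    ⟨fun h => h.2, fun h => ⟨key i (lt_of_lt_of_le h h2x), h⟩⟩
  have k2 : ∀ i, ((∀ q < p, 2 / x ≤ (ω (i, 5 * q + 1) : ℝ)) ∧ x⁻¹ ≤ (ω (i, 5 * p + 1) : ℝ) ∧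
      (ω (i, 5 * p + 1) : ℝ) < 2 / x) ↔
      ω (i, 5 * p + 1) ∈ {u : I | x⁻¹ ≤ (u : ℝ) ∧ (u : ℝ) < 2 / x} := fun i =>
    ⟨fun h => h.2, fun h => ⟨key i h.2, h⟩⟩
  simp only [Registered, pairEvent, k1, k2]
  rfl

open Classical in
/-- The number of registered candidates tells the size of the network. -/
def CountsWell (x : ℝ) {n : ℕ} (ω : Coins n) : Prop :=
  ((n : ℝ) / 1.5 ≤ x ∧ x ≤ 1.5 * n →
      105 * positions x ≤ 1000 * Nat.count (Registered x ω) (positions x)) ∧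
    (1.9 * n ≤ x ∨ x ≤ n / 1.9 →
      1000 * Nat.count (Registered x ω) (positions x) < 104 * positions x)

/-- The network is so large that candidates practically always collide: with `y = n / (4 * x)` the
hypothesis gives `y ^ 3 ≥ n / 64`, so `exp (-y)` is of order `n ^ (-3)`. This survives a union bound
over at most `n` positions and the factor `n` for the choice of the candidate. -/
theorem coinMeasure_not_countsWell_le_of_large (hx : 100 ≤ x) (hn : x ^ 3 < (n : ℝ) ^ 2) :
    coinMeasure n {ω | ¬ CountsWell x ω} ≤ ENNReal.ofReal (362880 * 64 ^ 3 / n) := by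
  classical
  have hx0 : 0 < x := by linarith
  have hnx : 10 * x ≤ n := by
    refine le_of_sq_le_sq ?_ (by positivity)
    nlinarith [sq_nonneg x]
  have hn1 : 1 ≤ n := by exact_mod_cast (by linarith : (1 : ℝ) ≤ n)
  have hpos : 0 < positions x := by
    have := one_le_logb_two (x := x) (by linarith)
    exact Nat.ceil_pos.mpr (by linarith)
  have h4 := four_mul_positions_le hx
  have hsub : {ω : Coins n | ¬ CountsWell x ω} ⊆
      ⋃ p ∈ Finset.range (positions x), {ω | Registered x ω p} := by
    intro ω hω
    by_contra hno
    refine absurd (⟨fun h => ?_, fun _ => ?_⟩ : CountsWell x ω) hω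
    · have := h.1
      rw [div_le_iff₀ (by norm_num)] at this
      linarith
    · have : Nat.count (Registered x ω) (positions x) = 0 := by
        rw [Nat.count_eq_card_filter_range, Finset.card_eq_zero, Finset.filter_eq_empty_iff]
        intro p hp hr
        exact hno (Set.mem_biUnion (Finset.mem_coe.mpr hp) hr)
      omega
  refine (measure_mono hsub).trans ((measure_biUnion_finset_le _ _).trans ?_)
  set y := (n : ℝ) / (4 * x) with hy
  have hy0 : 0 < y := by positivity
  have hexp : Real.exp (-(1 / (2 * x) * (n - 1 : ℕ))) ≤ 362880 * 64 ^ 3 / n ^ 3 := by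
    calc _ ≤ Real.exp (-y) := by
          rw [Real.exp_le_exp, neg_le_neg_iff, hy, Nat.cast_sub hn1, div_le_iff₀ (by positivity)]
          push_cast
          field_simp
          linarith
      _ ≤ 362880 / y ^ 9 := pow_nine_mul_exp_neg_le hy0
      _ ≤ _ := by
        have h3 : (n : ℝ) / 64 ≤ y ^ 3 := by
          rw [hy, div_pow, div_le_div_iff₀ (by norm_num) (by positivity)]
          nlinarith
        have h9 : (n : ℝ) ^ 3 / 64 ^ 3 ≤ y ^ 9 := by
          rw [← div_pow, show y ^ 9 = (y ^ 3) ^ 3 by ring]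
          gcongr
        calc (362880 : ℝ) / y ^ 9 ≤ 362880 / ((n : ℝ) ^ 3 / 64 ^ 3) := by gcongr
          _ = _ := by rw [div_div_eq_mul_div]
  calc _ ≤ ∑ p ∈ Finset.range (positions x), ENNReal.ofReal (n * (362880 * 64 ^ 3 / n ^ 3)) := by
        refine Finset.sum_le_sum fun p hp => ?_
        have hp' : (p : ℝ) ≤ positions x := by exact_mod_cast (Finset.mem_range.mp hp).le
        refine (coinMeasure_registered_le (by linarith) (by linarith)).trans ?_
        exact ENNReal.ofReal_le_ofReal (by gcongr)
    _ ≤ _ := by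
      rw [Finset.sum_const, Finset.card_range, nsmul_eq_mul, ← ENNReal.ofReal_natCast,
        ← ENNReal.ofReal_mul (by positivity)]
      refine ENNReal.ofReal_le_ofReal ?_
      calc (positions x : ℝ) * (n * (362880 * 64 ^ 3 / n ^ 3)) ≤
          n * (n * (362880 * 64 ^ 3 / n ^ 3)) := by
            have : (positions x : ℝ) ≤ n := by linarith
            gcongr
        _ = _ := by field_simp

/-- Here `n ≤ x ^ (3 / 2)` makes a second role of any device unlikely, so registrations may be
counted by the independent events `pairEvent`. Hoeffding's inequality with deviation 0.002 keeps the
frequency above 0.105 or below 0.104; its exponent `2 * 0.002 ^ 2 * L` yields the power of `x`. -/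
theorem coinMeasure_not_countsWell_le_of_small (hx : 10000 ≤ x) (hn : (n : ℝ) ^ 2 ≤ x ^ 3) :
    coinMeasure n {ω | ¬ CountsWell x ω} ≤
      ENNReal.ofReal (2306 * x ^ (-(8 / 1000000) : ℝ)) := by
  classical
  have hx0 : 0 < x := by linarith
  have hx1 : 1 ≤ x := by linarith
  set L := positions x with hL
  set T : Set (Coins n) := {ω | ∃ i, ∃ p < L, ∃ q < p, (ω (i, 5 * q + 1) : ℝ) < 2 / x ∧
      (ω (i, 5 * p + 1) : ℝ) < 2 / x} with hT
  set F : Set (Coins n) := {ω | ((n : ℝ) / 1.5 ≤ x ∧ x ≤ 1.5 * n) ∧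
    (Nat.count (fun p => ω ∈ pairEvent x n p) L : ℝ) ≤ (0.107 - 0.002) * L} with hF
  set G : Set (Coins n) := {ω | (1.9 * n ≤ x ∨ x ≤ n / 1.9) ∧
    (0.102 + 0.002) * L ≤ (Nat.count (fun p => ω ∈ pairEvent x n p) L : ℝ)} with hG
  have hexp : Real.exp (-(2 * 0.002 ^ 2 * (L : ℝ))) ≤ x ^ (-(8 / 1000000) : ℝ) := by
    rw [Real.rpow_def_of_pos hx0, Real.exp_le_exp]
    have := (log_le_logb_two hx1).trans logb_le_positions
    rw [← hL] at this
    linarith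
  have hFm : coinMeasure n F ≤ ENNReal.ofReal (x ^ (-(8 / 1000000) : ℝ)) := by
    by_cases hin : (n : ℝ) / 1.5 ≤ x ∧ x ≤ 1.5 * n
    · have h := measure_count_le_le (μ := coinMeasure n) measurableSet_pairEvent
        iIndepFun_pairEvent (q := 0.107) (δ := 0.002) (fun p => by
          rw [coinMeasure_pairEvent (x := x) (by linarith)]
          exact le_pairProb hx hin.1 hin.2) (by norm_num) L
      rw [← ENNReal.ofReal_toReal (measure_ne_top (coinMeasure n) F)]
      refine ENNReal.ofReal_le_ofReal (le_trans ?_ (h.trans hexp))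
      exact measureReal_mono fun ω hω => hω.2
    · have : F = ∅ := Set.eq_empty_of_forall_notMem fun ω hω => hin hω.1
      simp [this]
  have hGm : coinMeasure n G ≤ ENNReal.ofReal (x ^ (-(8 / 1000000) : ℝ)) := by
    by_cases hout : 1.9 * n ≤ x ∨ x ≤ n / 1.9
    · have h := measure_count_ge_le (μ := coinMeasure n) measurableSet_pairEvent
        iIndepFun_pairEvent (q := 0.102) (δ := 0.002) (fun p => by
          rw [coinMeasure_pairEvent (x := x) (by linarith)]
          exact pairProb_le hx hout) (by norm_num) L
      rw [← ENNReal.ofReal_toReal (measure_ne_top (coinMeasure n) G)]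
      refine ENNReal.ofReal_le_ofReal (le_trans ?_ (h.trans hexp))
      exact measureReal_mono fun ω hω => hω.2
    · have : G = ∅ := Set.eq_empty_of_forall_notMem fun ω hω => hout hω.1
      simp [this]
  have hTm : coinMeasure n T ≤ ENNReal.ofReal (2304 * x ^ (-(8 / 1000000) : ℝ)) := by
    refine (coinMeasure_twice_le (by linarith) L).trans (ENNReal.ofReal_le_ofReal ?_)
    -- From `L ≤ 2 * logb 2 x`, `logb 2 x ≤ 1.45 * log x` and `log x ≤ 8 * x ^ (1 / 8)`. The
    -- constant 2304 below is `4 * 24 ^ 2`.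
    have h1 : (L : ℝ) ≤ 24 * x ^ (1 / 8 : ℝ) := by
      have h1 := positions_le (x := x) (by linarith)
      have h2 := logb_two_le hx1
      have h3 := Real.log_le_rpow_div hx0.le (ε := 1 / 8) (by norm_num)
      have h4 : 0 < x ^ (1 / 8 : ℝ) := Real.rpow_pos_of_pos hx0 _
      rw [← hL] at h1
      linarith
    have h2 : (n : ℝ) ≤ x ^ (3 / 2 : ℝ) := by
      refine le_of_sq_le_sq ?_ (Real.rpow_nonneg hx0.le _)
      rw [← Real.rpow_natCast (x ^ (3 / 2 : ℝ)), ← Real.rpow_mul hx0.le]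
      norm_num
      exact_mod_cast hn
    calc 4 * (n : ℝ) * L ^ 2 / x ^ 2 ≤ 4 * x ^ (3 / 2 : ℝ) * (24 * x ^ (1 / 8 : ℝ)) ^ 2 / x ^ 2 := by
          gcongr
      _ = 2304 * x ^ (-(1 / 4) : ℝ) := by
        have e1 : (x ^ (1 / 8 : ℝ)) ^ 2 = x ^ (1 / 4 : ℝ) := by
          rw [← Real.rpow_natCast, ← Real.rpow_mul hx0.le]
          norm_num
        have e2 : x ^ (-(1 / 4) : ℝ) = x ^ (3 / 2 : ℝ) * x ^ (1 / 4 : ℝ) / x ^ 2 := by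
          rw [← Real.rpow_natCast x 2, ← Real.rpow_add hx0, ← Real.rpow_sub hx0]
          norm_num
        rw [mul_pow, e1, e2]
        ring
      _ ≤ _ := by
        refine mul_le_mul_of_nonneg_left ?_ (by norm_num)
        exact Real.rpow_le_rpow_of_exponent_le hx1 (by norm_num)
  have hsub : {ω : Coins n | ¬ CountsWell x ω} ⊆ T ∪ (F ∪ G) := by
    intro ω hω
    by_contra hno
    simp only [Set.mem_union, not_or] at hno
    obtain ⟨hnT, hnF, hnG⟩ := hno
    have hcount : Nat.count (Registered x ω) L = Nat.count (fun p => ω ∈ pairEvent x n p) L := by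
      simp only [Nat.count_eq_card_filter_range]
      congr 1
      exact Finset.filter_congr fun p hp => registered_iff_pairEvent (Finset.mem_range.mp hp) hx0 hnT
    refine absurd (⟨fun h => ?_, fun h => ?_⟩ : CountsWell x ω) hω
    · rw [← hL, hcount]
      by_contra hlt
      have hlt : (1000 : ℝ) * Nat.count (fun p => ω ∈ pairEvent x n p) L ≤ 105 * L := by
        exact_mod_cast (not_le.mp hlt).le
      exact hnF ⟨h, by linarith⟩
    · rw [← hL, hcount]
      by_contra hlt
      have hlt : (104 : ℝ) * L ≤ 1000 * Nat.count (fun p => ω ∈ pairEvent x n p) L := by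
        exact_mod_cast not_lt.mp hlt
      exact hnG ⟨h, by linarith⟩
  calc _ ≤ coinMeasure n T + (coinMeasure n F + coinMeasure n G) :=
        (measure_mono hsub).trans ((measure_union_le _ _).trans (by gcongr; exact measure_union_le _ _))
    _ ≤ _ := by
      have h0 : 0 ≤ x ^ (-(8 / 1000000) : ℝ) := Real.rpow_nonneg hx0.le _
      refine (add_le_add hTm (add_le_add hFm hGm)).trans (le_of_eq ?_)
      rw [← ENNReal.ofReal_add h0 h0, ← ENNReal.ofReal_add (by positivity) (by positivity)]
      congr 1
      ring

/-- The two regimes are separated by `n = x ^ (3 / 2)`. Below it the maximum of `n` and `x` is at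
most `x ^ (3 / 2)`, so a power `3 / 400000` of `x` corresponds to `1 / 200000` of the maximum. -/
theorem coinMeasure_not_countsWell_le (hx : 100 ≤ x) (n : ℕ) :
    coinMeasure n {ω | ¬ CountsWell x ω} ≤
      ENNReal.ofReal (10 ^ 12 * (max (n : ℝ) x) ^ (-(1 / 200000) : ℝ)) := by
  have hx0 : 0 < x := by linarith
  have hM : 1 ≤ max (n : ℝ) x := le_max_of_le_right (by linarith)
  have hM0 : 0 < max (n : ℝ) x := by linarith
  have hinv : (max (n : ℝ) x)⁻¹ ≤ (max (n : ℝ) x) ^ (-(1 / 200000) : ℝ) := by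
    rw [← Real.rpow_neg_one]
    exact Real.rpow_le_rpow_of_exponent_le hM (by norm_num)
  rcases lt_or_ge (x ^ 3) ((n : ℝ) ^ 2) with hn | hn
  · refine (coinMeasure_not_countsWell_le_of_large hx hn).trans (ENNReal.ofReal_le_ofReal ?_)
    have hnx : x ≤ n := by
      refine le_of_sq_le_sq ?_ (by positivity)
      nlinarith [sq_nonneg x]
    rw [max_eq_left hnx] at hinv ⊢
    calc (362880 : ℝ) * 64 ^ 3 / n = 362880 * 64 ^ 3 * (n : ℝ)⁻¹ := by rw [div_eq_mul_inv]
      _ ≤ _ := by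
        gcongr
        norm_num
  · have hMx : max (n : ℝ) x ^ 2 ≤ x ^ 3 := by
      rcases max_choice (n : ℝ) x with h | h <;> rw [h]
      · exact hn
      · nlinarith [sq_nonneg x]
    rcases lt_or_ge x 10000 with hx' | hx'
    -- For bounded `x` the maximum is at most `10 ^ 6`, and the claimed bound exceeds 1.
    · refine prob_le_one.trans ?_
      rw [← ENNReal.ofReal_one]
      refine ENNReal.ofReal_le_ofReal ?_
      have h1 : max (n : ℝ) x ≤ 1000000 := by
        refine le_of_sq_le_sq (hMx.trans ?_) (by norm_num)
        calc x ^ 3 ≤ 10000 ^ 3 := by gcongr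
          _ = _ := by norm_num
      have h2 : (1000000 : ℝ)⁻¹ ≤ (max (n : ℝ) x)⁻¹ := by gcongr
      have := h2.trans hinv
      norm_num at this ⊢
      linarith
    · refine (coinMeasure_not_countsWell_le_of_small hx' hn).trans (ENNReal.ofReal_le_ofReal ?_)
      have h1 : x ^ (-(8 / 1000000) : ℝ) ≤ (max (n : ℝ) x) ^ (-(1 / 200000) : ℝ) := by
        have e1 : (max (n : ℝ) x) ^ (-(1 / 200000) : ℝ) =
            (max (n : ℝ) x ^ 2) ^ (-(1 / 400000) : ℝ) := by
          rw [← Real.rpow_natCast, ← Real.rpow_mul hM0.le]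
          norm_num
        have e2 : (x ^ 3) ^ (-(1 / 400000) : ℝ) = x ^ (-(3 / 400000) : ℝ) := by
          rw [← Real.rpow_natCast, ← Real.rpow_mul hx0.le]
          norm_num
        rw [e1]
        refine le_trans ?_ (Real.rpow_le_rpow_of_nonpos (by positivity) hMx (by norm_num))
        rw [e2]
        exact Real.rpow_le_rpow_of_exponent_le (by linarith) (by norm_num)
      gcongr
      norm_num

theorem one_le_invAck {N : ℕ} (hN : 2 ≤ N) : 1 ≤ invAck N := by
  -- The witness shows that the infimum is not taken over the empty set, where it would be 0. Index
  -- 0 is excluded because `ack 0 0 = 1`.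
  refine le_csInf ⟨N, (lt_ack_left N N).le⟩ fun i hi => ?_
  by_contra h
  have : i = 0 := by omega
  have hi : N ≤ ack i i := hi
  rw [this] at hi
  simp at hi
  omega

theorem energy_testNetworkSize_le (cd : CDModel) (ω : Coins n) (T : ℕ) (i : Fin n) :
    (testNetworkSize x).run.device.energy cd ω T i ≤ 3005 := by
  rw [Proto.device_energy]
  exact netEnergy_le election_energyLe

/-- The energy requirement holds surely, since the constant 3005 is below `C * invAck ⌈x⌉₊`; the
outcome is determined by `CountsWell`. -/
theorem testSpec_testNetworkSize (cd : CDModel) :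
    TestSpec cd testNetworkSize (10 ^ 12) (1 / 200000) := by
  classical
  intro x hx
  have hx0 : 0 < x := by linarith
  have hpos : 0 < positions x := by
    have := one_le_logb_two (x := x) (by linarith)
    exact Nat.ceil_pos.mpr (by linarith)
  refine ⟨?_, fun n => (measure_mono fun ω hω => ?_).trans (coinMeasure_not_countsWell_le hx n)⟩
  · have h1 := positions_le (x := x) (by linarith)
    have h2 := one_le_logb_two (x := x) (by linarith)
    have h3 : ((testNetworkSize x).len : ℝ) = 5 * positions x := by
      simp [testNetworkSize, Machine.sub, election]
    rw [h3]
    linarith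
  · intro hgood
    refine absurd ⟨fun i => ?_, ?_⟩ hω
    · have h1 : ((testNetworkSize x).run.device.energy cd ω (testNetworkSize x).len i : ℝ) ≤ 3005 := by
        exact_mod_cast energy_testNetworkSize_le cd ω _ i
      have h2 : (1 : ℝ) ≤ invAck ⌈x⌉₊ := by
        exact_mod_cast one_le_invAck (Nat.succ_le_of_lt (Nat.lt_ceil.mpr (by norm_num; linarith)))
      linarith
    · obtain ⟨h1, h2, h3⟩ := election_leaders (cd := cd) (ω := ω) hx0 hpos
      exact ⟨h1, fun h => h2 (hgood.1 h), fun h => h3 (hgood.2 h)⟩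

end

end RadioNetwork
end

noncomputable section
open scoped unitInterval

namespace RadioNetwork

/-! ### The slots of Estimate-Network-Size -/

section Slots

variable {cd : CDModel} {n : ℕ} {ω : Coins n}

theorem netStep_of_slot {β : Type} {t : ℕ} {p : Fin n → Proto β} {i : Fin n} {act : I → Action}
    {next : I → Feedback → Proto β} (h : p i = .slot act next) :
    netStep cd ω t p i = next (ω (i, t + 1)) (feedback cd (netAct ω t p) i) := by
  rw [netStep, h]
  rfl

theorem netAct_of_slot {β : Type} {t : ℕ} {p : Fin n → Proto β} {i : Fin n} {act : I → Action}
    {next : I → Feedback → Proto β} (h : p i = .slot act next) :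
    netAct ω t p i = act (ω (i, t + 1)) := by
  rw [netAct, h]
  rfl

theorem netRun_wait {β : Type} {t T s : ℕ} {b : β} {p : Fin n → Proto β} {i : Fin n}
    (h : p i = .wait (T + s) b) : netRun cd ω t T p i = .wait s b := by
  induction T generalizing t p with
  | zero => simpa [netRun] using h
  | succ T ih =>
    refine ih ?_
    rw [Nat.add_right_comm] at h
    rw [netStep, h]
    rfl

/-- No device transmits if `Test(j)` is run in time slot `t`. -/
def Quiet (d : ℕ → ℕ) {n : ℕ} (ω : Coins n) (t j : ℕ) : Prop :=
  ∀ i, ¬ (ω (i, t + 1) : ℝ) < (1 / 2) ^ d j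

-- All devices reach the same answer: a transmitter knows that the slot is not silent, and a
-- listener perceives any transmission as a message or as noise. Without collision detection two
-- transmitters would sound like silence.
open Classical in
theorem netRun_searchTest (hcd : cd.detectsNoise = true) (d : ℕ → ℕ) (t j : ℕ) (i : Fin n) :
    netRun cd ω t 1 (fun _ => searchTest d j) i = .done (decide (Quiet d ω t j)) := by
  have ha : ∀ i, netAct ω t (fun _ => searchTest d j) i =
      if (ω (i, t + 1) : ℝ) < (1 / 2) ^ d j then .transmit 0 else .listen := fun i => rfl
  have hs : netRun cd ω t 1 (fun _ => searchTest d j) i =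
      .done (if (ω (i, t + 1) : ℝ) < (1 / 2) ^ d j then false
        else (feedback cd (netAct ω t fun _ => searchTest d j) i).isSilence) := rfl
  rw [hs]
  congr 1
  by_cases hq : Quiet d ω t j
  · rw [if_neg (hq i), decide_eq_true hq, feedback_of_listen (by rw [ha, if_neg (hq i)]),
      channel_of_forall_none fun i => by rw [ha, if_neg (hq i)]; rfl]
    rfl
  · rw [decide_eq_false hq]
    by_cases hi : (ω (i, t + 1) : ℝ) < (1 / 2) ^ d j
    · rw [if_pos hi]
    · rw [if_neg hi, feedback_of_listen (by rw [ha, if_neg hi])]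
      rw [Quiet] at hq
      push Not at hq
      obtain ⟨i', hi'⟩ := hq
      exact channel_ne_silence hcd (i := i') (by rw [ha, if_pos hi']; simp [Action.sent])

theorem hasLen_searchTest (d : ℕ → ℕ) (j : ℕ) : (searchTest d j).HasLen 1 :=
  ⟨0, rfl, fun _ _ => rfl⟩

theorem announce_of_silent {r : ℕ} {m : Memory} (h : ∀ l, m = ⟨some l, true⟩ → l % 2 ≠ r) :
    announce cd r m = .slot (fun _ => .listen) fun _ y => .done y.estimate := by
  rcases m with ⟨_ | l, _ | _⟩
  · rfl
  · rfl
  · rfl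
  · exact if_neg (h l rfl)

theorem announce_of_speaker {r l : ℕ} (h : l % 2 = r) :
    announce cd r ⟨some l, true⟩ = .slot (fun _ => .transmit l)
      fun _ y => .done (if cd.sendersHear then y.estimate else some (2 ^ l)) :=
  if_pos h

theorem hasLen_announce (r : ℕ) (m : Memory) : (announce cd r m).HasLen 1 := by
  by_cases h : ∀ l, m = ⟨some l, true⟩ → l % 2 ≠ r
  · rw [announce_of_silent h]
    exact ⟨0, rfl, fun _ _ => rfl⟩
  · push Not at h
    obtain ⟨l, rfl, hl⟩ := h
    rw [announce_of_speaker hl]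
    exact ⟨0, rfl, fun _ _ => rfl⟩

theorem netRun_announce_of_silent {t r : ℕ} {m : Fin n → Memory}
    (h : ∀ i l, m i = ⟨some l, true⟩ → l % 2 ≠ r) (i : Fin n) :
    netRun cd ω t 1 (fun i => announce cd r (m i)) i = .done none := by
  have hp := fun i => announce_of_silent (cd := cd) (h i)
  have ha : ∀ i, netAct ω t (fun i => announce cd r (m i)) i = .listen :=
    fun i => (netAct_of_slot (p := fun i => announce cd r (m i)) (hp i)).trans rfl
  refine (netStep_of_slot (p := fun i => announce cd r (m i)) (hp i)).trans ?_
  rw [feedback_of_listen (ha i),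
    channel_of_forall_none fun i => by rw [ha]; rfl]
  rfl

/-- With a single speaker the listeners hear its label, and the speaker either hears itself or
rightly presumes that it was alone. Thus everybody ends with the same estimate. -/
theorem netRun_announce_of_speaker {t r l : ℕ} {m : Fin n → Memory} {w : Fin n}
    (hw : m w = ⟨some l, true⟩) (hl : l % 2 = r)
    (h : ∀ i, i ≠ w → ∀ l, m i = ⟨some l, true⟩ → l % 2 ≠ r) (i : Fin n) :
    netRun cd ω t 1 (fun i => announce cd r (m i)) i = .done (some (2 ^ l)) := by
  have hp := fun i hi => announce_of_silent (cd := cd) (h i hi)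
  have hpw : announce cd r (m w) = _ := hw ▸ announce_of_speaker (cd := cd) hl
  have ha : ∀ i, i ≠ w → netAct ω t (fun i => announce cd r (m i)) i = .listen :=
    fun i hi => (netAct_of_slot (p := fun i => announce cd r (m i)) (hp i hi)).trans rfl
  have haw : netAct ω t (fun i => announce cd r (m i)) w = .transmit l :=
    (netAct_of_slot (p := fun i => announce cd r (m i)) hpw).trans rfl
  have hch : channel cd (netAct ω t fun i => announce cd r (m i)) = .message l :=
    channel_of_unique (i := w) (by rw [haw]; rfl) fun j hj => by rw [ha j hj]; rfl
  by_cases hi : i = w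
  · subst hi
    refine (netStep_of_slot (p := fun i => announce cd r (m i)) hpw).trans ?_
    rw [feedback, haw]
    dsimp only
    rw [hch]
    cases cd.sendersHear <;> rfl
  · refine (netStep_of_slot (p := fun i => announce cd r (m i)) (hp i hi)).trans ?_
    rw [feedback_of_listen (ha i hi), hch]
    rfl

end Slots

/-! ### Subnetworks formed by the devices with a given label -/

section Labels

variable {cd : CDModel} {n : ℕ}

/-- The devices with label `k`. -/
def labelled (d₁ : ℕ) (ω : Coins n) (k : ℕ) : Finset (Fin n) :=
  {i | labelOf d₁ (ω (i, 0)) = some k}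

/-- The random numbers of the devices in `A`, from time `t` on. -/
def subCoins (ω : Coins n) (A : Finset (Fin n)) (t : ℕ) : Coins A.card :=
  fun y => ω (A.orderEmbOfFin rfl y.1, t + y.2)

/-- Devices outside `A` wait, so the members of `A` behave as a network of their own with the random
numbers `subCoins`. -/
theorem exists_netRun_labelled {ω : Coins n} (S : Subroutine Bool) (A : Finset (Fin n)) (t : ℕ)
    (lead : Fin n → Bool) : ∃ b : Fin n → Bool,
      (∀ i, netRun cd ω t S.len (fun i => if i ∈ A then S.run else .wait S.len (lead i)) i =
        .done (b i)) ∧ (∀ i ∉ A, b i = lead i) ∧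
      ∀ j, b (A.orderEmbOfFin rfl j) = true ↔ j ∈ leaders cd S (subCoins ω A t) := by
  set p : Fin n → Proto Bool := fun i => if i ∈ A then S.run else .wait S.len (lead i) with hp
  have hlen : ∀ i, (p i).HasLen (S.len + 0) := by
    intro i
    simp only [hp, add_zero]
    split_ifs
    · exact S.hasLen_run
    · exact Proto.hasLen_wait _ _
  choose b hb using fun i => (hasLen_netRun (cd := cd) (ω := ω) (t := t) (hlen i)).eq_done
  refine ⟨b, hb, fun i hi => ?_, fun j => ?_⟩
  · have := hb i
    rw [netRun_wait (s := 0) (b := lead i) (by simp only [hp, if_neg hi, add_zero])] at this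
    exact (Proto.done.inj this).symm
  · have h := netRun_embed (cd := cd) (ω := ω) (e := A.orderEmbOfFin rfl) (t := t) (t' := 0)
      (T := S.len) (ω' := subCoins ω A t) (p := p) (q := fun _ => S.run)
      (A.orderEmbOfFin rfl).injective (fun j s => by simp [subCoins, add_assoc])
      (fun j => if_pos (A.orderEmbOfFin_mem rfl j)) (fun i hi => by
        have : i ∉ A := fun h => hi (by rw [Finset.range_orderEmbOfFin]; exact h)
        exact ⟨_, _, if_neg this⟩) j
    rw [hb] at h
    change _ ↔ S.run.device.result cd _ S.len j = some true
    rw [Proto.device_result, ← h]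
    exact ⟨fun h => by rw [h], fun h => Proto.done.inj h⟩

end Labels

/-! ### Exponential-Search -/

section Phases

variable (cd : CDModel) (d : ℕ → ℕ) (triv : ℕ → Subroutine (Option ℕ))
  (test : ℝ → Subroutine Bool) {n : ℕ} (ω : Coins n)

/-- At time `t`, all devices are about to run the phase `ph`, `lead` tells the leaders,
and device `i` has spent energy at most `E i`. -/
def AtPhase (t : ℕ) (ph : Phase) (lead : Fin n → Bool) (E : Fin n → ℕ) : Prop :=
  ∀ i, (estimateNetworkSize cd d triv test).config cd ω t i =
      .done (.inl (ph, ⟨labelOf (d 1) (ω (i, 0)), lead i⟩)) ∧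
    (estimateNetworkSize cd d triv test).energy cd ω t i ≤ E i

/-- At time `t`, all devices have terminated with the estimate `e`, and device `i` has spent
energy at most `E i`. -/
def Finished (t e : ℕ) (E : Fin n → ℕ) : Prop :=
  ∀ i, (estimateNetworkSize cd d triv test).result cd ω t i = some e ∧
    (estimateNetworkSize cd d triv test).energy cd ω t i ≤ E i

variable {cd d triv test ω}

theorem finished_of_config {t e : ℕ} {E : Fin n → ℕ}
    (h : ∀ i, (estimateNetworkSize cd d triv test).config cd ω t i = .done (.inr e))
    (hE : ∀ i, (estimateNetworkSize cd d triv test).energy cd ω t i ≤ E i) :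
    Finished cd d triv test ω t e E := fun i => by
  refine ⟨?_, hE i⟩
  rw [Device.result, h]
  rfl

theorem estimateNetworkSize_segment {δ : Type} {t T : ℕ} (hT : 0 < T) {p : Fin n → Proto δ}
    {E E' : Fin n → ℕ} {f : Fin n → δ → Proto ((Phase × Memory) ⊕ ℕ)}
    {c : Fin n → Proto ((Phase × Memory) ⊕ ℕ)}
    (hc : ∀ i, (estimateNetworkSize cd d triv test).config cd ω t i = c i)
    (hE : ∀ i, (estimateNetworkSize cd d triv test).energy cd ω t i ≤ E i)
    (hq : ∀ i, unroll (roundBody cd d test) (c i) = (p i).bind (f i))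
    (hp : ∀ i, (p i).HasLen T) (hE' : ∀ i, (p i).EnergyLe (E' i)) :
    (∀ i, (estimateNetworkSize cd d triv test).config cd ω (t + T) i =
      (netRun cd ω t T p i).bind (f i)) ∧
      ∀ i, (estimateNetworkSize cd d triv test).energy cd ω (t + T) i ≤ E i + E' i := by
  have hs := loopDevice_segment (cd := cd) (ω := ω) (t := t) hT (f := f)
    (init := fun u => (triv (2 ^ d 1)).run.bind <| stopOr <|
      .done (.inl (if cd.detectsNoise then .expand 1 else .iterate (d 1), ⟨labelOf (d 1) u, false⟩)))
    (fun i => (congrArg _ (hc i)).trans (hq i)) hp hE'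
  exact ⟨hs.1, fun i => (hs.2 i).trans (Nat.add_le_add_right (hE i) _)⟩

open Classical in
theorem AtPhase.expand_step (hcd : cd.detectsNoise = true) {t j : ℕ} {lead : Fin n → Bool}
    {E : Fin n → ℕ} (h : AtPhase cd d triv test ω t (.expand j) lead E) :
    AtPhase cd d triv test ω (t + 1) (if Quiet d ω t j then narrow d 1 j else .expand (2 * j)) lead
      fun i => E i + 1 := by
  have hs := estimateNetworkSize_segment (T := 1) one_pos (p := fun _ => searchTest d j)
    (f := fun i b => .done (.inl (if b then narrow d 1 j else .expand (2 * j),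
      ⟨labelOf (d 1) (ω (i, 0)), lead i⟩)))
    (fun i => (h i).1) (fun i => (h i).2) (fun _ => rfl) (fun _ => hasLen_searchTest d _)
    fun _ => (hasLen_searchTest d _).energyLe
  refine fun i => ⟨(hs.1 i).trans ?_, hs.2 i⟩
  rw [netRun_searchTest hcd]
  by_cases hq : Quiet d ω t j
  · rw [decide_eq_true hq, if_pos hq]
    rfl
  · rw [decide_eq_false hq, if_neg hq]
    rfl

open Classical in
theorem AtPhase.bisect_step (hcd : cd.detectsNoise = true) {t lo hi : ℕ} {lead : Fin n → Bool}
    {E : Fin n → ℕ} (h : AtPhase cd d triv test ω t (.bisect lo hi) lead E) :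
    AtPhase cd d triv test ω (t + 1) (if Quiet d ω t ((lo + hi) / 2) then
      narrow d lo ((lo + hi) / 2) else narrow d ((lo + hi) / 2 + 1) hi) lead fun i => E i + 1 := by
  have hs := estimateNetworkSize_segment (T := 1) one_pos (p := fun _ => searchTest d ((lo + hi) / 2))
    (f := fun i b => .done (.inl (if b then narrow d lo ((lo + hi) / 2)
      else narrow d ((lo + hi) / 2 + 1) hi, ⟨labelOf (d 1) (ω (i, 0)), lead i⟩)))
    (fun i => (h i).1) (fun i => (h i).2) (fun _ => rfl) (fun _ => hasLen_searchTest d _)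
    fun _ => (hasLen_searchTest d _).energyLe
  refine fun i => ⟨(hs.1 i).trans ?_, hs.2 i⟩
  rw [netRun_searchTest hcd]
  by_cases hq : Quiet d ω t ((lo + hi) / 2)
  · rw [decide_eq_true hq, if_pos hq]
    rfl
  · rw [decide_eq_false hq, if_neg hq]
    rfl

/-- The time slots that Exponential-Search needs if the index looked for is about `m`. -/
def searchTime (m : ℕ) : ℕ := 2 * Nat.log 2 m + 3

/-- The tests of Exponential-Search, starting at time `t₀`, are right about all indices except
`m - 1` and `m`. -/
structure SearchOK (d : ℕ → ℕ) {n : ℕ} (ω : Coins n) (t₀ m : ℕ) : Prop where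
  low : ∀ s < searchTime m, ∀ j, 1 ≤ j → j + 2 ≤ m → ¬ Quiet d ω (t₀ + s) j
  high : ∀ s < searchTime m, ∀ j, m + 1 ≤ j → j ≤ 2 * m → Quiet d ω (t₀ + s) j

/-- Doubling cannot stop at an index up to `m - 2`, and it must stop at the first power of two above
`m`, which is at most `2 * m`. Answers at `m - 1` and `m` do not matter. -/
theorem AtPhase.expand (hcd : cd.detectsNoise = true) {t₀ m : ℕ}
    (hok : SearchOK d ω t₀ m) {lead : Fin n → Bool} {E : ℕ} (b : ℕ) (hb : 2 ^ b ≤ 2 * m)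
    (h : AtPhase cd d triv test ω (t₀ + b) (.expand (2 ^ b)) lead fun _ => E + b) :
    ∃ a ≤ Nat.log 2 m + 1, 2 ^ a ≤ 2 * m ∧ m ≤ 2 ^ a + 1 ∧
      AtPhase cd d triv test ω (t₀ + (a + 1)) (narrow d 1 (2 ^ a)) lead fun _ => E + (a + 1) := by
  have hbl : b ≤ Nat.log 2 m + 1 := by
    rcases Nat.eq_zero_or_pos b with rfl | hb0
    · omega
    · obtain ⟨b, rfl⟩ := Nat.exists_eq_succ_of_ne_zero hb0.ne'
      rw [Nat.pow_succ] at hb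
      have : b ≤ Nat.log 2 m := Nat.le_log_of_pow_le (by norm_num) (by omega)
      omega
  obtain ⟨k, hk⟩ : ∃ k, k = Nat.log 2 m + 1 - b := ⟨_, rfl⟩
  have hs := h.expand_step hcd
  have h1 : 1 ≤ 2 ^ b := Nat.one_le_two_pow
  induction k generalizing b with
  | zero =>
    by_cases hq : Quiet d ω (t₀ + b) (2 ^ b)
    · rw [if_pos hq] at hs
      refine ⟨b, hbl, hb, ?_, hs⟩
      by_contra hlt
      exact hok.low b (by rw [searchTime]; omega) _ h1 (by omega) hq
    · exfalso
      obtain rfl : b = Nat.log 2 m + 1 := by omega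
      have := Nat.lt_pow_succ_log_self (b := 2) (by norm_num) m
      exact hq (hok.high _ (by rw [searchTime]; omega) _ this hb)
  | succ k ih =>
    by_cases hq : Quiet d ω (t₀ + b) (2 ^ b)
    · rw [if_pos hq] at hs
      refine ⟨b, hbl, hb, ?_, hs⟩
      by_contra hlt
      exact hok.low b (by rw [searchTime]; omega) _ h1 (by omega) hq
    · rw [if_neg hq, ← pow_succ'] at hs
      have hb' : 2 ^ (b + 1) ≤ 2 * m := by
        rw [pow_succ']
        by_contra hlt
        exact hq (hok.high b (by rw [searchTime]; omega) _ (by omega) hb)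
      exact ih (b + 1) hb' hs (by omega) (by omega) (AtPhase.expand_step hcd hs)
        Nat.one_le_two_pow

/-- The interval keeps `lo ≤ m + 1` and `m ≤ hi + 1`: a wrong exclusion could only come from a test
at some index other than `m - 1` and `m`, where the tests are right. The length is at most `2 ^ b`,
so `b` further tests suffice. -/
theorem AtPhase.bisect (hcd : cd.detectsNoise = true) {t₀ m : ℕ} (hok : SearchOK d ω t₀ m)
    {lead : Fin n → Bool} {E : ℕ} (b s lo hi : ℕ) (hlo : 1 ≤ lo) (hlh : lo ≤ hi)
    (hb : hi + 1 ≤ lo + 2 ^ b) (hlm : lo ≤ m + 1) (hmh : m ≤ hi + 1) (hhi : hi ≤ 2 * m)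
    (hs : s + b ≤ searchTime m)
    (h : AtPhase cd d triv test ω (t₀ + s) (narrow d lo hi) lead fun _ => E + s) :
    ∃ s' ≤ searchTime m, ∃ v, 1 ≤ v ∧ v ≤ m + 1 ∧ m ≤ v + 1 ∧
      AtPhase cd d triv test ω (t₀ + s') (.iterate (d (max 1 (v - 2)))) lead fun _ => E + s' := by
  induction b generalizing s lo hi with
  | zero =>
    have : ¬ lo < hi := by
      rw [pow_zero] at hb
      omega
    rw [narrow, if_neg this] at h
    exact ⟨s, by omega, lo, hlo, hlm, by omega, h⟩
  | succ b ih =>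
    by_cases hlt : lo < hi
    · rw [narrow, if_pos hlt] at h
      have h' := h.bisect_step hcd
      rw [pow_succ] at hb
      by_cases hq : Quiet d ω (t₀ + s) ((lo + hi) / 2)
      · rw [if_pos hq] at h'
        refine ih (s + 1) lo _ hlo (by omega) (by omega) hlm ?_ (by omega) (by omega) h'
        by_contra hgt
        exact hok.low s (by omega) _ (by omega) (by omega) hq
      · rw [if_neg hq] at h'
        refine ih (s + 1) _ hi (by omega) (by omega) (by omega) ?_ hmh hhi (by omega) h'
        by_contra hgt
        exact hq (hok.high s (by omega) _ (by omega) (by omega))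
    · rw [narrow, if_neg hlt] at h
      exact ⟨s, by omega, lo, hlo, hlm, by omega, h⟩

/-- Exponential-Search finds the index up to a constant. -/
theorem AtPhase.search (hcd : cd.detectsNoise = true) {t₀ m : ℕ} (hm : 1 ≤ m)
    (hok : SearchOK d ω t₀ m) {lead : Fin n → Bool} {E : ℕ}
    (h : AtPhase cd d triv test ω t₀ (.expand 1) lead fun _ => E) :
    ∃ s ≤ searchTime m, ∃ j, 1 ≤ j ∧ j ≤ max 1 (m - 1) ∧ m ≤ j + 3 ∧
      AtPhase cd d triv test ω (t₀ + s) (.iterate (d j)) lead fun _ => E + s := by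
  obtain ⟨a, ha, ha2, hma, h1⟩ := AtPhase.expand hcd hok 0 (by omega) h
  have hp : 1 ≤ 2 ^ a := Nat.one_le_two_pow
  -- Doubling used `a + 1` tests and bisection needs at most `a` more, with `a ≤ Nat.log 2 m + 1`;
  -- this is how `searchTime` arises.
  obtain ⟨s, hs, v, hv, hvm, hmv, h2⟩ := AtPhase.bisect hcd hok a (a + 1) 1 (2 ^ a) le_rfl hp
    (by omega) (by omega) hma ha2 (by rw [searchTime]; omega) h1
  exact ⟨s, hs, _, le_max_left _ _, by omega, by omega, h2⟩

end Phases

end RadioNetwork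
end

noncomputable section
open scoped unitInterval

namespace RadioNetwork

/-! ### The main loop -/

/-- The election among the devices in `A`, which starts at time `t` and has the guess `√(2 ^ k)`,
has the outcome that is typical for a network of size `n` if `A` consists of the devices with
label `k`. -/
structure ElectionOK (cd : CDModel) (S : Subroutine Bool) {n : ℕ} (ω : Coins n)
    (A : Finset (Fin n)) (t k : ℕ) : Prop where
  le_one : (leaders cd S (subCoins ω A t)).ncard ≤ 1
  central : n ^ 2 ≤ 2 * 4 ^ k → 4 ^ k ≤ 2 * n ^ 2 → (leaders cd S (subCoins ω A t)).ncard = 1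
  far : 2 * 2 ^ k ≤ n ∨ 2 * n ≤ 2 ^ k → (leaders cd S (subCoins ω A t)).ncard = 0

/-- The leaders with labels in `[k₀, k)` are as they should be. -/
structure LeadersOK (d₁ : ℕ) {n : ℕ} (ω : Coins n) (k₀ k : ℕ) (lead : Fin n → Bool) : Prop where
  near : ∀ i, lead i = true → ∃ l, labelOf d₁ (ω (i, 0)) = some l ∧ l < k ∧
    n < 2 * 2 ^ l ∧ 2 ^ l < 2 * n
  unique : ∀ i i' l, lead i = true → lead i' = true → labelOf d₁ (ω (i, 0)) = some l →
    labelOf d₁ (ω (i', 0)) = some l → i = i'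
  exist : ∀ l, k₀ ≤ l → l < k → n ^ 2 ≤ 2 * 4 ^ l → 4 ^ l ≤ 2 * n ^ 2 →
    ∃ i, lead i = true ∧ labelOf d₁ (ω (i, 0)) = some l

def IsCheckpoint (d : ℕ → ℕ) (k : ℕ) : Prop := ∃ i, 1 ≤ i ∧ d i = k

open Classical in
/-- The time at which iteration `k₀ + a` starts, if iteration `k₀` starts at time `t₀`. -/
def iterTime (test : ℝ → Subroutine Bool) (d : ℕ → ℕ) (k₀ t₀ : ℕ) : ℕ → ℕ
  | 0 => t₀
  | a + 1 => iterTime test d k₀ t₀ a + (test √(2 ^ (k₀ + a))).len +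
    if IsCheckpoint d (k₀ + a) then 2 else 0

section

variable {cd : CDModel} {d : ℕ → ℕ} {triv : ℕ → Subroutine (Option ℕ)}
  {test : ℝ → Subroutine Bool} {n : ℕ} {ω : Coins n}

theorem iterTime_mono {k₀ t₀ : ℕ} : Monotone (iterTime test d k₀ t₀) :=
  monotone_nat_of_le_succ fun a => by
    rw [iterTime]
    omega

/-- Only devices with label `k` change their status in iteration `k`, and `ElectionOK` says what
happens to them. Leaders with smaller labels are carried along unchanged. -/
theorem LeadersOK.step {d₁ k₀ k t : ℕ} {lead b : Fin n → Bool} {S : Subroutine Bool}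
    (h : LeadersOK d₁ ω k₀ k lead) (hS : ElectionOK cd S ω (labelled d₁ ω k) t k)
    (hb : ∀ i ∉ labelled d₁ ω k, b i = lead i)
    (hb' : ∀ j, b ((labelled d₁ ω k).orderEmbOfFin rfl j) = true ↔
      j ∈ leaders cd S (subCoins ω (labelled d₁ ω k) t)) :
    LeadersOK d₁ ω k₀ (k + 1) b := by
  set A := labelled d₁ ω k with hA
  have hmem : ∀ i, i ∈ A ↔ labelOf d₁ (ω (i, 0)) = some k := fun i => by simp [hA, labelled]
  have hidx : ∀ i ∈ A, ∃ j, A.orderEmbOfFin rfl j = i := fun i hi => by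
    have : i ∈ Set.range (A.orderEmbOfFin rfl) := by
      rw [Finset.range_orderEmbOfFin]
      exact hi
    exact this
  refine ⟨fun i hi => ?_, fun i i' l hi hi' hl hl' => ?_, fun l hl hlk h1 h2 => ?_⟩
  · by_cases hiA : i ∈ A
    · obtain ⟨j, rfl⟩ := hidx i hiA
      have hj := (hb' j).mp hi
      refine ⟨k, (hmem _).mp hiA, Nat.lt_succ_self k, ?_, ?_⟩
      · by_contra hfar
        have h0 := hS.far (.inl (not_lt.mp hfar))
        rw [Set.ncard_eq_zero] at h0
        rw [h0] at hj
        exact hj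
      · by_contra hfar
        have h0 := hS.far (.inr (not_lt.mp hfar))
        rw [Set.ncard_eq_zero] at h0
        rw [h0] at hj
        exact hj
    · rw [hb i hiA] at hi
      obtain ⟨l, hl, hlk, h1⟩ := h.near i hi
      exact ⟨l, hl, hlk.trans (Nat.lt_succ_self k), h1⟩
  · by_cases hlk : l = k
    · subst hlk
      obtain ⟨j, rfl⟩ := hidx i ((hmem i).mpr hl)
      obtain ⟨j', rfl⟩ := hidx i' ((hmem i').mpr hl')
      have := (Set.ncard_le_one (Set.toFinite _)).mp hS.le_one _ ((hb' j).mp hi) _ ((hb' j').mp hi')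
      rw [this]
    · have hne : ∀ i, labelOf d₁ (ω (i, 0)) = some l → i ∉ A := fun i hi hiA =>
        hlk (Option.some_injective _ (hi.symm.trans ((hmem i).mp hiA)))
      rw [hb _ (hne i hl)] at hi
      rw [hb _ (hne i' hl')] at hi'
      exact h.unique i i' l hi hi' hl hl'
  · rcases Nat.lt_succ_iff_lt_or_eq.mp hlk with hlk | rfl
    · obtain ⟨i, hi, hil⟩ := h.exist l hl hlk h1 h2
      refine ⟨i, ?_, hil⟩
      rw [hb i fun hiA => hlk.ne (Option.some_injective _ (hil.symm.trans ((hmem i).mp hiA)))]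
      exact hi
    · obtain ⟨j, hj⟩ := Set.ncard_eq_one.mp (hS.central h1 h2)
      exact ⟨_, (hb' j).mpr (hj ▸ rfl), (hmem _).mp (A.orderEmbOfFin_mem rfl j)⟩

/-- At most one leader speaks in each of the two announcement slots. -/
theorem LeadersOK.speaker {d₁ k₀ k : ℕ} {lead : Fin n → Bool} (h : LeadersOK d₁ ω k₀ k lead)
    (r : ℕ) :
    (∀ i l, (⟨labelOf d₁ (ω (i, 0)), lead i⟩ : Memory) = ⟨some l, true⟩ → l % 2 ≠ r) ∨
      ∃ w l, (⟨labelOf d₁ (ω (w, 0)), lead w⟩ : Memory) = ⟨some l, true⟩ ∧ l % 2 = r ∧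
        (n < 2 * 2 ^ l ∧ 2 ^ l < 2 * n) ∧ ∀ i, i ≠ w → ∀ l,
          (⟨labelOf d₁ (ω (i, 0)), lead i⟩ : Memory) = ⟨some l, true⟩ → l % 2 ≠ r := by
  by_cases hs : ∀ i l, (⟨labelOf d₁ (ω (i, 0)), lead i⟩ : Memory) = ⟨some l, true⟩ → l % 2 ≠ r
  · exact .inl hs
  push Not at hs
  obtain ⟨w, l, hw, hl⟩ := hs
  have hnear : ∀ i l, (⟨labelOf d₁ (ω (i, 0)), lead i⟩ : Memory) = ⟨some l, true⟩ →
      n < 2 * 2 ^ l ∧ 2 ^ l < 2 * n := by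
    intro i l hi
    simp only [Memory.mk.injEq] at hi
    obtain ⟨l', hl', -, h1⟩ := h.near i hi.2
    rw [hi.1] at hl'
    rwa [Option.some_injective _ hl']
  refine .inr ⟨w, l, hw, hl, hnear w l hw, fun i hi l' hi' hl' => hi ?_⟩
  have h1 := hnear w l hw
  have h2 := hnear i l' hi'
  -- Both `2 ^ a` and `2 ^ b` lie strictly between `n / 2` and `2 n`, so the labels differ by at
  -- most 1, and equal parity makes them equal.
  have key : ∀ a b : ℕ, n < 2 * 2 ^ a → 2 ^ b < 2 * n → b < a + 2 := fun a b ha hb => by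
    refine (Nat.pow_lt_pow_iff_right (a := 2) (by norm_num)).mp ?_
    rw [pow_add]
    omega
  have h3 := key l l' h1.1 h2.2
  have h4 := key l' l h2.1 h1.2
  obtain rfl : l = l' := by omega
  simp only [Memory.mk.injEq] at hw hi'
  exact h.unique i w l hi'.2 hw.2 hi'.1 hw.1

/-- One slot of announcements. -/
theorem announce_step {t r : ℕ} {lead : Fin n → Bool} {E : Fin n → ℕ} {k₀ k : ℕ}
    (hl : LeadersOK (d 1) ω k₀ k lead) {q : Fin n → Proto ((Phase × Memory) ⊕ ℕ)}
    (hc : ∀ i, (estimateNetworkSize cd d triv test).config cd ω t i =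
      (announce cd r ⟨labelOf (d 1) (ω (i, 0)), lead i⟩).bind (stopOr (q i)))
    (hE : ∀ i, (estimateNetworkSize cd d triv test).energy cd ω t i ≤ E i) :
    (∃ e, n ≤ 2 * e ∧ e ≤ 2 * n ∧
      Finished cd d triv test ω (t + 1) e fun i => E i + 1) ∨
    ((∀ i l, (⟨labelOf (d 1) (ω (i, 0)), lead i⟩ : Memory) = ⟨some l, true⟩ → l % 2 ≠ r) ∧
      (∀ i, (estimateNetworkSize cd d triv test).config cd ω (t + 1) i = q i) ∧
      ∀ i, (estimateNetworkSize cd d triv test).energy cd ω (t + 1) i ≤ E i + 1) := by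
  have hslot : ∀ i, ((announce cd r ⟨labelOf (d 1) (ω (i, 0)), lead i⟩).bind
      (stopOr (q i))).IsSlot := fun i => by
    have := (hasLen_announce (cd := cd) r ⟨labelOf (d 1) (ω (i, 0)), lead i⟩).isSlot one_pos
    cases h : announce cd r ⟨labelOf (d 1) (ω (i, 0)), lead i⟩ with
    | done b => rw [h] at this; exact this.elim
    | slot act next => trivial
  have hs := estimateNetworkSize_segment one_pos hc hE (fun i => unroll_of_isSlot (hslot i))
    (fun i => hasLen_announce _ _) fun i => (hasLen_announce _ _).energyLe
  rcases hl.speaker r with h | ⟨w, l, hw, hlr, hnear, h⟩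
  · refine .inr ⟨h, fun i => (hs.1 i).trans ?_, hs.2⟩
    rw [netRun_announce_of_silent (m := fun i => ⟨labelOf (d 1) (ω (i, 0)), lead i⟩) h]
    rfl
  · refine .inl ⟨2 ^ l, hnear.1.le, hnear.2.le, finished_of_config (fun i => (hs.1 i).trans ?_) hs.2⟩
    rw [netRun_announce_of_speaker (m := fun i => ⟨labelOf (d 1) (ω (i, 0)), lead i⟩) hw hlr h]
    rfl

open Classical in
/-- One iteration of the main loop. -/
theorem AtPhase.iterate_step {E₀ t k₀ k : ℕ} {lead : Fin n → Bool} {E : Fin n → ℕ}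
    (h : AtPhase cd d triv test ω t (.iterate k) lead E) (hl : LeadersOK (d 1) ω k₀ k lead)
    (hlen : 0 < (test √(2 ^ k)).len) (hE₀ : (test √(2 ^ k)).run.EnergyLe E₀)
    (hok : ElectionOK cd (test √(2 ^ k)) ω (labelled (d 1) ω k) t k) :
    (∃ T e, T ≤ t + (test √(2 ^ k)).len + 2 ∧ n ≤ 2 * e ∧ e ≤ 2 * n ∧ IsCheckpoint d k ∧
      Finished cd d triv test ω T e fun i =>
        E i + (if labelOf (d 1) (ω (i, 0)) = some k then E₀ else 0) + 2) ∨
    ∃ b, LeadersOK (d 1) ω k₀ (k + 1) b ∧ (IsCheckpoint d k → ∀ i, b i = false) ∧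
      AtPhase cd d triv test ω
        (t + (test √(2 ^ k)).len + if IsCheckpoint d k then 2 else 0) (.iterate (k + 1)) b
        fun i => E i + (if labelOf (d 1) (ω (i, 0)) = some k then E₀ else 0) +
          if IsCheckpoint d k then 2 else 0 := by
  set S := test √(2 ^ k) with hS
  set A := labelled (d 1) ω k with hA
  have hmem : ∀ i, i ∈ A ↔ labelOf (d 1) (ω (i, 0)) = some k := fun i => by simp [hA, labelled]
  obtain ⟨b, hrun, hbA, hb⟩ := exists_netRun_labelled (cd := cd) (ω := ω) S A t lead
  have hlb := hl.step hok hbA hb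
  have hs := estimateNetworkSize_segment (T := S.len) hlen
    (p := fun i => if i ∈ A then S.run else .wait S.len (lead i))
    (E' := fun i => if labelOf (d 1) (ω (i, 0)) = some k then E₀ else 0)
    (f := fun i b =>
      if ∃ i, 1 ≤ i ∧ d i = k then
        (announce cd 1 ⟨labelOf (d 1) (ω (i, 0)), b⟩).bind <| stopOr <|
        (announce cd 0 ⟨labelOf (d 1) (ω (i, 0)), b⟩).bind <| stopOr <|
        .done (.inl (.iterate (k + 1), ⟨labelOf (d 1) (ω (i, 0)), b⟩))
      else .done (.inl (.iterate (k + 1), ⟨labelOf (d 1) (ω (i, 0)), b⟩)))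
    (fun i => (h i).1) (fun i => (h i).2) (fun i => by
      simp only [hmem]
      rfl) (fun i => by
      split_ifs
      · exact S.hasLen_run
      · exact Proto.hasLen_wait _ _) fun i => by
      simp only [hmem]
      split_ifs
      · exact hE₀
      · exact Proto.energyLe_wait _ _
  simp only [hrun] at hs
  by_cases hcp : IsCheckpoint d k
  · have hc1 : ∀ i, (estimateNetworkSize cd d triv test).config cd ω (t + S.len) i = _ := fun i =>
      (hs.1 i).trans (if_pos hcp)
    rcases announce_step hlb hc1 hs.2 with ⟨e, he1, he2, hf⟩ | ⟨hq1, hc2, hE2⟩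
    · refine .inl ⟨_, e, by omega, he1, he2, hcp, fun i => ⟨(hf i).1, (hf i).2.trans ?_⟩⟩
      dsimp only
      omega
    · rcases announce_step hlb hc2 hE2 with ⟨e, he1, he2, hf⟩ | ⟨hq0, hc3, hE3⟩
      · exact .inl ⟨_, e, by omega, he1, he2, hcp, hf⟩
      · refine .inr ⟨b, hlb, fun _ i => ?_, fun i => ?_⟩
        · by_contra hbi
          have hbi : b i = true := by simpa using hbi
          obtain ⟨l, hl, -⟩ := hlb.near i hbi
          have h1 := hq1 i l (by rw [hl, hbi])
          have h0 := hq0 i l (by rw [hl, hbi])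
          omega
        · rw [if_pos hcp]
          exact ⟨hc3 i, hE3 i⟩
  · refine .inr ⟨b, hlb, fun h => absurd h hcp, fun i => ?_⟩
    rw [if_neg hcp]
    exact ⟨(hs.1 i).trans (if_neg hcp), hs.2 i⟩

/-- There is a label `l` such that `2 ^ l` is within a factor `√2` of `n`. -/
theorem exists_central {n k₀ D : ℕ} (h1 : 2 ^ k₀ < n) (h2 : n ≤ 2 ^ D) :
    ∃ l, k₀ ≤ l ∧ l ≤ D ∧ n ^ 2 ≤ 2 * 4 ^ l ∧ 4 ^ l ≤ 2 * n ^ 2 := by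
  have hpow : ∀ a : ℕ, (2 ^ a) ^ 2 = 4 ^ a := fun a => by
    rw [← pow_mul, mul_comm, pow_mul]
    norm_num
  have hD : n ^ 2 ≤ 2 * 4 ^ D := by
    have := Nat.pow_le_pow_left h2 2
    rw [hpow] at this
    omega
  have hex : ∃ l, n ^ 2 ≤ 2 * 4 ^ l := ⟨D, hD⟩
  classical
  -- The least `l` with `n ≤ √2 * 2 ^ l`, in squared form; minimality gives the opposite inequality.
  refine ⟨Nat.find hex, ?_, Nat.find_min' hex hD, Nat.find_spec hex, ?_⟩
  · have h3 := Nat.find_spec hex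
    have h4 := Nat.pow_lt_pow_left h1 (n := 2) (by norm_num)
    rw [hpow] at h4
    refine Nat.lt_succ_iff.mp ((Nat.pow_lt_pow_iff_right (a := 4) (by norm_num)).mp ?_)
    rw [Nat.succ_eq_add_one, pow_succ]
    omega
  · rcases hl : Nat.find hex with _ | l
    · have : 1 ≤ n ^ 2 := Nat.one_le_pow _ _ (Nat.zero_lt_of_lt h1)
      rw [pow_zero]
      omega
    · have := Nat.find_min hex (m := l) (by omega)
      rw [pow_succ]
      omega

open Classical in
/-- The main loop ends at the latest at a checkpoint above `log n`. -/
theorem AtPhase.iterate {E₀ E t₀ k₀ D : ℕ}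
    (h : AtPhase cd d triv test ω t₀ (.iterate k₀) (fun _ => false) fun _ => E)
    (hk₀ : 2 ^ k₀ < n) (hD : IsCheckpoint d D) (hDn : n ≤ 2 ^ D)
    (hlen : ∀ k, k₀ ≤ k → 0 < (test √(2 ^ k)).len) (hE₀ : ∀ x, (test x).run.EnergyLe E₀)
    (hok : ∀ a, k₀ + a ≤ D → ElectionOK cd (test √(2 ^ (k₀ + a))) ω (labelled (d 1) ω (k₀ + a))
      (iterTime test d k₀ t₀ a) (k₀ + a)) :
    ∃ T e, T ≤ iterTime test d k₀ t₀ (D + 1 - k₀) ∧ n ≤ 2 * e ∧ e ≤ 2 * n ∧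
      Finished cd d triv test ω T e fun _ =>
        E + 2 * Nat.count (fun a => IsCheckpoint d (k₀ + a)) (D + 1 - k₀) + E₀ := by
  set N := D + 1 - k₀ with hN
  have hk₀D : k₀ < D := (Nat.pow_lt_pow_iff_right (a := 2) (by norm_num)).mp (hk₀.trans_le hDn)
  -- Either the run has finished, or it goes on with correct leaders. Unfinished after a checkpoint
  -- means that there is no leader at all, because any leader would have spoken in one of the two
  -- slots.
  have main : ∀ a ≤ N, (∃ T e, T ≤ iterTime test d k₀ t₀ N ∧ n ≤ 2 * e ∧ e ≤ 2 * n ∧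
      Finished cd d triv test ω T e fun _ =>
        E + 2 * Nat.count (fun a => IsCheckpoint d (k₀ + a)) N + E₀) ∨
      ∃ lead, LeadersOK (d 1) ω k₀ (k₀ + a) lead ∧
        (∀ c, a = c + 1 → IsCheckpoint d (k₀ + c) → ∀ i, lead i = false) ∧
        AtPhase cd d triv test ω (iterTime test d k₀ t₀ a) (.iterate (k₀ + a)) lead fun i =>
          E + 2 * Nat.count (fun a => IsCheckpoint d (k₀ + a)) a +
            if ∃ l, labelOf (d 1) (ω (i, 0)) = some l ∧ k₀ ≤ l ∧ l < k₀ + a then E₀ else 0 := by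
    intro a
    induction a with
    | zero =>
      refine fun _ => .inr ⟨fun _ => false, ⟨fun i hi => by simp at hi, fun i i' l hi => by simp at hi,
        fun l h1 h2 => by omega⟩, fun c hc => by omega, fun i => ⟨(h i).1, (h i).2.trans ?_⟩⟩
      dsimp only
      omega
    | succ a ih =>
      intro ha
      rcases ih (by omega) with hfin | ⟨lead, hlead, -, hph⟩
      · exact .inl hfin
      have hstep := hph.iterate_step hlead (hlen _ (by omega)) (hE₀ _) (hok a (by omega))
      -- A device has at most one label, so the election energy `E₀` is charged at most once over
      -- all iterations.
      have hen : ∀ i : Fin n, (if ∃ l, labelOf (d 1) (ω (i, 0)) = some l ∧ k₀ ≤ l ∧ l < k₀ + a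
          then E₀ else 0) + (if labelOf (d 1) (ω (i, 0)) = some (k₀ + a) then E₀ else 0) ≤
          if ∃ l, labelOf (d 1) (ω (i, 0)) = some l ∧ k₀ ≤ l ∧ l < k₀ + (a + 1)
          then E₀ else 0 := by
        intro i
        by_cases h2 : labelOf (d 1) (ω (i, 0)) = some (k₀ + a)
        · rw [if_neg, if_pos h2, if_pos ⟨_, h2, by omega, by omega⟩, zero_add]
          rintro ⟨l, hl, -, hlt⟩
          rw [h2] at hl
          have := Option.some_injective _ hl
          omega
        · rw [if_neg h2, add_zero]
          by_cases h1 : ∃ l, labelOf (d 1) (ω (i, 0)) = some l ∧ k₀ ≤ l ∧ l < k₀ + a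
          · obtain ⟨l, hl, h3, h4⟩ := h1
            rw [if_pos ⟨l, hl, h3, h4⟩, if_pos ⟨l, hl, h3, by omega⟩]
          · rw [if_neg h1]
            exact Nat.zero_le _
      have hle : ∀ i : Fin n, (if ∃ l, labelOf (d 1) (ω (i, 0)) = some l ∧ k₀ ≤ l ∧ l < k₀ + (a + 1)
          then E₀ else 0) ≤ E₀ := fun i => by split_ifs <;> omega
      rcases hstep with ⟨T, e, hT, he1, he2, hcp, hf⟩ | ⟨b, hb, hbc, hb'⟩
      · refine .inl ⟨T, e, ?_, he1, he2, fun i => ⟨(hf i).1, (hf i).2.trans ?_⟩⟩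
        · refine le_trans ?_ (iterTime_mono (test := test) (d := d) (k₀ := k₀) (t₀ := t₀) ha)
          rw [iterTime, if_pos hcp]
          exact hT
        · have hc := Nat.count_monotone (fun a => IsCheckpoint d (k₀ + a)) ha
          rw [Nat.count_succ, if_pos hcp] at hc
          have := hen i
          have := hle i
          dsimp only
          omega
      · refine .inr ⟨b, hb, fun c hc hcp => ?_, fun i => ⟨(hb' i).1, (hb' i).2.trans ?_⟩⟩
        · obtain rfl : a = c := by omega
          exact hbc hcp
        · have := hen i
          rw [Nat.count_succ]
          dsimp only
          split_ifs at * <;> omega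
  rcases main N le_rfl with hfin | ⟨lead, hlead, hno, -⟩
  · exact hfin
  -- After the checkpoint `D` a leader with a central label would exist although there are none, so
  -- the run cannot be unfinished.
  · obtain ⟨l, hl1, hl2, hl3, hl4⟩ := exists_central hk₀ hDn
    obtain ⟨i, hi, -⟩ := hlead.exist l hl1 (by omega) hl3 hl4
    have hND : k₀ + (D - k₀) = D := by omega
    rw [hno (D - k₀) (by omega) (hND.symm ▸ hD) i] at hi
    exact absurd hi (by simp)

end

end RadioNetwork
end

/-! ### Time and energy of a run in which all goes well -/

noncomputable section
open scoped unitInterval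

namespace RadioNetwork

section Checkpoints

variable {γ : ℝ} {d : ℕ → ℕ}

/-- The requirement `100 ≤ √(2 ^ d 1)` excludes exponents up to 13, since `2 ^ 13 < 10 ^ 4`. -/
theorem Admissible.first (h : Admissible γ d) : 13 < d 1 := by
  by_contra hle
  have h1 : √(2 ^ d 1) ≤ √(2 ^ 13) := by
    refine Real.sqrt_le_sqrt ?_
    exact pow_le_pow_right₀ (by norm_num) (not_lt.mp hle)
  have h2 : √(2 ^ 13) < (100 : ℝ) := by
    rw [Real.sqrt_lt' (by norm_num)]
    norm_num
  linarith [h.large]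

theorem Admissible.four_mul_le (h : Admissible 4 d) {i : ℕ} (hi : 1 ≤ i) :
    4 * d i ≤ d (i + 1) := by
  exact_mod_cast h.growth i hi

theorem Admissible.monotone (h : Admissible 4 d) {i j : ℕ} (hi : 1 ≤ i) (hij : i ≤ j) :
    d i ≤ d j := by
  induction j, hij using Nat.le_induction with
  | base => exact le_rfl
  | succ j hj ih =>
    have := h.four_mul_le (hi.trans hj)
    omega

theorem Admissible.add_lt (h : Admissible 4 d) {i : ℕ} (hi : 1 ≤ i) : i + 12 < d i := by
  induction i, hi using Nat.le_induction with
  | base => exact h.first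
  | succ i hi ih =>
    have := h.four_mul_le hi
    omega

theorem Admissible.strictMono (h : Admissible 4 d) {i j : ℕ} (hi : 1 ≤ i) (hij : i < j) :
    d i < d j := by
  have h1 := h.monotone (i := i + 1) (by omega) hij
  have h2 := h.four_mul_le hi
  have h3 := h.add_lt hi
  omega

open Classical in
theorem Admissible.count_isCheckpoint_le (h : Admissible 4 d) {j m : ℕ} (hj : 1 ≤ j)
    (hjm : j ≤ m) : Nat.count (fun a => IsCheckpoint d (d j + a)) (d m + 1 - d j) ≤ m + 1 - j := by
  rw [Nat.count_eq_card_filter_range]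
  refine (Finset.card_le_card (t := (Finset.Icc j m).image fun i => d i - d j) ?_).trans
    (Finset.card_image_le.trans_eq (Nat.card_Icc j m))
  intro a ha
  rw [Finset.mem_filter, Finset.mem_range] at ha
  obtain ⟨ha, i, hi, hia⟩ := ha
  rw [Finset.mem_image]
  refine ⟨i, Finset.mem_Icc.mpr ⟨?_, ?_⟩, by omega⟩
  · by_contra hlt
    have := h.strictMono hi (not_le.mp hlt)
    omega
  · by_contra hlt
    have := h.strictMono (hj.trans hjm) (not_le.mp hlt)
    have := h.monotone hj hjm
    omega

end Checkpoints

theorem positions_sqrt_le (k : ℕ) : positions √(2 ^ k) ≤ k / 2 + 1 := by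
  rw [positions, Nat.ceil_le, Real.sqrt_eq_rpow, ← Real.rpow_natCast, ← Real.rpow_mul (by norm_num),
    Real.logb_rpow (by norm_num) (by norm_num)]
  have h1 : k ≤ 2 * (k / 2 + 1) := by omega
  have h2 : (k : ℝ) ≤ 2 * ((k / 2 + 1 : ℕ) : ℝ) := by exact_mod_cast h1
  linarith

theorem positions_sqrt_pos {k : ℕ} (hk : 0 < k) : 0 < positions √(2 ^ k) := by
  rw [positions, Nat.ceil_pos, Real.sqrt_eq_rpow, ← Real.rpow_natCast,
    ← Real.rpow_mul (by norm_num), Real.logb_rpow (by norm_num) (by norm_num)]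
  positivity

theorem len_testNetworkSize (x : ℝ) : (testNetworkSize x).len = 5 * positions x := rfl

/-- An iteration `k ≤ D` has at most `D / 2 + 1` positions of five slots and two slots of
announcements, so the loop takes quadratic time in `D`. -/
theorem iterTime_testNetworkSize_le (d : ℕ → ℕ) (k₀ t₀ a D : ℕ) (h : k₀ + a ≤ D + 1) :
    iterTime testNetworkSize d k₀ t₀ a ≤ t₀ + a * (5 * (D / 2 + 1) + 2) := by
  induction a with
  | zero => simp [iterTime]
  | succ a ih =>
    have h1 := ih (by omega)
    have h2 := positions_sqrt_le (k₀ + a)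
    have h3 : (k₀ + a) / 2 ≤ D / 2 := Nat.div_le_div_right (by omega)
    rw [iterTime, len_testNetworkSize, add_mul a 1, one_mul]
    split_ifs <;> omega

section

variable {cd : CDModel} {d : ℕ → ℕ} {triv : ℕ → Subroutine (Option ℕ)}
  {test : ℝ → Subroutine Bool} {n : ℕ} {ω : Coins n}

theorem unroll_bind_of_isSlot {κ β δ : Type} {body : κ → Proto (κ ⊕ β)} {p : Proto δ}
    (hp : p.IsSlot) (f : δ → Proto (κ ⊕ β)) : unroll body (p.bind f) = p.bind f := by
  cases p with
  | done b => exact hp.elim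
  | slot act next => rfl

/-- The situation after Trivial-Algorithm. -/
theorem estimateNetworkSize_triv (hlen : 0 < (triv (2 ^ d 1)).len) :
    (∀ i, (estimateNetworkSize cd d triv test).config cd ω (triv (2 ^ d 1)).len i =
      (netRun cd ω 0 (triv (2 ^ d 1)).len (fun _ => (triv (2 ^ d 1)).run) i).bind (stopOr <|
        .done (.inl (if cd.detectsNoise then .expand 1 else .iterate (d 1),
          ⟨labelOf (d 1) (ω (i, 0)), false⟩)))) ∧
    ∀ i, (estimateNetworkSize cd d triv test).energy cd ω (triv (2 ^ d 1)).len i ≤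
      (triv (2 ^ d 1)).len := by
  have hs := estimateNetworkSize_segment (cd := cd) (d := d) (triv := triv) (test := test) (ω := ω)
    (t := 0) hlen (p := fun _ => (triv (2 ^ d 1)).run) (E := fun _ => 0)
    (E' := fun _ => (triv (2 ^ d 1)).len)
    (f := fun i => stopOr <|
        .done (.inl (if cd.detectsNoise then .expand 1 else .iterate (d 1),
          ⟨labelOf (d 1) (ω (i, 0)), false⟩)))
    (fun i => rfl) (fun i => by simp [Device.energy])
    (fun i => unroll_bind_of_isSlot ((triv (2 ^ d 1)).hasLen_run.isSlot hlen) _)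
    (fun i => (triv (2 ^ d 1)).hasLen_run) fun i => (triv (2 ^ d 1)).hasLen_run.energyLe
  simp only [zero_add] at hs
  exact hs

/-- Everything goes well in a run on a network whose size has the index `m`. -/
structure GoodRun (cd : CDModel) (d : ℕ → ℕ) (triv : ℕ → Subroutine (Option ℕ))
    (test : ℝ → Subroutine Bool) {n : ℕ} (ω : Coins n) (m : ℕ) : Prop where
  search : cd.detectsNoise = true → SearchOK d ω (triv (2 ^ d 1)).len m
  elect : ∀ s ≤ searchTime m, ∀ j, 1 ≤ j → j < m → ∀ k, d j ≤ k → k ≤ d m →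
    ElectionOK cd (test √(2 ^ k)) ω (labelled (d 1) ω k)
      (iterTime test d (d j) ((triv (2 ^ d 1)).len + s) (k - d j)) k

-- With collision detection the search supplies a start `d j` with `j < m ≤ j + 3`; otherwise `j =
-- 1` and no time is lost. In both cases the start is below `log n`, as the main loop needs, and the
-- checkpoint `d m` ends it.
open Classical in
theorem GoodRun.finished {m E₀ : ℕ} (h : GoodRun cd d triv test ω m) (hd : Admissible 4 d)
    (hm : 2 ≤ m) (hnm : 2 ^ d (m - 1) < n) (hmn : n ≤ 2 ^ d m)
    (hlen : 0 < (triv (2 ^ d 1)).len) (hlen' : ∀ k, d 1 ≤ k → 0 < (test √(2 ^ k)).len)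
    (hE₀ : ∀ x, (test x).run.EnergyLe E₀)
    (hnone : ∀ i, (triv (2 ^ d 1)).run.device.result cd ω (triv (2 ^ d 1)).len i = some none) :
    ∃ s j, s ≤ searchTime m ∧ 1 ≤ j ∧ j < m ∧ (cd.detectsNoise = true → m ≤ j + 3) ∧
      (cd.detectsNoise = false → s = 0) ∧
      ∃ T e, T ≤ iterTime test d (d j) ((triv (2 ^ d 1)).len + s) (d m + 1 - d j) ∧ n ≤ 2 * e ∧
        e ≤ 2 * n ∧ Finished cd d triv test ω T e fun _ =>
          (triv (2 ^ d 1)).len + s + 2 * (m + 1 - j) + E₀ := by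
  set T₁ := (triv (2 ^ d 1)).len with hT₁
  obtain ⟨hc, hE⟩ := estimateNetworkSize_triv (cd := cd) (d := d) (triv := triv) (test := test)
    (ω := ω) hlen
  have h0 : AtPhase cd d triv test ω T₁
      (if cd.detectsNoise then .expand 1 else .iterate (d 1)) (fun _ => false) fun _ => T₁ :=
    fun i => ⟨(hc i).trans (by rw [(Proto.device_result _ _ _ _).mp (hnone i)]; rfl), hE i⟩
  obtain ⟨s, hs, j, hj, hjm, hcd, hcd', hph⟩ : ∃ s ≤ searchTime m, ∃ j, 1 ≤ j ∧ j < m ∧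
      (cd.detectsNoise = true → m ≤ j + 3) ∧ (cd.detectsNoise = false → s = 0) ∧
      AtPhase cd d triv test ω (T₁ + s) (.iterate (d j)) (fun _ => false) fun _ => T₁ + s := by
    cases hcd : cd.detectsNoise with
    | false =>
      rw [hcd] at h0
      exact ⟨0, Nat.zero_le _, 1, le_rfl, by omega, fun h => by simp at h, fun _ => rfl, h0⟩
    | true =>
      rw [hcd] at h0
      obtain ⟨s, hs, j, hj, hjm, hmj, hph⟩ := AtPhase.search hcd (by omega) (h.search hcd) h0
      exact ⟨s, hs, j, hj, by omega, fun _ => hmj, fun h => by simp at h, hph⟩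
  refine ⟨s, j, hs, hj, hjm, hcd, hcd', ?_⟩
  obtain ⟨T, e, hT, he1, he2, hf⟩ := hph.iterate (E₀ := E₀) (D := d m)
    ((Nat.pow_le_pow_right (by norm_num) (hd.monotone hj (by omega))).trans_lt hnm)
    ⟨m, by omega, rfl⟩ hmn
    (fun k hk => hlen' k ((hd.monotone le_rfl hj).trans hk)) hE₀ fun a ha => by
      have := h.elect s hs j hj hjm (d j + a) (by omega) ha
      rwa [Nat.add_sub_cancel_left] at this
  refine ⟨T, e, hT, he1, he2, fun i => ⟨(hf i).1, (hf i).2.trans ?_⟩⟩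
  have := hd.count_isCheckpoint_le hj hjm.le
  dsimp only
  omega

theorem IsIndex.le_pow {m : ℕ} (h : IsIndex d n m) (hn : 1 ≤ n) : n ≤ 2 ^ d m := by
  have h1 := h.2.1
  rw [Real.logb_le_iff_le_rpow (by norm_num) (by exact_mod_cast hn), Real.rpow_natCast] at h1
  exact_mod_cast h1

theorem IsIndex.pow_lt {m : ℕ} (h : IsIndex d n m) (hm : 2 ≤ m) (hn : 1 ≤ n) :
    2 ^ d (m - 1) < n := by
  have h1 := h.2.2 hm
  rw [Real.lt_logb_iff_rpow_lt (by norm_num) (by exact_mod_cast hn), Real.rpow_natCast] at h1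
  exact_mod_cast h1

theorem CDModel.scale_nonneg (cd : CDModel) {x : ℝ} (hx : 1 ≤ x) : 0 ≤ cd.scale x := by
  rw [CDModel.scale]
  split_ifs
  · exact Real.logb_nonneg (by norm_num) hx
  · linarith

theorem natLog_le_logb {m : ℕ} (hm : 1 ≤ m) : (Nat.log 2 m : ℝ) ≤ Real.logb 2 m := by
  rw [Real.le_logb_iff_rpow_le (by norm_num) (by exact_mod_cast hm), Real.rpow_natCast]
  exact_mod_cast Nat.pow_log_le_self 2 (by omega)

/-- The behaviour of Estimate-Network-Size when everything goes well. -/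
theorem GoodRun.solves {m : ℕ} (hn : 1 ≤ n) (hd : Admissible 4 d) (hi : IsIndex d n m)
    (hlen : 0 < (triv (2 ^ d 1)).len)
    (htriv : (2 ^ d 1 < n ∧
        ∀ i, (triv (2 ^ d 1)).run.device.result cd ω (triv (2 ^ d 1)).len i = some none) ∨
      ∃ e : ℕ, (n : ℝ) / 2 ≤ e ∧ (e : ℝ) ≤ 2 * n ∧
        ∀ i, (triv (2 ^ d 1)).run.device.result cd ω (triv (2 ^ d 1)).len i = some (some e))
    (h : 2 ≤ m → GoodRun cd d triv testNetworkSize ω m) :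
    Solves (estimateNetworkSize cd d triv testNetworkSize) cd ω
      (30 * (d m : ℝ) ^ 2 + (triv (2 ^ d 1)).len)
      (3020 * (cd.scale m + 1) + (triv (2 ^ d 1)).len) := by
  have hm1 : (1 : ℝ) ≤ m := by exact_mod_cast hi.1
  have hsc := cd.scale_nonneg hm1
  rcases htriv with ⟨hlt, hnone⟩ | ⟨e, he1, he2, hres⟩
  -- A correct verdict "more than `2 ^ d 1`" excludes index 1.
  · have hm : 2 ≤ m := by
      by_contra hlt'
      obtain rfl : m = 1 := by have := hi.1; omega
      exact absurd (hi.le_pow hn) (not_le.mpr hlt)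
    obtain ⟨s, j, hs, hj, hjm, hcd, hcd', T, e, hT, he1, he2, hf⟩ := (h hm).finished (E₀ := 3005) hd
      hm (hi.pow_lt hm hn) (hi.le_pow hn) hlen (fun k hk => by
        rw [len_testNetworkSize]
        have := positions_sqrt_pos (k := k) (by have := hd.first; omega)
        omega) (fun x => election_energyLe) hnone
    have hlog : Nat.log 2 m ≤ m := (Nat.log_lt_self 2 (by omega)).le
    have hmd := hd.add_lt hi.1
    refine ⟨T, e, ?_, ?_, ?_, fun i => ⟨(hf i).1, ?_⟩⟩
    · have hT' := hT.trans (iterTime_testNetworkSize_le d _ _ _ (d m) (by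
        have := hd.monotone hj hjm.le
        omega))
      have h1 : (d m + 1 - d j) * (5 * (d m / 2 + 1) + 2) ≤ d m * (10 * d m) := by
        refine Nat.mul_le_mul ?_ ?_
        · have := hd.add_lt hj
          omega
        · omega
      have h2 : s ≤ d m * d m := by
        rw [searchTime] at hs
        refine (show s ≤ 14 * d m by omega).trans (Nat.mul_le_mul_right _ ?_)
        omega
      have h3 : T ≤ 30 * (d m) ^ 2 + (triv (2 ^ d 1)).len := by
        nlinarith
      exact_mod_cast h3
    · have : (n : ℝ) ≤ 2 * e := by exact_mod_cast he1
      linarith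
    · exact_mod_cast he2
    · have hen : ((estimateNetworkSize cd d triv testNetworkSize).energy cd ω T i : ℝ) ≤
          (triv (2 ^ d 1)).len + s + 2 * (m + 1 - j : ℕ) + 3005 := by exact_mod_cast (hf i).2
      refine hen.trans ?_
      -- With collision detection the search costs `O(log m)` and at most four checkpoints are met;
      -- without it there is no search, and up to `m` checkpoints are met.
      cases hc : cd.detectsNoise with
      | true =>
        have h1 : (m + 1 - j : ℕ) ≤ 4 := by
          have := hcd hc
          omega
        have h1' : ((m + 1 - j : ℕ) : ℝ) ≤ 4 := by exact_mod_cast h1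
        have h2 : (s : ℝ) ≤ 2 * Real.logb 2 m + 3 := by
          have h3 : (s : ℝ) ≤ 2 * (Nat.log 2 m : ℝ) + 3 := by exact_mod_cast hs
          have := natLog_le_logb hi.1
          linarith
        rw [CDModel.scale, if_pos hc] at hsc ⊢
        linarith
      | false =>
        have h1 : ((m + 1 - j : ℕ) : ℝ) ≤ m := by exact_mod_cast (by omega : m + 1 - j ≤ m)
        rw [hcd' hc, CDModel.scale, if_neg (by simp [hc])]
        push_cast
        linarith
  · obtain ⟨hc, hE⟩ := estimateNetworkSize_triv (cd := cd) (d := d) (triv := triv)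
      (test := testNetworkSize) (ω := ω) hlen
    have hf := finished_of_config (e := e) (fun i => (hc i).trans
      (by rw [(Proto.device_result _ _ _ _).mp (hres i)]; rfl)) hE
    refine ⟨_, e, ?_, he1, he2, fun i => ⟨(hf i).1, ?_⟩⟩
    · have : 0 ≤ 30 * (d m : ℝ) ^ 2 := by positivity
      linarith
    · have : ((estimateNetworkSize cd d triv testNetworkSize).energy cd ω (triv (2 ^ d 1)).len i : ℝ) ≤
          (triv (2 ^ d 1)).len := by exact_mod_cast (hf i).2
      linarith

end

end RadioNetwork
end

noncomputable section
open scoped unitInterval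

namespace RadioNetwork

/-! ### The labels -/

section Label

variable {d₁ k : ℕ}

theorem summable_labelProb (a : ℕ) : Summable fun j : ℕ => 1 / √(2 ^ (a + j)) := by
  have h : ∀ j : ℕ, 1 / √(2 ^ (a + j)) = 1 / √(2 ^ a) * (1 / √2) ^ j := fun j => by
    have h1 : √((2 : ℝ) ^ j) = √2 ^ j := by
      rw [Real.sqrt_eq_iff_mul_self_eq (by positivity) (by positivity), ← mul_pow,
        Real.mul_self_sqrt (by norm_num)]
    rw [pow_add, Real.sqrt_mul (by positivity), h1, one_div_pow, one_div_mul_one_div]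
  simp only [h]
  refine (summable_geometric_of_lt_one (by positivity) ?_).mul_left _
  rw [div_lt_one (by positivity), Real.lt_sqrt (by norm_num)]
  norm_num

/-- The probability of a label of at most `k`. -/
def labelSum (d₁ k : ℕ) : ℝ := ∑ j ∈ Finset.Icc d₁ k, 1 / √(2 ^ j)

theorem labelSum_le_one (h : ∑' j : ℕ, 1 / √(2 ^ (d₁ + j)) ≤ 1) (k : ℕ) : labelSum d₁ k ≤ 1 := by
  refine le_trans ?_ h
  refine le_trans (le_of_eq ?_) ((summable_labelProb d₁).sum_le_tsum (Finset.range (k + 1 - d₁))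
    fun j _ => by positivity)
  rw [labelSum, ← Finset.Ico_add_one_right_eq_Icc, Finset.sum_Ico_eq_sum_range]

theorem labelSum_mono : Monotone (labelSum d₁) := fun k l hkl =>
  Finset.sum_le_sum_of_subset_of_nonneg (Finset.Icc_subset_Icc le_rfl hkl)
    fun j _ _ => by positivity

theorem labelSum_sub (hk : d₁ < k) : labelSum d₁ k = labelSum d₁ (k - 1) + 1 / √(2 ^ k) := by
  obtain ⟨k, rfl⟩ := Nat.exists_eq_succ_of_ne_zero (by omega : k ≠ 0)
  rw [labelSum, Nat.succ_eq_add_one, Finset.sum_Icc_succ_top (by omega), Nat.add_sub_cancel, labelSum]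

theorem labelSum_self (d₁ : ℕ) : labelSum d₁ d₁ = 1 / √(2 ^ d₁) := by
  simp [labelSum]

/-- The labels cut `[0, 1)` into consecutive intervals of the prescribed lengths. The lower end for
`k = d₁` is stated separately because `k - 1` is truncated when `d₁ = 0`. -/
theorem labelOf_eq_some (hk : d₁ ≤ k) (u : I) : labelOf d₁ u = some k ↔
    (if d₁ = k then 0 else labelSum d₁ (k - 1)) ≤ (u : ℝ) ∧ (u : ℝ) < labelSum d₁ k := by
  classical
  have hdef : labelOf d₁ u = if h : ∃ k, d₁ ≤ k ∧ (u : ℝ) < labelSum d₁ k then some (Nat.find h)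
      else none := by
    rw [labelOf]
    rfl
  rw [hdef]
  constructor
  · intro h
    split_ifs at h with hex
    · have h := Option.some_injective _ h
      have h1 := Nat.find_spec hex
      rw [h] at h1
      refine ⟨?_, h1.2⟩
      split_ifs with hkd
      · exact u.2.1
      · have h2 := Nat.find_min hex (m := k - 1) (by omega)
        push Not at h2
        exact h2 (by omega)
  · rintro ⟨h1, h2⟩
    have hex : ∃ k, d₁ ≤ k ∧ (u : ℝ) < labelSum d₁ k := ⟨k, hk, h2⟩
    rw [dif_pos hex]
    congr 1
    rw [Nat.find_eq_iff]
    refine ⟨⟨hk, h2⟩, fun j hj hj' => ?_⟩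
    rw [if_neg (by omega)] at h1
    have := labelSum_mono (d₁ := d₁) (show j ≤ k - 1 by omega)
    linarith [hj'.2]

theorem volume_labelOf (h : ∑' j : ℕ, 1 / √(2 ^ (d₁ + j)) ≤ 1) (hk : d₁ ≤ k) :
    volume {u | labelOf d₁ u = some k} = ENNReal.ofReal (1 / √(2 ^ k)) := by
  simp only [labelOf_eq_some hk]
  rw [volume_Ico _ (labelSum_le_one h k)]
  · congr 1
    split_ifs with hkd
    · rw [← hkd, labelSum_self, sub_zero]
    · rw [labelSum_sub (by omega)]
      ring
  · split_ifs
    · exact le_rfl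
    · exact Finset.sum_nonneg fun j _ => by positivity

theorem measurableSet_labelOf (hk : d₁ ≤ k) : MeasurableSet {u | labelOf d₁ u = some k} := by
  simp only [labelOf_eq_some hk]
  exact (measurableSet_le measurable_const measurable_subtype_coe).inter
    (measurableSet_lt measurable_subtype_coe measurable_const)

end Label

/-! ### The number of devices with a given label -/

section Count

variable {n : ℕ}

/-- Chebyshev's inequality for the number of devices whose random number lies in `F`. -/
theorem coinMeasure_card_le {F : Set I} (hF : MeasurableSet F) {p b : ℝ} (hp : 0 ≤ p)
    (hv : volume F = ENNReal.ofReal p) (hb : 0 < b) (a : Coins n → ℝ)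
    (ha : ∀ ω, a ω = ∑ i, F.indicator (fun _ => (1 : ℝ)) (ω (i, 0))) :
    coinMeasure n {ω | b ≤ |a ω - n * p|} ≤ ENNReal.ofReal (n * p / b ^ 2) := by
  obtain rfl : a = fun ω => ∑ i, F.indicator (fun _ => (1 : ℝ)) (ω (i, 0)) := funext ha
  set X : Fin n → Coins n → ℝ := fun i ω => F.indicator (fun _ => (1 : ℝ)) (ω (i, 0)) with hX
  have hXm : ∀ i, Measurable (X i) := fun i =>
    (measurable_const.indicator hF).comp (measurable_pi_apply _)
  have hX01 : ∀ i ω, 0 ≤ X i ω ∧ X i ω ≤ 1 := fun i ω => by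
    simp only [hX]
    by_cases h : ω (i, 0) ∈ F <;> simp [h]
  have hXL : ∀ i, MemLp (X i) 2 (coinMeasure n) := fun i =>
    MemLp.of_bound (hXm i).aestronglyMeasurable 1 (ae_of_all _ fun ω => by
      rw [Real.norm_eq_abs, abs_of_nonneg (hX01 i ω).1]
      exact (hX01 i ω).2)
  have hset : ∀ i, (coinMeasure n) ((fun ω => ω (i, 0)) ⁻¹' F) = ENNReal.ofReal p := fun i => by
    have h := coinMeasure_slot (n := n) 0 {i} (A := fun _ => F) fun _ _ => hF
    simp only [Finset.mem_singleton, forall_eq, Finset.prod_singleton] at h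
    rw [← hv, ← h]
    rfl
  have hE : ∀ i, ∫ ω, X i ω ∂(coinMeasure n) = p := fun i => by
    have : X i = ((fun ω : Coins n => ω (i, 0)) ⁻¹' F).indicator fun _ => (1 : ℝ) := rfl
    have hm : MeasurableSet ((fun ω : Coins n => ω (i, 0)) ⁻¹' F) := hF.preimage (by fun_prop)
    rw [this, integral_indicator_const _ hm, smul_eq_mul, mul_one,
      Measure.real, hset, ENNReal.toReal_ofReal hp]
  have hind : ProbabilityTheory.iIndepFun X (coinMeasure n) := by
    have h1 := ProbabilityTheory.iIndepFun_infinitePi (P := fun _ : Fin n × ℕ => (volume : Measure I))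
      (X := fun _ u => u) fun _ => measurable_id
    have h2 := h1.precomp (g := fun i : Fin n => (i, 0)) fun i j h => (Prod.mk.inj h).1
    exact h2.comp (fun _ => F.indicator fun _ => (1 : ℝ)) fun _ => measurable_const.indicator hF
  -- The variance of an indicator is at most its mean, and variances of independent variables add
  -- up.
  have hvar : ProbabilityTheory.variance (∑ i, X i) (coinMeasure n) ≤ n * p := by
    rw [ProbabilityTheory.IndepFun.variance_sum (fun i _ => hXL i)
      fun i _ j _ hij => hind.indepFun hij]
    calc _ ≤ ∑ i : Fin n, p := by
          refine Finset.sum_le_sum fun i _ => ?_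
          refine (ProbabilityTheory.variance_le_expectation_sq (hXm i).aestronglyMeasurable).trans ?_
          rw [← hE i]
          refine integral_mono (hXL i).integrable_sq ((hXL i).integrable (by norm_num)) fun ω => ?_
          have := hX01 i ω
          simp only [Pi.pow_apply]
          nlinarith
      _ = n * p := by simp
  have hmean : ∫ ω, (∑ i, X i) ω ∂(coinMeasure n) = n * p := by
    simp only [Finset.sum_apply]
    rw [integral_finsetSum _ fun i _ => (hXL i).integrable (by norm_num)]
    simp [hE]
  have h := ProbabilityTheory.meas_ge_le_variance_div_sq (μ := coinMeasure n) (X := ∑ i, X i)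
    (memLp_finsetSum' _ fun i _ => hXL i) hb
  rw [hmean] at h
  simp only [Finset.sum_apply] at h
  exact h.trans (ENNReal.ofReal_le_ofReal (by gcongr))

theorem card_labelled (d₁ k : ℕ) (ω : Coins n) : ((labelled d₁ ω k).card : ℝ) =
    ∑ i, ({u | labelOf d₁ u = some k} : Set I).indicator (fun _ => (1 : ℝ)) (ω (i, 0)) := by
  rw [labelled, Finset.card_filter]
  push_cast
  refine Finset.sum_congr rfl fun i _ => ?_
  simp [Set.indicator_apply]

end Count

end RadioNetwork
end

noncomputable section
open scoped unitInterval

namespace RadioNetwork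

/-! ### The elections among the devices with a given label -/

section

variable {n : ℕ} {cd : CDModel}

theorem map_subCoins (A : Finset (Fin n)) (t : ℕ) :
    (coinMeasure n).map (fun ω => subCoins ω A t) = coinMeasure A.card := by
  have h := Measure.map_infinitePi_infinitePi_of_inj
    (P := fun _ : Fin n × ℕ => (volume : Measure I))
    (f := fun y : Fin A.card × ℕ => (A.orderEmbOfFin rfl y.1, t + y.2)) fun y z h => by
      simp only [Prod.mk.injEq, add_right_inj] at h
      exact Prod.ext ((A.orderEmbOfFin rfl).injective h.1) h.2
  exact h

theorem measurableSet_labelOf_iff {d₁ k : ℕ} (hk : d₁ ≤ k) (p : Prop) :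
    MeasurableSet {u | labelOf d₁ u = some k ↔ p} := by
  by_cases hp : p
  · simp only [hp, iff_true]
    exact measurableSet_labelOf hk
  · simp only [hp, iff_false]
    exact (measurableSet_labelOf hk).compl

/-- The labels are independent of the random numbers used in the time slots. -/
theorem coinMeasure_labelled_inter_le {d₁ k t : ℕ} (hk : d₁ ≤ k) (ht : 1 ≤ t) (A : Finset (Fin n))
    (B : Set (Coins A.card)) :
    coinMeasure n ({ω | labelled d₁ ω k = A} ∩ (fun ω => subCoins ω A t) ⁻¹' B) ≤
      coinMeasure n {ω | labelled d₁ ω k = A} * coinMeasure A.card B := by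
  classical
  set m : Fin n × ℕ → MeasurableSpace (Coins n) :=
    fun y => MeasurableSpace.comap (fun ω => ω y) inferInstance with hm
  have hle : ∀ y, m y ≤ (inferInstance : MeasurableSpace (Coins n)) := fun y =>
    (measurable_pi_apply y).comap_le
  have hind := ProbabilityTheory.iIndepFun_infinitePi
    (P := fun _ : Fin n × ℕ => (volume : Measure I)) (X := fun _ u => u) fun _ => measurable_id
  have hInd := ProbabilityTheory.indep_iSup_of_disjoint (m := m) hle hind
    (S := {y | y.2 = 0}) (T := {y | y.2 ≠ 0}) (Set.disjoint_left.mpr fun y h h' => h' h)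
  rw [ProbabilityTheory.Indep_iff] at hInd
  have hcoord : ∀ (S : Set (Fin n × ℕ)) (y : Fin n × ℕ), y ∈ S →
      Measurable[⨆ z ∈ S, m z] fun ω : Coins n => ω y := fun S y hy =>
    (comap_measurable (fun ω : Coins n => ω y)).mono (le_iSup₂_of_le (f := fun z _ => m z) y hy le_rfl)
      le_rfl
  have h1 : MeasurableSet[⨆ z ∈ {y : Fin n × ℕ | y.2 = 0}, m z] {ω | labelled d₁ ω k = A} := by
    have : {ω : Coins n | labelled d₁ ω k = A} =
        ⋂ i, (fun ω => ω (i, 0)) ⁻¹' {u | labelOf d₁ u = some k ↔ i ∈ A} := by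
      ext ω
      simp [labelled, Finset.ext_iff]
    rw [this]
    exact MeasurableSet.iInter fun i => hcoord {y | y.2 = 0} (i, 0) rfl
      (measurableSet_labelOf_iff hk _)
  have h2 : MeasurableSet[⨆ z ∈ {y : Fin n × ℕ | y.2 ≠ 0}, m z]
      ((fun ω => subCoins ω A t) ⁻¹' toMeasurable (coinMeasure A.card) B) := by
    have : Measurable[⨆ z ∈ {y : Fin n × ℕ | y.2 ≠ 0}, m z] fun ω => subCoins ω A t :=
      @measurable_pi_lambda _ _ _ (_) _ _ fun y =>
        hcoord _ (A.orderEmbOfFin rfl y.1, t + y.2) (by simp; omega)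
    exact this (measurableSet_toMeasurable _ _)
  -- Subroutines are arbitrary functions, so `B` need not be measurable; independence is applied to
  -- its measurable hull, which has the same measure.
  calc _ ≤ coinMeasure n ({ω | labelled d₁ ω k = A} ∩
        (fun ω => subCoins ω A t) ⁻¹' toMeasurable (coinMeasure A.card) B) := by
        gcongr
        exact subset_toMeasurable _ _
    _ = coinMeasure n {ω | labelled d₁ ω k = A} *
        coinMeasure n ((fun ω => subCoins ω A t) ⁻¹' toMeasurable (coinMeasure A.card) B) :=
      hInd _ _ h1 h2
    _ = _ := by
      congr 1
      have hmeas : Measurable fun ω : Coins n => subCoins ω A t := by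
        unfold subCoins
        fun_prop
      rw [← Measure.map_apply hmeas (measurableSet_toMeasurable _ _), map_subCoins,
        measure_toMeasurable]

theorem measurableSet_labelled_eq {d₁ k : ℕ} (hk : d₁ ≤ k) (A : Finset (Fin n)) :
    MeasurableSet {ω : Coins n | labelled d₁ ω k = A} := by
  have : {ω : Coins n | labelled d₁ ω k = A} =
      ⋂ i, (fun ω => ω (i, 0)) ⁻¹' {u | labelOf d₁ u = some k ↔ i ∈ A} := by
    ext ω
    simp [labelled, Finset.ext_iff]
  rw [this]
  exact MeasurableSet.iInter fun i => (measurableSet_labelOf_iff hk _).preimage (by fun_prop)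

/-- Given the set of devices with label `k`, their later coins are those of a fresh network of that
size, so a bound that is uniform over the sizes admitted by `P` survives averaging over the set. -/
theorem coinMeasure_labelled_le {d₁ k t : ℕ} (hk : d₁ ≤ k) (ht : 1 ≤ t) {P : ℕ → Prop}
    {B : ∀ m, Set (Coins m)} {β : ENNReal} (h : ∀ m, P m → coinMeasure m (B m) ≤ β) :
    coinMeasure n {ω | P (labelled d₁ ω k).card ∧
      subCoins ω (labelled d₁ ω k) t ∈ B (labelled d₁ ω k).card} ≤ β := by
  classical
  have hsub : {ω : Coins n | P (labelled d₁ ω k).card ∧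
      subCoins ω (labelled d₁ ω k) t ∈ B (labelled d₁ ω k).card} ⊆
      ⋃ A ∈ (Finset.univ : Finset (Finset (Fin n))).filter fun A => P A.card,
        ({ω | labelled d₁ ω k = A} ∩ (fun ω => subCoins ω A t) ⁻¹' B A.card) := by
    rintro ω ⟨h1, h2⟩
    refine Set.mem_biUnion (x := labelled d₁ ω k) ?_ ⟨rfl, h2⟩
    simpa using h1
  refine (measure_mono hsub).trans ((measure_biUnion_finset_le _ _).trans ?_)
  calc _ ≤ ∑ A ∈ (Finset.univ : Finset (Finset (Fin n))).filter fun A => P A.card,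
        coinMeasure n {ω | labelled d₁ ω k = A} * β := by
        refine Finset.sum_le_sum fun A hA => ?_
        refine (coinMeasure_labelled_inter_le hk ht A _).trans ?_
        gcongr
        exact h _ (Finset.mem_filter.mp hA).2
    _ ≤ ∑ A : Finset (Fin n), coinMeasure n {ω | labelled d₁ ω k = A} * β :=
        Finset.sum_le_sum_of_subset (Finset.filter_subset _ _)
    _ = coinMeasure n ((fun ω => labelled d₁ ω k) ⁻¹' (Finset.univ : Finset (Finset (Fin n)))) * β := by
        rw [← Finset.sum_mul,
          ← sum_measure_preimage_singleton _ fun A _ => measurableSet_labelled_eq hk A]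
        rfl
    _ ≤ 1 * β := by
        gcongr
        exact prob_le_one
    _ = β := one_mul β

/-- The number `a` of devices with label `k` is typical for a network of size `n`. -/
def TypicalCount (n k a : ℕ) : Prop :=
  |(a : ℝ) - n * (1 / √(2 ^ k))| < max √(2 ^ k) (n * (1 / √(2 ^ k))) / 40

theorem one_le_sqrt_two_pow (k : ℕ) : 1 ≤ √(2 ^ k : ℝ) := by
  rw [Real.one_le_sqrt]
  exact one_le_pow₀ (by norm_num)

/-- One half of the exponent is spent on `M ≥ √(n / 2)`, which gives a power of `n`, the other half
on `M ≥ x`, which makes the errors summable over the labels. -/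
theorem rpow_neg_le {M x c : ℝ} (hx : 1 ≤ x) (hn : 1 ≤ n) (hM : x ≤ M) (hMn : (n : ℝ) / 2 ≤ M ^ 2)
    (hc : 0 < c) (hc1 : c ≤ 1) : M ^ (-c) ≤ 2 * ((n : ℝ) ^ (-(c / 4)) * x ^ (-(c / 2))) := by
  have hM0 : 0 < M := by linarith
  have hn0 : (0 : ℝ) < n := by exact_mod_cast hn
  have h1 : M ^ (-c) = (M ^ 2) ^ (-(c / 4)) * M ^ (-(c / 2)) := by
    rw [← Real.rpow_natCast, ← Real.rpow_mul hM0.le, ← Real.rpow_add hM0]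
    congr 1
    push_cast
    ring
  have h2 : (M ^ 2) ^ (-(c / 4)) ≤ ((n : ℝ) / 2) ^ (-(c / 4)) :=
    Real.rpow_le_rpow_of_nonpos (by positivity) hMn (by linarith)
  have h3 : M ^ (-(c / 2)) ≤ x ^ (-(c / 2)) :=
    Real.rpow_le_rpow_of_nonpos (by linarith) hM (by linarith)
  have h4 : ((n : ℝ) / 2) ^ (-(c / 4)) ≤ 2 * (n : ℝ) ^ (-(c / 4)) := by
    rw [Real.div_rpow hn0.le (by norm_num), Real.rpow_neg (by norm_num : (0 : ℝ) ≤ 2), div_inv_eq_mul,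
      mul_comm]
    gcongr
    calc (2 : ℝ) ^ (c / 4) ≤ 2 ^ (1 : ℝ) :=
          Real.rpow_le_rpow_of_exponent_le (by norm_num) (by linarith)
      _ = 2 := by norm_num
  have h5 : 0 ≤ M ^ (-(c / 2)) := Real.rpow_nonneg hM0.le _
  have h6 : 0 ≤ (n : ℝ) ^ (-(c / 4)) := Real.rpow_nonneg hn0.le _
  calc M ^ (-c) ≤ 2 * (n : ℝ) ^ (-(c / 4)) * x ^ (-(c / 2)) := by
        rw [h1]
        exact mul_le_mul (h2.trans h4) h3 h5 (by positivity)
    _ = _ := by ring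

/-- With `M` the larger of guess and expected number, the variance is at most `M` and the permitted
deviation is `M / 40`, so Chebyshev's inequality gives `1600 / M`. -/
theorem coinMeasure_not_typicalCount_le {d₁ k : ℕ} (h : ∑' j : ℕ, 1 / √(2 ^ (d₁ + j)) ≤ 1)
    (hk : d₁ ≤ k) (hn : 1 ≤ n) {c : ℝ} (hc : 0 < c) (hc1 : c ≤ 1) :
    coinMeasure n {ω | ¬ TypicalCount n k (labelled d₁ ω k).card} ≤
      ENNReal.ofReal (3200 * ((n : ℝ) ^ (-(c / 4)) * √(2 ^ k) ^ (-(c / 2)))) := by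
  have hx := one_le_sqrt_two_pow k
  set x : ℝ := √(2 ^ k) with hxd
  have hx0 : 0 < x := by linarith
  set M : ℝ := max x (n * (1 / x)) with hM
  have hxM : x ≤ M := le_max_left _ _
  have hyM : n * (1 / x) ≤ M := le_max_right _ _
  have hM0 : 0 < M := by linarith
  have hM1 : 1 ≤ M := hx.trans hxM
  have h1 := coinMeasure_card_le (n := n) (measurableSet_labelOf hk) (p := 1 / x) (b := M / 40)
    (by positivity) (volume_labelOf h hk) (by positivity) (fun ω => ((labelled d₁ ω k).card : ℝ))
    (card_labelled d₁ k)
  refine (measure_mono fun ω hω => ?_).trans (h1.trans (ENNReal.ofReal_le_ofReal ?_))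
  · have hω : ¬ TypicalCount n k (labelled d₁ ω k).card := hω
    rw [TypicalCount, not_lt, ← hxd] at hω
    exact hω
  -- The guess times the expected number of devices is exactly `n`, so the larger of the two is at
  -- least `√n`.
  · have hMn : (n : ℝ) ≤ M ^ 2 := by
      calc (n : ℝ) = x * (n * (1 / x)) := by field_simp
        _ ≤ M * M := by gcongr
        _ = M ^ 2 := by ring
    calc n * (1 / x) / (M / 40) ^ 2 ≤ M / (M / 40) ^ 2 := by gcongr
      _ = 1600 * M ^ (-1 : ℝ) := by
        rw [Real.rpow_neg_one]
        field_simp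
        norm_num
      _ ≤ 1600 * M ^ (-c) := by
        gcongr
      _ ≤ 1600 * (2 * ((n : ℝ) ^ (-(c / 4)) * x ^ (-(c / 2)))) := by
        gcongr
        exact rpow_neg_le hx hn hxM (by linarith) hc hc1
      _ = _ := by ring

/-- With `x` the guess and `y` the expected number, `x * y = n`. If `y ≤ x`, then already `x ^ 2 ≥
n`; otherwise a typical number is at least `y / 2`, so the maximum squared is at least `x * (y /
2)`. -/
theorem TypicalCount.sq_le {k a : ℕ} (h : TypicalCount n k a) :
    (n : ℝ) / 2 ≤ max (a : ℝ) √(2 ^ k) ^ 2 := by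
  have hx := one_le_sqrt_two_pow k
  rw [TypicalCount] at h
  set x : ℝ := √(2 ^ k) with hxd
  have hx0 : 0 < x := by linarith
  obtain ⟨y, hy⟩ : ∃ y, y = (n : ℝ) * (1 / x) := ⟨_, rfl⟩
  have hn : (n : ℝ) = x * y := by
    rw [hy]
    field_simp
  rw [← hy] at h
  have hxM : x ≤ max (a : ℝ) x := le_max_right _ _
  have haM : (a : ℝ) ≤ max (a : ℝ) x := le_max_left _ _
  have h1 := abs_lt.mp h
  rcases le_total y x with hyx | hyx
  · rw [hn]
    nlinarith
  · rw [max_eq_right hyx] at h1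
    rw [hn]
    have h2 : y / 2 ≤ max (a : ℝ) x := by linarith
    nlinarith

/-- If the number of devices with label `k` is typical and the election among them has the outcome
required of Test-Network-Size, then the outcome is as it should be. -/
theorem TypicalCount.electionOK {S : Subroutine Bool} {ω : Coins n} {A : Finset (Fin n)} {t k : ℕ}
    (h : TypicalCount n k A.card)
    (hS : (leaders cd S (subCoins ω A t)).ncard ≤ 1 ∧
      ((A.card : ℝ) / 1.5 ≤ √(2 ^ k) ∧ √(2 ^ k) ≤ 1.5 * A.card →
        (leaders cd S (subCoins ω A t)).ncard = 1) ∧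
      (1.9 * A.card ≤ √(2 ^ k) ∨ √(2 ^ k) ≤ A.card / 1.9 →
        (leaders cd S (subCoins ω A t)).ncard = 0)) : ElectionOK cd S ω A t k := by
  have hx := one_le_sqrt_two_pow k
  have hx2 : √(2 ^ k : ℝ) ^ 2 = 2 ^ k := Real.sq_sqrt (by positivity)
  rw [TypicalCount] at h
  set x : ℝ := √(2 ^ k) with hxd
  have hx0 : 0 < x := by linarith
  obtain ⟨y, hy⟩ : ∃ y, y = (n : ℝ) * (1 / x) := ⟨_, rfl⟩
  have hy0 : 0 ≤ y := by
    rw [hy]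
    positivity
  have hn : (n : ℝ) = x * y := by
    rw [hy]
    field_simp
  rw [← hy] at h
  have h1 := abs_lt.mp h
  refine ⟨hS.1, fun hc1 hc2 => hS.2.1 ?_, fun hfar => hS.2.2 ?_⟩
  · have e1 : (n : ℝ) ^ 2 ≤ 2 * 4 ^ k := by exact_mod_cast hc1
    have e2 : (4 : ℝ) ^ k ≤ 2 * n ^ 2 := by exact_mod_cast hc2
    have e3 : (4 : ℝ) ^ k = x ^ 2 * x ^ 2 := by
      rw [hx2, ← mul_pow]
      norm_num
    have hx20 : 0 < x ^ 2 := by positivity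
    have f1 : y ^ 2 ≤ 2 * x ^ 2 := by
      rw [hn, e3] at e1
      have : x ^ 2 * y ^ 2 ≤ x ^ 2 * (2 * x ^ 2) := by nlinarith
      exact le_of_mul_le_mul_left this hx20
    have f2 : x ^ 2 ≤ 2 * y ^ 2 := by
      rw [hn, e3] at e2
      have : x ^ 2 * x ^ 2 ≤ x ^ 2 * (2 * y ^ 2) := by nlinarith
      exact le_of_mul_le_mul_left this hx20
    -- The tolerance `1 / 40` fits between the thresholds: `√2 * (1 + 1/40) < 1.5` and `1.5 * (1/√2
    -- - 1/40) > 1` here, `2 * (1 - 1/40) > 1.9` and `1.9 * (1/2 + 1/40) < 1` in the other case.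
    have g1 : y ≤ 1.4143 * x := le_of_sq_le_sq (by nlinarith) (by positivity)
    have g2 : x ≤ 1.4143 * y := le_of_sq_le_sq (by nlinarith) (by positivity)
    rw [div_le_iff₀ (by norm_num)]
    rcases le_total y x with hyx | hyx
    · rw [max_eq_left hyx] at h1
      constructor <;> linarith
    · rw [max_eq_right hyx] at h1
      constructor <;> linarith
  · rw [le_div_iff₀ (by norm_num)]
    rcases hfar with hfar | hfar
    · right
      have e1 : 2 * (2 : ℝ) ^ k ≤ n := by exact_mod_cast hfar
      rw [hn, ← hx2] at e1
      have f1 : 2 * x ≤ y := le_of_mul_le_mul_left (by linarith [sq x]) hx0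
      rw [max_eq_right (by linarith)] at h1
      linarith
    · left
      have e1 : 2 * (n : ℝ) ≤ (2 : ℝ) ^ k := by exact_mod_cast hfar
      rw [hn, ← hx2] at e1
      have f1 : 2 * y ≤ x := le_of_mul_le_mul_left (by linarith [sq x]) hx0
      rw [max_eq_left (by linarith)] at h1
      linarith

/-- Two sources of error: an atypical number of devices with label `k`, or a failure of
Test-Network-Size on a typical number of them. -/
theorem coinMeasure_not_electionOK_le {d₁ k t : ℕ} {test : ℝ → Subroutine Bool} {C c : ℝ}
    (htest : TestSpec cd test C c) (hC : 0 ≤ C) (hc : 0 < c) (hc1 : c ≤ 1)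
    (h : ∑' j : ℕ, 1 / √(2 ^ (d₁ + j)) ≤ 1) (h100 : 100 ≤ √(2 ^ d₁))
    (hk : d₁ ≤ k) (hn : 1 ≤ n) (ht : 1 ≤ t) :
    coinMeasure n {ω | ¬ ElectionOK cd (test √(2 ^ k)) ω (labelled d₁ ω k) t k} ≤
      ENNReal.ofReal ((3200 + 2 * C) * ((n : ℝ) ^ (-(c / 4)) * √(2 ^ k) ^ (-(c / 2)))) := by
  have hx := one_le_sqrt_two_pow k
  have hx100 : 100 ≤ √(2 ^ k : ℝ) :=
    h100.trans (Real.sqrt_le_sqrt (pow_le_pow_right₀ (by norm_num) hk))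
  have hpos : 0 ≤ (n : ℝ) ^ (-(c / 4)) * √(2 ^ k) ^ (-(c / 2)) :=
    mul_nonneg (Real.rpow_nonneg (by positivity) _) (Real.rpow_nonneg (by positivity) _)
  have hspec := (htest _ hx100).2
  set S := test √(2 ^ k) with hS
  set B : ∀ m, Set (Coins m) := fun m => {ω | ¬ ((leaders cd S ω).ncard ≤ 1 ∧
      ((m : ℝ) / 1.5 ≤ √(2 ^ k) ∧ √(2 ^ k) ≤ 1.5 * m → (leaders cd S ω).ncard = 1) ∧
      (1.9 * m ≤ √(2 ^ k) ∨ √(2 ^ k) ≤ m / 1.9 → (leaders cd S ω).ncard = 0))} with hB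
  have hBm : ∀ m, TypicalCount n k m → coinMeasure m (B m) ≤
      ENNReal.ofReal (2 * C * ((n : ℝ) ^ (-(c / 4)) * √(2 ^ k) ^ (-(c / 2)))) := by
    intro m hm
    refine (measure_mono fun ω hω => ?_).trans ((hspec m).trans (ENNReal.ofReal_le_ofReal ?_))
    · exact fun h => absurd h.2 hω
    · calc C * max (m : ℝ) √(2 ^ k) ^ (-c) ≤
          C * (2 * ((n : ℝ) ^ (-(c / 4)) * √(2 ^ k) ^ (-(c / 2)))) := by
            gcongr
            exact rpow_neg_le hx hn (le_max_right _ _) hm.sq_le hc hc1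
        _ = _ := by ring
  have hsub : {ω : Coins n | ¬ ElectionOK cd S ω (labelled d₁ ω k) t k} ⊆
      {ω | ¬ TypicalCount n k (labelled d₁ ω k).card} ∪
        {ω | TypicalCount n k (labelled d₁ ω k).card ∧
          subCoins ω (labelled d₁ ω k) t ∈ B (labelled d₁ ω k).card} := by
    intro ω hω
    by_cases htyp : TypicalCount n k (labelled d₁ ω k).card
    · refine .inr ⟨htyp, fun hgood => absurd (htyp.electionOK hgood) hω⟩
    · exact .inl htyp
  refine (measure_mono hsub).trans ((measure_union_le _ _).trans
    ((add_le_add (coinMeasure_not_typicalCount_le h hk hn hc hc1)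
      (coinMeasure_labelled_le hk ht hBm)).trans (le_of_eq ?_)))
  rw [← ENNReal.ofReal_add (by positivity) (by positivity)]
  congr 1
  ring

end

end RadioNetwork
end

/-! ### The failure probability of the whole algorithm -/

noncomputable section
open scoped unitInterval

namespace RadioNetwork

section

variable {n : ℕ} {cd : CDModel} {d : ℕ → ℕ}

theorem volume_lt_half_pow (a : ℕ) :
    volume {u : I | (u : ℝ) < (1 / 2) ^ a} = ENNReal.ofReal ((1 / 2) ^ a) := by
  have := volume_Ico (a := 0) (b := (1 / 2) ^ a) le_rfl (pow_le_one₀ (by norm_num) (by norm_num))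
  rw [sub_zero] at this
  rw [← this]
  congr 1
  ext u
  simp [u.2.1]

theorem measurableSet_lt_half_pow (a : ℕ) : MeasurableSet {u : I | (u : ℝ) < (1 / 2) ^ a} :=
  measurableSet_lt measurable_subtype_coe measurable_const

theorem coinMeasure_quiet_le (t j : ℕ) :
    coinMeasure n {ω | Quiet d ω t j} ≤ ENNReal.ofReal (Real.exp (-((1 / 2) ^ d j * n))) := by
  have h1 : ((1 : ℝ) / 2) ^ d j ≤ 1 := pow_le_one₀ (by norm_num) (by norm_num)
  have h := coinMeasure_slot (n := n) (t + 1) Finset.univ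
    (A := fun _ => {u : I | (u : ℝ) < (1 / 2) ^ d j}ᶜ) fun _ _ => (measurableSet_lt_half_pow _).compl
  rw [Finset.prod_const, Finset.card_univ, Fintype.card_fin,
    prob_compl_eq_one_sub (measurableSet_lt_half_pow _), volume_lt_half_pow, ← ENNReal.ofReal_one,
    ← ENNReal.ofReal_sub _ (by positivity), ← ENNReal.ofReal_pow (by linarith)] at h
  refine (measure_mono fun ω hω i _ => ?_).trans
    (h.le.trans (ENNReal.ofReal_le_ofReal (one_sub_pow_le_exp h1 n)))
  have hω : Quiet d ω t j := hω
  exact hω i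

theorem coinMeasure_not_quiet_le (t j : ℕ) :
    coinMeasure n {ω | ¬ Quiet d ω t j} ≤ ENNReal.ofReal (n * (1 / 2) ^ d j) := by
  have hsub : {ω : Coins n | ¬ Quiet d ω t j} ⊆ ⋃ i ∈ (Finset.univ : Finset (Fin n)),
      {ω | ∀ i' ∈ ({i} : Finset (Fin n)), ω (i', t + 1) ∈ {u : I | (u : ℝ) < (1 / 2) ^ d j}} := by
    intro ω hω
    have hω : ¬ Quiet d ω t j := hω
    rw [Quiet] at hω
    push Not at hω
    obtain ⟨i, hi⟩ := hω
    refine Set.mem_biUnion (x := i) (by simp) fun i' hi' => ?_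
    rw [Finset.mem_singleton.mp hi']
    exact hi
  refine (measure_mono hsub).trans ((measure_biUnion_finset_le _ _).trans ?_)
  rw [Finset.sum_congr rfl fun i _ => coinMeasure_slot (n := n) (t + 1) {i}
    (A := fun _ => {u : I | (u : ℝ) < (1 / 2) ^ d j}) fun _ _ => measurableSet_lt_half_pow _]
  simp only [Finset.prod_singleton, volume_lt_half_pow, Finset.sum_const, Finset.card_univ,
    Fintype.card_fin, nsmul_eq_mul]
  rw [ENNReal.ofReal_mul (by positivity), ENNReal.ofReal_natCast]

theorem searchTime_le {m : ℕ} (hm : 1 ≤ m) : searchTime m ≤ 5 * m := by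
  have : Nat.log 2 m < m := Nat.log_lt_self 2 (by omega)
  rw [searchTime]
  omega

/-- Exponential-Search is right apart from an event of small probability. -/
theorem coinMeasure_not_searchOK_le (hd : Admissible 4 d) {m : ℕ} (hm : 2 ≤ m) (hn : 1 ≤ n)
    (hi : IsIndex d n m) (t₀ : ℕ) :
    coinMeasure n {ω | ¬ SearchOK d ω t₀ m} ≤ ENNReal.ofReal (130 / n) := by
  have hn0 : (0 : ℝ) < n := by exact_mod_cast hn
  have hlow := hi.pow_lt hm hn
  have hhigh := hi.le_pow hn
  have hmn : m ≤ n := by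
    have h1 := hd.add_lt (i := m - 1) (by omega)
    have h2 : d (m - 1) < 2 ^ d (m - 1) := Nat.lt_two_pow_self
    omega
  set S := searchTime m with hS
  have hsub : {ω : Coins n | ¬ SearchOK d ω t₀ m} ⊆
      ⋃ s ∈ Finset.range S, ((⋃ j ∈ Finset.Icc 1 (m - 2), {ω | Quiet d ω (t₀ + s) j}) ∪
        ⋃ j ∈ Finset.Icc (m + 1) (2 * m), {ω | ¬ Quiet d ω (t₀ + s) j}) := by
    intro ω hω
    by_contra hno
    refine absurd (⟨fun s hs j hj hjm hq => hno ?_, fun s hs j hj hjm => ?_⟩ :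
      SearchOK d ω t₀ m) hω
    · exact Set.mem_biUnion (x := s) (by simpa using hs) (.inl (Set.mem_biUnion (x := j)
        (by simp; omega) hq))
    · by_contra hq
      exact hno (Set.mem_biUnion (x := s) (by simpa using hs) (.inr (Set.mem_biUnion (x := j)
        (by simp; omega) hq)))
  have hq1 : ∀ s, ∀ j ∈ Finset.Icc 1 (m - 2), coinMeasure n {ω | Quiet d ω (t₀ + s) j} ≤
      ENNReal.ofReal (24 / n ^ 3) := by
    intro s j hj
    rw [Finset.mem_Icc] at hj
    refine (coinMeasure_quiet_le _ _).trans (ENNReal.ofReal_le_ofReal ?_)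
    -- Growth by the factor 4 and `j + 1 ≤ m - 1` give `4 * d j ≤ d (m - 1) < log n`. At least `n ^
    -- (3 / 4)` transmitters are expected, and silence is very unlikely.
    have h1 : (2 ^ d j) ^ 4 ≤ n := by
      rw [← pow_mul]
      refine le_trans (Nat.pow_le_pow_right (by norm_num) ?_) hlow.le
      have h1 := hd.four_mul_le hj.1
      have h2 := hd.monotone (i := j + 1) (j := m - 1) (by omega) (by omega)
      omega
    have h2 : ((2 : ℝ) ^ d j) ^ 4 ≤ n := by exact_mod_cast h1
    refine (exp_neg_le_div_pow_four (by positivity)).trans ?_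
    gcongr
    rw [mul_pow, one_div_pow, one_div_pow, one_div_mul_eq_div, le_div_iff₀ (by positivity)]
    calc (n : ℝ) ^ 3 * (2 ^ d j) ^ 4 ≤ (n : ℝ) ^ 3 * (n : ℝ) := by gcongr
      _ = (n : ℝ) ^ 4 := by ring
  have hq2 : ∀ s, ∀ j ∈ Finset.Icc (m + 1) (2 * m), coinMeasure n {ω | ¬ Quiet d ω (t₀ + s) j} ≤
      ENNReal.ofReal (1 / n ^ 3) := by
    intro s j hj
    rw [Finset.mem_Icc] at hj
    refine (coinMeasure_not_quiet_le _ _).trans (ENNReal.ofReal_le_ofReal ?_)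
    -- Growth once more: above index `m` the transmission probability is at most `n ^ (-4)`.
    have h1 : n ^ 4 ≤ 2 ^ d j := by
      refine (Nat.pow_le_pow_left hhigh 4).trans ?_
      rw [← pow_mul]
      refine Nat.pow_le_pow_right (by norm_num) ?_
      have h1 := hd.four_mul_le hi.1
      have h2 := hd.monotone (i := m + 1) (j := j) (by omega) hj.1
      omega
    have h2 : (n : ℝ) ^ 4 ≤ 2 ^ d j := by exact_mod_cast h1
    rw [one_div_pow, mul_one_div, div_le_div_iff₀ (by positivity) (by positivity), one_mul]
    calc (n : ℝ) * n ^ 3 = n ^ 4 := by ring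
      _ ≤ _ := h2
  refine (measure_mono hsub).trans ((measure_biUnion_finset_le _ _).trans ?_)
  calc _ ≤ ∑ s ∈ Finset.range S, (∑ j ∈ Finset.Icc 1 (m - 2), ENNReal.ofReal (24 / n ^ 3) +
        ∑ j ∈ Finset.Icc (m + 1) (2 * m), ENNReal.ofReal (1 / n ^ 3)) := by
        refine Finset.sum_le_sum fun s _ => (measure_union_le _ _).trans (add_le_add ?_ ?_)
        · exact (measure_biUnion_finset_le _ _).trans (Finset.sum_le_sum (hq1 s))
        · exact (measure_biUnion_finset_le _ _).trans (Finset.sum_le_sum (hq2 s))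
    _ = ENNReal.ofReal (S * ((m - 2 : ℕ) * (24 / n ^ 3) + m * (1 / n ^ 3))) := by
        simp only [Finset.sum_const, Nat.card_Icc, Finset.card_range, nsmul_eq_mul]
        rw [show m - 2 + 1 - 1 = m - 2 by omega, show 2 * m + 1 - (m + 1) = m by omega,
          ← ENNReal.ofReal_natCast, ← ENNReal.ofReal_natCast, ← ENNReal.ofReal_natCast,
          ← ENNReal.ofReal_mul (by positivity), ← ENNReal.ofReal_mul (by positivity),
          ← ENNReal.ofReal_add (by positivity) (by positivity), ← ENNReal.ofReal_mul (by positivity)]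
    _ ≤ _ := by
        refine ENNReal.ofReal_le_ofReal ?_
        have h1 : (S : ℝ) ≤ 5 * n := by
          have := searchTime_le hi.1
          exact_mod_cast (this.trans (by omega) : S ≤ 5 * n)
        have h2 : ((m - 2 : ℕ) : ℝ) ≤ n := by exact_mod_cast (by omega : m - 2 ≤ n)
        have h3 : (m : ℝ) ≤ n := by exact_mod_cast hmn
        calc (S : ℝ) * ((m - 2 : ℕ) * (24 / n ^ 3) + m * (1 / n ^ 3)) ≤
            5 * (n : ℝ) * (n * (24 / n ^ 3) + n * (1 / n ^ 3)) := by gcongr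
          _ = 125 / (n : ℝ) := by
            field_simp
            norm_num
          _ ≤ _ := by
            gcongr
            norm_num

theorem sqrt_two_pow_rpow (k : ℕ) (c : ℝ) :
    √(2 ^ k) ^ (-(c / 2)) = ((2 : ℝ) ^ (-(c / 4))) ^ k := by
  rw [Real.sqrt_eq_rpow, ← Real.rpow_natCast, ← Real.rpow_mul (by norm_num),
    ← Real.rpow_mul (by norm_num), ← Real.rpow_natCast, ← Real.rpow_mul (by norm_num)]
  congr 1
  ring

/-- Everything goes well apart from an event of small probability. -/
theorem coinMeasure_not_goodRun_le {triv : ℕ → Subroutine (Option ℕ)}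
    {test : ℝ → Subroutine Bool} {C c : ℝ} (htest : TestSpec cd test C c) (hC : 0 ≤ C) (hc : 0 < c)
    (hc1 : c ≤ 1) (hd : Admissible 4 d) {m : ℕ} (hm : 2 ≤ m) (hn : 1 ≤ n) (hi : IsIndex d n m)
    (hlen : 0 < (triv (2 ^ d 1)).len) :
    coinMeasure n {ω | ¬ GoodRun cd d triv test ω m} ≤ ENNReal.ofReal
      ((130 + 6 * (3200 + 2 * C) * (24 / c) ^ 2 * (1 - 2 ^ (-(c / 4)))⁻¹) * (n : ℝ) ^ (-(c / 8))) := by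
  have hn0 : (0 : ℝ) < n := by exact_mod_cast hn
  have hn1 : (1 : ℝ) ≤ n := by exact_mod_cast hn
  set r : ℝ := 2 ^ (-(c / 4)) with hr
  have hr0 : 0 < r := Real.rpow_pos_of_pos (by norm_num) _
  have hr1 : r < 1 := Real.rpow_lt_one_of_one_lt_of_neg (by norm_num) (by linarith)
  set T₁ := (triv (2 ^ d 1)).len with hT₁
  set S := searchTime m with hS
  -- The starting time of an election depends on the outcome `(s, j)` of the search. Instead of
  -- conditioning on it, the election is required to succeed at the starting times of all possible
  -- outcomes.
  set τ : ℕ → ℕ → ℕ → ℕ := fun s j k => iterTime test d (d j) (T₁ + s) (k - d j) with hτ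
  have hτ1 : ∀ s j k, 1 ≤ τ s j k := fun s j k =>
    le_trans (show 1 ≤ T₁ + s by omega)
      (iterTime_mono (test := test) (d := d) (k₀ := d j) (t₀ := T₁ + s) (Nat.zero_le (k - d j)))
  have hsub : {ω : Coins n | ¬ GoodRun cd d triv test ω m} ⊆ {ω | ¬ SearchOK d ω T₁ m} ∪
      ⋃ s ∈ Finset.range (S + 1), ⋃ j ∈ Finset.range m, ⋃ k ∈ Finset.Icc (d 1) (d m),
        {ω | ¬ ElectionOK cd (test √(2 ^ k)) ω (labelled (d 1) ω k) (τ s j k) k} := by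
    intro ω hω
    by_contra hno
    simp only [Set.mem_union, not_or] at hno
    refine absurd (⟨fun _ => not_not.mp hno.1, fun s hs j hj hjm k hk hkm => ?_⟩ :
      GoodRun cd d triv test ω m) hω
    by_contra hbad
    refine hno.2 (Set.mem_biUnion (x := s) (by simp; omega) (Set.mem_biUnion (x := j) (by simpa)
      (Set.mem_biUnion (x := k) ?_ hbad)))
    have := hd.monotone le_rfl hj
    simp
    omega
  have hsum : ∀ s j, coinMeasure n (⋃ k ∈ Finset.Icc (d 1) (d m),
      {ω | ¬ ElectionOK cd (test √(2 ^ k)) ω (labelled (d 1) ω k) (τ s j k) k}) ≤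
      ENNReal.ofReal ((3200 + 2 * C) * ((n : ℝ) ^ (-(c / 4)) * (1 - r)⁻¹)) := by
    intro s j
    have hp : 0 ≤ (n : ℝ) ^ (-(c / 4)) := Real.rpow_nonneg hn0.le _
    refine (measure_biUnion_finset_le _ _).trans ?_
    calc _ ≤ ∑ k ∈ Finset.Icc (d 1) (d m),
          ENNReal.ofReal ((3200 + 2 * C) * ((n : ℝ) ^ (-(c / 4)) * r ^ k)) := by
          refine Finset.sum_le_sum fun k hk => ?_
          rw [← sqrt_two_pow_rpow]
          exact coinMeasure_not_electionOK_le htest hC hc hc1 hd.sum_le hd.large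
            (Finset.mem_Icc.mp hk).1 hn (hτ1 s j k)
      _ = ENNReal.ofReal (∑ k ∈ Finset.Icc (d 1) (d m),
          (3200 + 2 * C) * ((n : ℝ) ^ (-(c / 4)) * r ^ k)) := by
          rw [ENNReal.ofReal_sum_of_nonneg fun k _ => by positivity]
      _ ≤ _ := by
          refine ENNReal.ofReal_le_ofReal ?_
          rw [← Finset.mul_sum, ← Finset.mul_sum]
          gcongr
          rw [← tsum_geometric_of_lt_one hr0.le hr1]
          exact (summable_geometric_of_lt_one hr0.le hr1).sum_le_tsum _ fun k _ => by positivity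
  -- The index is below `log n`, hence below a small power of `n`. The factor of order `m ^ 2` from
  -- the union bound over `s` and `j` then costs only `n ^ (c / 8)` out of `n ^ (-(c / 4))`.
  have hmlog : (m : ℝ) ≤ 24 / c * (n : ℝ) ^ (c / 16) := by
    have h1 := hd.add_lt (i := m - 1) (by omega)
    have h2 : (m : ℝ) ≤ d (m - 1) := by exact_mod_cast (by omega : m ≤ d (m - 1))
    have h3 := hi.2.2 hm
    have h4 := logb_two_le hn1
    have h5 := Real.log_le_rpow_div hn0.le (ε := c / 16) (by positivity)
    have h6 : 0 ≤ (n : ℝ) ^ (c / 16) := Real.rpow_nonneg hn0.le _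
    have h7 : (n : ℝ) ^ (c / 16) / (c / 16) = 16 / c * (n : ℝ) ^ (c / 16) := by
      field_simp
    have h8 : 0 ≤ 1 / c * (n : ℝ) ^ (c / 16) := by positivity
    have h9 : 24 / c * (n : ℝ) ^ (c / 16) = 24 * (1 / c * (n : ℝ) ^ (c / 16)) := by ring
    have h10 : 16 / c * (n : ℝ) ^ (c / 16) = 16 * (1 / c * (n : ℝ) ^ (c / 16)) := by ring
    rw [h7, h10] at h5
    rw [h9]
    linarith
  refine (measure_mono hsub).trans ((measure_union_le _ _).trans ?_)
  set W : ℝ := (3200 + 2 * C) * ((n : ℝ) ^ (-(c / 4)) * (1 - r)⁻¹) with hW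
  have hr2 : 0 ≤ (1 - r)⁻¹ := inv_nonneg.mpr (by linarith)
  have hW0 : 0 ≤ W := by
    have : 0 ≤ (n : ℝ) ^ (-(c / 4)) := Real.rpow_nonneg hn0.le _
    positivity
  calc _ ≤ ENNReal.ofReal (130 / n) + ∑ s ∈ Finset.range (S + 1), ∑ j ∈ Finset.range m,
        ENNReal.ofReal W := by
        refine add_le_add (coinMeasure_not_searchOK_le hd hm hn hi _) ?_
        refine (measure_biUnion_finset_le _ _).trans (Finset.sum_le_sum fun s _ => ?_)
        exact (measure_biUnion_finset_le _ _).trans (Finset.sum_le_sum fun j _ => hsum s j)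
    _ = ENNReal.ofReal (130 / n + (S + 1 : ℕ) * (m * W)) := by
        simp only [Finset.sum_const, Finset.card_range, nsmul_eq_mul]
        rw [← ENNReal.ofReal_natCast, ← ENNReal.ofReal_natCast, ← ENNReal.ofReal_mul (by positivity),
          ← ENNReal.ofReal_mul (by positivity), ← ENNReal.ofReal_add (by positivity) (by positivity)]
    _ ≤ _ := by
        refine ENNReal.ofReal_le_ofReal ?_
        rw [add_mul]
        refine add_le_add ?_ ?_
        · rw [div_eq_mul_inv, ← Real.rpow_neg_one]
          gcongr
          linarith
        · have h1 : ((S + 1 : ℕ) : ℝ) ≤ 6 * m := by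
            have := searchTime_le hi.1
            exact_mod_cast (by omega : S + 1 ≤ 6 * m)
          have h2 : (n : ℝ) ^ (-(c / 8)) = (n : ℝ) ^ (c / 16) * (n : ℝ) ^ (c / 16) *
              (n : ℝ) ^ (-(c / 4)) := by
            rw [← Real.rpow_add hn0, ← Real.rpow_add hn0]
            congr 1
            ring
          have h0 : 0 < (n : ℝ) ^ (c / 16) := Real.rpow_pos_of_pos hn0 _
          calc ((S + 1 : ℕ) : ℝ) * (m * W) ≤ 6 * m * (m * W) := by gcongr
            _ ≤ 6 * (24 / c * (n : ℝ) ^ (c / 16)) * ((24 / c * (n : ℝ) ^ (c / 16)) * W) := by gcongr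
            _ = _ := by
              rw [h2, hW]
              ring

end

theorem TrivialSpec.mono {cd : CDModel} {triv : ℕ → Subroutine (Option ℕ)} {C C' c c' : ℝ}
    (h : TrivialSpec cd triv C c) (hC : 0 ≤ C) (hCC : C ≤ C') (hc : c' ≤ c) :
    TrivialSpec cd triv C' c' := fun N n hn => (h N n hn).trans (ENNReal.ofReal_le_ofReal (by
  have : (1 : ℝ) ≤ n := by exact_mod_cast hn.1
  have hC' : 0 ≤ C' := hC.trans hCC
  gcongr))

theorem TestSpec.mono {cd : CDModel} {test : ℝ → Subroutine Bool} {C C' c c' : ℝ}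
    (h : TestSpec cd test C c) (hC : 0 ≤ C) (hCC : C ≤ C') (hc : c' ≤ c) :
    TestSpec cd test C' c' := by
  intro x hx
  obtain ⟨h1, h2⟩ := h x hx
  have hlog := one_le_logb_two (x := x) (by linarith)
  refine ⟨h1.trans (by gcongr), fun n => (measure_mono fun ω hω hgood => ?_).trans
    ((h2 n).trans (ENNReal.ofReal_le_ofReal ?_))⟩
  · exact absurd ⟨fun i => (hgood.1 i).trans (by gcongr), hgood.2⟩ hω
  · have h3 : 1 ≤ max (n : ℝ) x := le_max_of_le_right (by linarith)
    have hC' : 0 ≤ C' := hC.trans hCC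
    gcongr

/-- The guarantee for arbitrary checkpoints, with an energy bound in which the inverse Ackermann
function is replaced by a constant. -/
theorem exists_failureProb_le (cd : CDModel) : ∃ C c : ℝ, 0 < C ∧ 0 < c ∧
    TrivialSpec cd trivialAlgorithm C c ∧ TestSpec cd testNetworkSize C c ∧
    ∀ d : ℕ → ℕ, Admissible 4 d → ∀ n i : ℕ, cd.Allows n → IsIndex d n i →
      failureProb (estimateNetworkSize cd d trivialAlgorithm testNetworkSize) cd n
          (30 * (d i : ℝ) ^ 2 + (trivialAlgorithm (2 ^ d 1)).len)
          (3020 * (cd.scale i + 1) + (trivialAlgorithm (2 ^ d 1)).len)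
        ≤ ENNReal.ofReal (C * (n : ℝ) ^ (-c)) := by
  have htriv := trivialSpec_trivialAlgorithm cd
  have htest := testSpec_testNetworkSize cd
  obtain ⟨c, hc⟩ : ∃ c : ℝ, c = 1 / 200000 := ⟨_, rfl⟩
  rw [← hc] at htest
  have hr1 : (2 : ℝ) ^ (-(c / 4)) < 1 :=
    Real.rpow_lt_one_of_one_lt_of_neg (by norm_num) (by rw [hc]; norm_num)
  obtain ⟨C₁, hC₁⟩ : ∃ C₁ : ℝ, C₁ = 130 + 6 * (3200 + 2 * 10 ^ 12) * (24 / c) ^ 2 *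
    (1 - 2 ^ (-(c / 4)))⁻¹ := ⟨_, rfl⟩
  have hC₁0 : 0 ≤ C₁ := by
    have : 0 ≤ (1 - (2 : ℝ) ^ (-(c / 4)))⁻¹ := inv_nonneg.mpr (by linarith)
    rw [hC₁]
    positivity
  have hc0 : 0 < c := by rw [hc]; norm_num
  have hc1 : c ≤ 1 := by rw [hc]; norm_num
  refine ⟨C₁ + 10 ^ 12, c / 8, by positivity, by positivity,
    htriv.mono (by norm_num) (by linarith) (by linarith),
    htest.mono (by norm_num) (by linarith) (by linarith), fun d hd n i hn hi => ?_⟩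
  have hlen : 0 < (trivialAlgorithm (2 ^ d 1)).len := by
    simp [trivialAlgorithm, Machine.sub, census]
  have hn1 : (1 : ℝ) ≤ n := by exact_mod_cast hn.1
  have hp : 0 ≤ (n : ℝ) ^ (-(c / 8)) := by positivity
  have hT := htriv (2 ^ d 1) n hn
  have hTle : (800 : ℝ) * (n : ℝ) ^ (-1 : ℝ) ≤ 10 ^ 12 * (n : ℝ) ^ (-(c / 8)) := by
    gcongr
    · norm_num
    · linarith
  set G : Set (Coins n) := {ω | 2 ≤ i → GoodRun cd d trivialAlgorithm testNetworkSize ω i} with hG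
  have hGm : coinMeasure n Gᶜ ≤ ENNReal.ofReal (C₁ * (n : ℝ) ^ (-(c / 8))) := by
    by_cases hi2 : 2 ≤ i
    · rw [hC₁]
      refine le_trans (measure_mono fun ω hω => ?_)
        (coinMeasure_not_goodRun_le htest (by norm_num) hc0 hc1 hd hi2 hn.1 hi hlen)
      exact fun h => hω fun _ => h
    · have : Gᶜ = ∅ := Set.eq_empty_of_forall_notMem fun ω hω => hω fun h => absurd h hi2
      rw [this, measure_empty]
      exact zero_le
  rw [failureProb]
  calc _ ≤ coinMeasure n (Gᶜ ∪ _) := measure_mono fun ω hω => by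
        by_contra hno
        rw [Set.mem_union, not_or] at hno
        exact hω (GoodRun.solves hn.1 hd hi hlen (not_not.mp hno.2) (not_not.mp hno.1))
    _ ≤ ENNReal.ofReal (C₁ * (n : ℝ) ^ (-(c / 8))) + ENNReal.ofReal (800 * (n : ℝ) ^ (-1 : ℝ)) :=
      (measure_union_le _ _).trans (add_le_add hGm hT)
    _ ≤ _ := by
      rw [← ENNReal.ofReal_add (by positivity) (by positivity)]
      refine ENNReal.ofReal_le_ofReal ?_
      rw [add_mul]
      linarith

end RadioNetwork
end

/-! ### The iterated logarithm and special choices of checkpoints -/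

noncomputable section

open scoped unitInterval

namespace RadioNetwork

/-- The infimum drops by one if it is over a nonempty set. Nonemptiness is shown by induction on an
integer bound `k`, which decreases under the logarithm because `k + 1 ≤ 2 ^ k`. -/
theorem logStar_of_one_lt {x : ℝ} (hx : 1 < x) : logStar x = logStar (Real.logb 2 x) + 1 := by
  have hne : ∀ k : ℕ, ∀ y : ℝ, y ≤ k → {i | (Real.logb 2)^[i] y ≤ 1}.Nonempty := by
    intro k
    induction k with
    | zero => exact fun y hy => ⟨0, by simpa using hy.trans (by norm_num)⟩
    | succ k ih =>
      intro y hy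
      by_cases h2 : y ≤ 2
      · by_cases h1 : y ≤ 1
        · exact ⟨0, h1⟩
        · refine ⟨1, ?_⟩
          change Real.logb 2 y ≤ 1
          rw [Real.logb_le_iff_le_rpow (by norm_num) (by linarith), Real.rpow_one]
          exact h2
      · obtain ⟨i, hi⟩ := ih (Real.logb 2 y) (by
          rw [Real.logb_le_iff_le_rpow (by norm_num) (by linarith), Real.rpow_natCast]
          refine hy.trans ?_
          exact_mod_cast Nat.lt_two_pow_self)
        exact ⟨i + 1, hi⟩
  obtain ⟨k, hk⟩ := exists_nat_ge x
  have h0 : 0 ∉ {i | (Real.logb 2)^[i] x ≤ 1} := fun h => absurd hx (not_lt.mpr h)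
  have hpos : 1 ≤ logStar x := by
    by_contra h
    have h1 := Nat.sInf_mem (hne k x hk)
    rw [show sInf {i | (Real.logb 2)^[i] x ≤ 1} = 0 from (by omega : logStar x = 0)] at h1
    exact h0 h1
  rw [logStar, ← Nat.sInf_add hpos]
  rfl

/-- A sequence that grows at least as fast as iterated exponentiation bounds the iterated logarithm
from below. -/
theorem lt_logStar {t : ℕ → ℝ} (h0 : 1 ≤ t 0) (ht : ∀ j, (2 : ℝ) ^ t j ≤ t (j + 1)) (j : ℕ) {x : ℝ}
    (hx : t j < x) : j < logStar x := by
  induction j generalizing x with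
  | zero =>
    rw [logStar_of_one_lt (by linarith)]
    omega
  | succ j ih =>
    have h1 : (2 : ℝ) ^ t j < x := (ht j).trans_lt hx
    have hpos : (0 : ℝ) < 2 ^ t j := by positivity
    have ht1 : ∀ k, 1 ≤ t k := by
      intro k
      induction k with
      | zero => exact h0
      | succ k ihk => exact (Real.one_le_rpow (by norm_num) (by linarith)).trans (ht k)
    have h2 := ih ((Real.lt_logb_iff_rpow_lt (by norm_num) (by linarith)).mpr h1)
    rw [logStar_of_one_lt ((ht1 (j + 1)).trans_lt hx)]
    omega

theorem tendsto_logb_two : Tendsto (fun n : ℕ => Real.logb 2 n) atTop atTop :=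
  (Real.tendsto_logb_atTop (by norm_num)).comp tendsto_natCast_atTop_atTop

theorem tendsto_logb_logb_two : Tendsto (fun n : ℕ => Real.logb 2 (Real.logb 2 n)) atTop atTop :=
  (Real.tendsto_logb_atTop (by norm_num)).comp tendsto_logb_two

theorem le_two_rpow {x : ℝ} (hx : 0 ≤ x) : x ≤ 2 ^ x :=
  calc x ≤ (⌊x⌋₊ + 1 : ℕ) := by exact_mod_cast (Nat.lt_floor_add_one x).le
    _ ≤ (2 ^ ⌊x⌋₊ : ℕ) := by exact_mod_cast Nat.lt_two_pow_self
    _ = (2 : ℝ) ^ (⌊x⌋₊ : ℝ) := by rw [Real.rpow_natCast]; norm_cast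
    _ ≤ 2 ^ x := Real.rpow_le_rpow_of_exponent_le (by norm_num) (Nat.floor_le hx)

theorem tendsto_rpow_sub_rpow {a b : ℝ} (ha : 0 < a) (hab : a < b) :
    Tendsto (fun x : ℝ => x ^ b - x ^ a) atTop atTop := by
  have h := (tendsto_rpow_atTop ha).atTop_mul_atTop₀
    (tendsto_atTop_add_const_right _ (-1 : ℝ) (tendsto_rpow_atTop (sub_pos.mpr hab)))
  refine h.congr' ?_
  filter_upwards [eventually_gt_atTop 0] with x hx
  rw [mul_add, ← Real.rpow_add hx]
  ring_nf

/-- In terms of `y = x ^ ε` the left side is a power of `y` plus 2, the right side exponential in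
`y`. -/
theorem eventually_add_two_le_two_rpow {a ε : ℝ} (ha : 0 < a) (hε : 0 < ε) :
    ∀ᶠ x : ℝ in atTop, x + 2 ≤ 2 ^ (x ^ ε * a) := by
  have hlog : 0 < Real.log 2 := Real.log_pos (by norm_num)
  have h := (isLittleO_rpow_exp_pos_mul_atTop ε⁻¹ (mul_pos hlog ha)).bound
    (show (0 : ℝ) < 1 / 2 by norm_num)
  filter_upwards [(tendsto_rpow_atTop hε).eventually h, eventually_ge_atTop 2] with x hx h2
  rw [← Real.rpow_mul (by linarith), mul_inv_cancel₀ hε.ne', Real.rpow_one, Real.norm_of_nonneg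
    (by linarith), Real.norm_of_nonneg (Real.exp_pos _).le] at hx
  rw [Real.rpow_def_of_pos (by norm_num), show Real.log 2 * (x ^ ε * a) = Real.log 2 * a * x ^ ε by
    ring]
  linarith

/-- Once `A * y + A'` bounds the index, `y` gives the energy bound. -/
theorem CDModel.eventually_energy_le (cd : CDModel) {A C : ℝ} (hA : 0 ≤ A) (hC : 3020 * A + 3021 ≤ C)
    (A' K : ℝ) {y : ℕ → ℝ} (hy : Tendsto y atTop atTop) :
    ∀ᶠ n in atTop, ∀ i : ℕ, 1 ≤ i → (i : ℝ) ≤ A * y n + A' →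
      3020 * (cd.scale i + 1) + K ≤ C * cd.scale (y n) := by
  have hlog : Tendsto (fun n => Real.logb 2 (y n)) atTop atTop :=
    (Real.tendsto_logb_atTop (by norm_num)).comp hy
  filter_upwards [hy.eventually_ge_atTop (3020 * (A' + 1) + K), hy.eventually_ge_atTop (max A' 1),
    hlog.eventually_ge_atTop (3020 * (Real.logb 2 (A + 1) + 1) + K), hlog.eventually_ge_atTop 0]
    with n h1 h2 h3 h4 i hi hin
  have hA' := (le_max_left _ _).trans h2
  have hy1 := (le_max_right _ _).trans h2
  have hi1 : (1 : ℝ) ≤ i := by exact_mod_cast hi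
  rw [CDModel.scale, CDModel.scale]
  split_ifs with hcd
  · have h5 : Real.logb 2 i ≤ Real.logb 2 (A + 1) + Real.logb 2 (y n) := by
      rw [← Real.logb_mul (by positivity) (by positivity)]
      exact Real.logb_le_logb_of_le (by norm_num) (by linarith) (by linarith)
    have h6 : 3021 * Real.logb 2 (y n) ≤ C * Real.logb 2 (y n) := by
      gcongr
      linarith
    linarith
  · have h6 : (3020 * A + 3021) * y n ≤ C * y n := by gcongr
    linarith

theorem failureProb_mono {cd : CDModel} {alg : Device ℕ} {n : ℕ} {T T' E E' : ℝ} (hT : T ≤ T')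
    (hE : E ≤ E') : failureProb alg cd n T' E' ≤ failureProb alg cd n T E := by
  refine measure_mono fun ω hω hs => ?_
  obtain ⟨t, e, h1, h2, h3, h4⟩ := hs
  exact absurd ⟨t, e, h1.trans hT, h2, h3, fun i => ⟨(h4 i).1, (h4 i).2.trans hE⟩⟩ hω

theorem exists_isIndex {d : ℕ → ℕ} (hd : Admissible 4 d) (n : ℕ) : ∃ i, IsIndex d n i := by
  classical
  have hex : ∃ i, 1 ≤ i ∧ Real.logb 2 n ≤ d i := by
    obtain ⟨k, hk⟩ := exists_nat_ge (Real.logb 2 n)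
    have := hd.add_lt (i := k + 1) (by omega)
    exact ⟨k + 1, by omega, hk.trans (by exact_mod_cast (by omega : k ≤ d (k + 1)))⟩
  refine ⟨Nat.find hex, (Nat.find_spec hex).1, (Nat.find_spec hex).2, fun h2 => ?_⟩
  have := Nat.find_min hex (show Nat.find hex - 1 < Nat.find hex by omega)
  rw [not_and, not_le] at this
  exact this (by omega)

/-- Every function that eventually exceeds `4 x` generates an admissible sequence. -/
theorem exists_admissible {f : ℕ → ℝ} (hf : ∀ᶠ x : ℕ in atTop, 4 * (x : ℝ) ≤ f x) :
    ∃ d : ℕ → ℕ, Admissible 4 d ∧ ∀ i, 1 ≤ i → d (i + 1) = ⌈f (d i)⌉₊ := by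
  obtain ⟨N, hN⟩ := eventually_atTop.mp hf
  -- The sequence starts at `m`: 14 guarantees `√(2 ^ m) ≥ 128` and a small label sum, and beyond
  -- `N` the function grows by the factor 4.
  obtain ⟨m, hm⟩ : ∃ m, m = max N 14 := ⟨_, rfl⟩
  have hm14 : 14 ≤ m := hm ▸ le_max_right _ _
  have hmN : N ≤ m := hm ▸ le_max_left _ _
  set F : ℕ → ℕ := fun x => ⌈f x⌉₊ with hF
  have hle : ∀ k, m ≤ F^[k] m := by
    intro k
    induction k with
    | zero => exact le_rfl
    | succ k ih =>
      rw [Function.iterate_succ_apply']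
      have h1 := (hN _ (hmN.trans ih)).trans (Nat.le_ceil _)
      have h2 : 4 * F^[k] m ≤ F (F^[k] m) := by exact_mod_cast h1
      omega
  have hsucc : ∀ i, 1 ≤ i → F^[i + 1 - 1] m = ⌈f (F^[i - 1] m : ℕ)⌉₊ := by
    intro i hi
    rw [show i + 1 - 1 = (i - 1) + 1 by omega, Function.iterate_succ_apply']
  refine ⟨fun i => F^[i - 1] m, ⟨fun i hi => ?_, ?_, ?_⟩, hsucc⟩
  · rw [hsucc i hi]
    exact (hN _ (hmN.trans (hle _))).trans (Nat.le_ceil _)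
  · have h128 : (128 : ℝ) ≤ √(2 ^ m) := by
      rw [Real.le_sqrt (by norm_num) (by positivity)]
      calc (128 : ℝ) ^ 2 = 2 ^ 14 := by norm_num
        _ ≤ 2 ^ m := pow_le_pow_right₀ (by norm_num) hm14
    have h14 : (1.4 : ℝ) ≤ √2 := Real.le_sqrt_of_sq_le (by norm_num)
    have hterm : ∀ j : ℕ, 1 / √(2 ^ (m + j)) ≤ 1 / 128 * (1 / 1.4 : ℝ) ^ j := by
      intro j
      rw [pow_add, Real.sqrt_mul (by positivity), one_div_pow, one_div_mul_one_div]
      have : √((2 : ℝ) ^ j) = √2 ^ j := by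
        rw [Real.sqrt_eq_iff_mul_self_eq (by positivity) (by positivity), ← mul_pow,
          Real.mul_self_sqrt (by norm_num)]
      rw [this]
      gcongr
    have hgeo := (summable_geometric_of_lt_one (r := (1 / 1.4 : ℝ)) (by norm_num)
      (by norm_num)).mul_left (1 / 128)
    have hs : Summable fun j : ℕ => 1 / √((2 : ℝ) ^ (m + j)) :=
      Summable.of_nonneg_of_le (fun j => by positivity) hterm hgeo
    refine (hs.tsum_le_tsum hterm hgeo).trans ?_
    rw [tsum_mul_left, tsum_geometric_of_lt_one (by norm_num) (by norm_num)]
    norm_num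
  · change (100 : ℝ) ≤ √(2 ^ m)
    rw [Real.le_sqrt (by norm_num) (by positivity)]
    calc (100 : ℝ) ^ 2 ≤ 2 ^ 14 := by norm_num
      _ ≤ 2 ^ m := pow_le_pow_right₀ (by norm_num) hm14

/-- An eventual bound on time and energy at the index of `n` bounds the failure probability. -/
theorem eventually_failureProb_le {cd : CDModel} {d : ℕ → ℕ} {alg : Device ℕ} {C c K : ℝ}
    (hd : Admissible 4 d) (H : ∀ n i : ℕ, cd.Allows n → IsIndex d n i →
      failureProb alg cd n (30 * (d i : ℝ) ^ 2 + K) (3020 * (cd.scale i + 1) + K) ≤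
        ENNReal.ofReal (C * (n : ℝ) ^ (-c))) {T E : ℕ → ℝ}
    (hT : ∀ᶠ n in atTop, ∀ i, 2 ≤ i → IsIndex d n i → 30 * (d i : ℝ) ^ 2 + K ≤ T n)
    (hE : ∀ᶠ n in atTop, ∀ i, 2 ≤ i → IsIndex d n i → 3020 * (cd.scale i + 1) + K ≤ E n) :
    ∀ᶠ n : ℕ in atTop, failureProb alg cd n (T n) (E n) ≤ ENNReal.ofReal (C * (n : ℝ) ^ (-c)) := by
  -- Large `n` have an index of at least 2, so `d (i - 1) < log n` is available.
  filter_upwards [hT, hE, eventually_ge_atTop 2, tendsto_logb_two.eventually_gt_atTop (d 1 : ℝ)]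
    with n h1 h2 hn h3
  obtain ⟨i, hi⟩ := exists_isIndex hd n
  have hi2 : 2 ≤ i := by
    by_contra hlt
    have : i = 1 := by have := hi.1; omega
    exact absurd hi.2.1 (not_le.mpr (this ▸ h3))
  exact (failureProb_mono (h1 i hi2 hi) (h2 i hi2 hi)).trans (H n i ⟨by omega, fun _ => hn⟩ hi)

section geometric

variable {d : ℕ → ℕ} {g : ℝ}

theorem IsIndex.le_of_geometric (hd : Admissible 4 d) {n i : ℕ} (hi2 : 2 ≤ i) (hi : IsIndex d n i) :
    (i : ℝ) ≤ 1 * Real.logb 2 (Real.logb 2 n) + 2 := by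
  have hpow : ∀ k, 1 ≤ k → 2 ^ (k - 1) ≤ d k := by
    intro k hk
    induction k, hk using Nat.le_induction with
    | base => exact hd.first.le.trans' (by norm_num)
    | succ k hk ih =>
      have h1 := hd.four_mul_le hk
      rw [show k + 1 - 1 = (k - 1) + 1 by omega, pow_succ]
      omega
  have h1 : (2 : ℝ) ^ (i - 2) ≤ d (i - 1) := by exact_mod_cast hpow (i - 1) (by omega)
  have h2 := h1.trans (hi.2.2 hi2).le
  have h3 : ((i - 2 : ℕ) : ℝ) ≤ Real.logb 2 (Real.logb 2 n) := by
    rw [Real.le_logb_iff_rpow_le (by norm_num) (h2.trans_lt' (by positivity)), Real.rpow_natCast]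
    exact h2
  rw [Nat.cast_sub hi2] at h3
  push_cast at h3
  linarith

theorem eventually_time_le_of_geometric (hg : 4 ≤ g)
    (hstep : ∀ i, 1 ≤ i → d (i + 1) = ⌈g * d i⌉₊) (K : ℝ) :
    ∀ᶠ n : ℕ in atTop, ∀ i, 2 ≤ i → IsIndex d n i →
      30 * (d i : ℝ) ^ 2 + K ≤ (30 * (g + 1) ^ 2 + 1) * Real.logb 2 n ^ 2 := by
  filter_upwards [tendsto_logb_two.eventually_ge_atTop (max K 1)] with n hn i hi2 hi
  have hK := (le_max_left _ _).trans hn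
  have h1 := (le_max_right _ _).trans hn
  have h2 : (d i : ℝ) ≤ (g + 1) * Real.logb 2 n := by
    have h3 := hstep (i - 1) (by omega)
    rw [show i - 1 + 1 = i by omega] at h3
    rw [h3]
    refine (Nat.ceil_lt_add_one (by positivity)).le.trans ?_
    have h4 : g * d (i - 1) ≤ g * Real.logb 2 n := by
      have := hi.2.2 hi2
      gcongr
    linarith
  have h3 : (d i : ℝ) ^ 2 ≤ ((g + 1) * Real.logb 2 n) ^ 2 := by gcongr
  nlinarith

end geometric

section polynomial

variable {d : ℕ → ℕ} {p : ℝ}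

/-- Iterating gives `log d_k ≥ p ^ (k - 1)`, so `p ^ (i - 2) ≤ log log n`; then `log p ≥ (p - 1) /
p` bounds `i` with the right dependence on `p`. -/
theorem IsIndex.le_of_polynomial (hd : Admissible 4 d) (hp : 1 < p)
    (hstep : ∀ i, 1 ≤ i → d (i + 1) = ⌈(d i : ℝ) ^ p⌉₊) {n i : ℕ} (hi2 : 2 ≤ i)
    (hi : IsIndex d n i) :
    (i : ℝ) ≤ p / (p - 1) * Real.logb 2 (Real.logb 2 (Real.logb 2 n)) + 2 := by
  have hpow : ∀ k, 1 ≤ k → p ^ (k - 1) ≤ Real.logb 2 (d k) := by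
    intro k hk
    induction k, hk using Nat.le_induction with
    | base =>
      have := hd.first
      exact one_le_logb_two (by exact_mod_cast (by omega : 2 ≤ d 1))
    | succ k hk ih =>
      have h0 : (0 : ℝ) < d k := by exact_mod_cast (hd.add_lt hk).trans_le' (Nat.zero_le _)
      rw [show k + 1 - 1 = (k - 1) + 1 by omega, pow_succ, hstep k hk]
      calc p ^ (k - 1) * p ≤ Real.logb 2 (d k) * p := by gcongr
        _ = Real.logb 2 ((d k : ℝ) ^ p) := by rw [Real.logb_rpow_eq_mul_logb_of_pos h0, mul_comm]
        _ ≤ _ := Real.logb_le_logb_of_le (by norm_num) (by positivity) (Nat.le_ceil _)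
  have hlt := hi.2.2 hi2
  have h0 : (0 : ℝ) < d (i - 1) := by
    exact_mod_cast (hd.add_lt (i := i - 1) (by omega)).trans_le' (Nat.zero_le _)
  have h1 : p ^ (i - 2) ≤ Real.logb 2 (Real.logb 2 n) :=
    (hpow (i - 1) (by omega)).trans (Real.logb_le_logb_of_le (by norm_num) h0 hlt.le)
  have hp0 : 0 < p ^ (i - 2) := by positivity
  have h2 : ((i - 2 : ℕ) : ℝ) * Real.logb 2 p ≤ Real.logb 2 (Real.logb 2 (Real.logb 2 n)) := by
    rw [← Real.logb_pow]
    exact Real.logb_le_logb_of_le (by norm_num) hp0 h1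
  have h3 : (p - 1) / p ≤ Real.logb 2 p := by
    refine le_trans ?_ (log_le_logb_two hp.le)
    have := Real.one_sub_inv_le_log_of_pos (show 0 < p by linarith)
    rwa [show (p - 1) / p = 1 - p⁻¹ by field_simp]
  have h4 : ((i - 2 : ℕ) : ℝ) * ((p - 1) / p) ≤ Real.logb 2 (Real.logb 2 (Real.logb 2 n)) :=
    h2.trans' (by gcongr)
  have h5 : ((i - 2 : ℕ) : ℝ) ≤ p / (p - 1) * Real.logb 2 (Real.logb 2 (Real.logb 2 n)) := by
    have hp1 : 0 < p - 1 := by linarith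
    calc ((i - 2 : ℕ) : ℝ) = p / (p - 1) * (((i - 2 : ℕ) : ℝ) * ((p - 1) / p)) := by
          field_simp
      _ ≤ _ := by gcongr
  rw [Nat.cast_sub hi2] at h5
  push_cast at h5
  linarith

theorem eventually_time_le_of_polynomial (hp : 1 < p)
    (hstep : ∀ i, 1 ≤ i → d (i + 1) = ⌈(d i : ℝ) ^ p⌉₊) (K : ℝ) :
    ∀ᶠ n : ℕ in atTop, ∀ i, 2 ≤ i → IsIndex d n i →
      30 * (d i : ℝ) ^ 2 + K ≤ 121 * Real.logb 2 n ^ (2 * p) := by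
  filter_upwards [tendsto_logb_two.eventually_ge_atTop (max K 1)] with n hn i hi2 hi
  have hK := (le_max_left _ _).trans hn
  have h1 := (le_max_right _ _).trans hn
  set L := Real.logb 2 n
  have hL : L ≤ L ^ (2 * p) := by
    calc L = L ^ (1 : ℝ) := (Real.rpow_one _).symm
      _ ≤ L ^ (2 * p) := Real.rpow_le_rpow_of_exponent_le h1 (by linarith)
  have h2 : (d i : ℝ) ≤ 2 * L ^ p := by
    have h3 := hstep (i - 1) (by omega)
    rw [show i - 1 + 1 = i by omega] at h3
    rw [h3]
    refine (Nat.ceil_lt_add_one (by positivity)).le.trans ?_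
    have h4 : (d (i - 1) : ℝ) ^ p ≤ L ^ p :=
      Real.rpow_le_rpow (by positivity) (hi.2.2 hi2).le (by linarith)
    have h5 : 1 ≤ L ^ p := Real.one_le_rpow h1 (by linarith)
    linarith
  have h3 : (d i : ℝ) ^ 2 ≤ (2 * L ^ p) ^ 2 := by gcongr
  have h4 : (2 * L ^ p) ^ 2 = 4 * L ^ (2 * p) := by
    rw [mul_pow, ← Real.rpow_natCast (L ^ p), ← Real.rpow_mul (by linarith), mul_comm p]
    norm_num
  linarith

end polynomial

section doubleExponential

variable {d : ℕ → ℕ} {ε ε' : ℝ}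

/-- Two steps beat one exponentiation. With `l = log d_i`, the first step gives `log d_(i+1) ≥ 2 ^
(l ^ ε)`, whose power `ε` eventually exceeds `l`; so the second step reaches `2 ^ (2 ^ l) = 2 ^
d_i`. -/
theorem exists_two_rpow_le (hd : Admissible 4 d) (hε : 0 < ε)
    (hstep : ∀ i, 1 ≤ i → d (i + 1) = ⌈(2 : ℝ) ^ (2 : ℝ) ^ (Real.logb 2 (d i)) ^ ε⌉₊) :
    ∃ i₀, 1 ≤ i₀ ∧ ∀ i, i₀ ≤ i → (2 : ℝ) ^ (d i : ℝ) ≤ d (i + 2) := by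
  obtain ⟨N, hN⟩ := eventually_atTop.mp
    (tendsto_logb_two.eventually (eventually_add_two_le_two_rpow hε hε))
  refine ⟨N + 1, by omega, fun i hi => ?_⟩
  have hdi := hd.add_lt (i := i) (by omega)
  have h1 := hN (d i) (by omega)
  set l := Real.logb 2 (d i)
  have hd0 : (1 : ℝ) ≤ d i := by exact_mod_cast (by omega : 1 ≤ d i)
  have hl : 0 ≤ l := Real.logb_nonneg (by norm_num) hd0
  have h2 : (2 : ℝ) ^ l ^ ε ≤ Real.logb 2 (d (i + 1)) := by
    rw [hstep i (by omega), Real.le_logb_iff_rpow_le (by norm_num)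
      ((Nat.le_ceil _).trans_lt' (by positivity))]
    exact Nat.le_ceil _
  have h3 : l ≤ (Real.logb 2 (d (i + 1))) ^ ε := by
    refine le_trans ?_ (Real.rpow_le_rpow (by positivity) h2 hε.le)
    rw [← Real.rpow_mul (by norm_num)]
    linarith
  rw [hstep (i + 1) (by omega)]
  refine le_trans ?_ (Nat.le_ceil _)
  refine Real.rpow_le_rpow_of_exponent_le (by norm_num) ?_
  calc (d i : ℝ) = 2 ^ l := (Real.rpow_logb (by norm_num) (by norm_num) (by linarith)).symm
    _ ≤ _ := Real.rpow_le_rpow_of_exponent_le (by norm_num) h3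

theorem tendsto_logStar : Tendsto (fun n : ℕ => (logStar n : ℝ)) atTop atTop := by
  refine tendsto_natCast_atTop_atTop.comp (tendsto_atTop.mpr fun k => ?_)
  set t : ℕ → ℝ := fun j => (fun x : ℝ => (2 : ℝ) ^ x)^[j] 1 with ht
  filter_upwards [tendsto_natCast_atTop_atTop.eventually_gt_atTop (t k)] with n hn
  exact (lt_logStar (t := t) le_rfl (fun j => by
    rw [ht]
    simp only [Function.iterate_succ_apply']
    exact le_rfl) k hn).le

theorem exists_isIndex_le_logStar (hd : Admissible 4 d) (hε : 0 < ε)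
    (hstep : ∀ i, 1 ≤ i → d (i + 1) = ⌈(2 : ℝ) ^ (2 : ℝ) ^ (Real.logb 2 (d i)) ^ ε⌉₊) :
    ∃ A' : ℝ, ∀ n i : ℕ, 2 ≤ i → IsIndex d n i → (i : ℝ) ≤ 2 * logStar n + A' := by
  obtain ⟨i₀, hi₀, h⟩ := exists_two_rpow_le hd hε hstep
  refine ⟨i₀, fun n i hi2 hi => ?_⟩
  by_cases hle : i ≤ i₀
  · have : (i : ℝ) ≤ i₀ := by exact_mod_cast hle
    have : (0 : ℝ) ≤ logStar n := by positivity
    linarith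
  · have hd0 := hd.add_lt hi₀
    -- The subsequence of every second checkpoint from `i₀` on grows like a tower. Its last member
    -- up to `i - 1` is below `log n`, and the crude bound `log n ≤ n` suffices.
    have h1 : ((d (i₀ + 2 * ((i - 1 - i₀) / 2)) : ℕ) : ℝ) < n := by
      have h2 : ((d (i₀ + 2 * ((i - 1 - i₀) / 2)) : ℕ) : ℝ) ≤ d (i - 1) := by
        exact_mod_cast hd.monotone (by omega) (by omega)
      have hn : 0 < n := by
        by_contra h0
        have h3 := hi.2.2 hi2
        rw [show n = 0 by omega, Nat.cast_zero, Real.logb_zero] at h3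
        exact absurd h3 (not_lt.mpr (Nat.cast_nonneg _))
      have h3 : Real.logb 2 n ≤ n := by
        rw [Real.logb_le_iff_le_rpow (by norm_num) (by exact_mod_cast hn), Real.rpow_natCast]
        exact_mod_cast Nat.lt_two_pow_self.le
      exact (h2.trans_lt (hi.2.2 hi2)).trans_le h3
    have h2 := lt_logStar (t := fun j => ((d (i₀ + 2 * j) : ℕ) : ℝ))
      (by exact_mod_cast (by simp; omega : 1 ≤ d (i₀ + 2 * 0)))
      (fun j => h (i₀ + 2 * j) (by omega)) _ h1
    exact_mod_cast (by omega : i ≤ 2 * logStar n + i₀)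

/-- With `u = 2 ^ (L ^ ε)` and `L = log log n`, the checkpoint is at most `2 * 2 ^ u`. The remaining
factors make it `2 ^ (7 + 2 * u) ≤ 2 ^ (16 * u)`, and `16 * u` is absorbed as soon as `L ^ ε'`
exceeds `L ^ ε` by 4. -/
theorem eventually_time_le_of_doubleExponential (hε : 0 < ε) (hεε : ε < ε')
    (hstep : ∀ i, 1 ≤ i → d (i + 1) = ⌈(2 : ℝ) ^ (2 : ℝ) ^ (Real.logb 2 (d i)) ^ ε⌉₊)
    (hd : Admissible 4 d) (K : ℝ) :
    ∀ᶠ n : ℕ in atTop, ∀ i, 2 ≤ i → IsIndex d n i →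
      30 * (d i : ℝ) ^ 2 + K ≤ (2 : ℝ) ^ (2 : ℝ) ^ (Real.logb 2 (Real.logb 2 n)) ^ ε' := by
  filter_upwards [tendsto_logb_logb_two.eventually
      ((tendsto_rpow_sub_rpow hε hεε).eventually_ge_atTop 4),
    tendsto_logb_logb_two.eventually_ge_atTop 0,
    tendsto_logb_logb_two.eventually ((tendsto_rpow_atTop hε).eventually_ge_atTop K)]
    with n h1 h2 h3 i hi2 hi
  set L := Real.logb 2 (Real.logb 2 n)
  set s := L ^ ε
  have hs : 0 ≤ s := Real.rpow_nonneg h2 _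
  have hu : s ≤ 2 ^ s := le_two_rpow hs
  set u : ℝ := 2 ^ s with hu'
  have hu1 : 1 ≤ u := Real.one_le_rpow (by norm_num) hs
  have hv : 16 * u ≤ 2 ^ L ^ ε' := by
    calc 16 * u = 2 ^ (4 + s) := by rw [Real.rpow_add (by norm_num), hu']; norm_num
      _ ≤ _ := Real.rpow_le_rpow_of_exponent_le (by norm_num) (by linarith)
  have hlow : (13 : ℝ) < d (i - 1) := by
    exact_mod_cast hd.first.trans_le (hd.monotone le_rfl (by omega))
  have hw : (2 : ℝ) ^ (Real.logb 2 (d (i - 1))) ^ ε ≤ u := by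
    refine Real.rpow_le_rpow_of_exponent_le (by norm_num) (Real.rpow_le_rpow ?_ ?_ hε.le)
    · exact Real.logb_nonneg (by norm_num) (by linarith)
    · exact Real.logb_le_logb_of_le (by norm_num) (by linarith) (hi.2.2 hi2).le
  have hU : 1 ≤ (2 : ℝ) ^ u := Real.one_le_rpow (by norm_num) (by linarith)
  have hd2 : (d i : ℝ) ≤ 2 * 2 ^ u := by
    have h5 := hstep (i - 1) (by omega)
    rw [show i - 1 + 1 = i by omega] at h5
    rw [h5]
    refine (Nat.ceil_lt_add_one (by positivity)).le.trans ?_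
    have h6 := Real.rpow_le_rpow_of_exponent_le (show (1 : ℝ) ≤ 2 by norm_num) hw
    linarith
  have hK : K ≤ 2 ^ u := h3.trans (hu.trans (le_two_rpow (by linarith)))
  calc 30 * (d i : ℝ) ^ 2 + K ≤ 30 * (2 * 2 ^ u) ^ 2 + 2 ^ u := by gcongr
    _ ≤ 2 ^ 7 * ((2 : ℝ) ^ u) ^ 2 := by nlinarith
    _ = (2 : ℝ) ^ (7 + u * 2) := by
      rw [Real.rpow_add (by norm_num), Real.rpow_mul (by norm_num)]
      norm_num
    _ ≤ _ := Real.rpow_le_rpow_of_exponent_le (by norm_num) (by linarith)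

theorem eventually_two_rpow_two_rpow_le (hε' : 0 < ε') (hε1 : ε' < 1) {δ : ℝ} (hδ : 0 < δ) :
    ∀ᶠ n : ℕ in atTop,
      (2 : ℝ) ^ (2 : ℝ) ^ (Real.logb 2 (Real.logb 2 n)) ^ ε' ≤ (n : ℝ) ^ δ := by
  filter_upwards [tendsto_logb_logb_two.eventually
      ((tendsto_rpow_sub_rpow hε' hε1).eventually_ge_atTop (-Real.logb 2 δ)),
    eventually_gt_atTop 0, tendsto_logb_two.eventually_gt_atTop 0] with n h1 hn hl
  set L := Real.logb 2 n with hL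
  have hn0 : (0 : ℝ) < n := by exact_mod_cast hn
  rw [Real.rpow_one] at h1
  calc (2 : ℝ) ^ (2 : ℝ) ^ (Real.logb 2 L) ^ ε' ≤ 2 ^ (δ * L) := by
        refine Real.rpow_le_rpow_of_exponent_le (by norm_num) ?_
        calc (2 : ℝ) ^ (Real.logb 2 L) ^ ε' ≤ 2 ^ (Real.logb 2 δ + Real.logb 2 L) :=
              Real.rpow_le_rpow_of_exponent_le (by norm_num) (by linarith)
          _ = δ * L := by
            rw [Real.rpow_add (by norm_num), Real.rpow_logb (by norm_num) (by norm_num) hδ,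
              Real.rpow_logb (by norm_num) (by norm_num) hl]
    _ = (n : ℝ) ^ δ := by
      rw [mul_comm, Real.rpow_mul (by norm_num), hL, Real.rpow_logb (by norm_num) (by norm_num) hn0]

theorem eventually_four_mul_le_of_doubleExponential (hε : 0 < ε) :
    ∀ᶠ x : ℕ in atTop, 4 * (x : ℝ) ≤ (2 : ℝ) ^ (2 : ℝ) ^ (Real.logb 2 x) ^ ε := by
  filter_upwards [tendsto_logb_two.eventually (eventually_add_two_le_two_rpow one_pos hε),
    eventually_gt_atTop 0] with x h1 h0
  rw [mul_one] at h1
  calc 4 * (x : ℝ) = 2 ^ (Real.logb 2 x + 2) := by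
        rw [Real.rpow_add (by norm_num), Real.rpow_logb (by norm_num) (by norm_num)
          (by exact_mod_cast h0)]
        norm_num
        ring
    _ ≤ _ := Real.rpow_le_rpow_of_exponent_le (by norm_num) h1

theorem eventually_four_mul_le_rpow {p : ℝ} (hp : 1 < p) :
    ∀ᶠ x : ℕ in atTop, 4 * (x : ℝ) ≤ (x : ℝ) ^ p := by
  filter_upwards [tendsto_natCast_atTop_atTop.eventually
    ((tendsto_rpow_atTop (sub_pos.mpr hp)).eventually_ge_atTop 4), eventually_gt_atTop 0] with x h1 h0
  have h0' : (0 : ℝ) < x := by exact_mod_cast h0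
  calc 4 * (x : ℝ) ≤ (x : ℝ) ^ (p - 1) * x := by gcongr
    _ = _ := by rw [← Real.rpow_add_one h0'.ne', sub_add_cancel]

end doubleExponential

end RadioNetwork
end

/-! ### Assembly of the theorem -/

theorem mainTheorem7 (cd : CDModel) :
    ∃ (γ C c : ℝ) (K : ℕ → ℝ) (triv : ℕ → Subroutine (Option ℕ)) (test : ℝ → Subroutine Bool),
      1 < γ ∧ 0 < C ∧ 0 < c ∧ TrivialSpec cd triv C c ∧ TestSpec cd test C c ∧
      -- arbitrary checkpoints
      (∀ d : ℕ → ℕ, Admissible γ d → ∀ n i : ℕ, cd.Allows n → IsIndex d n i →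
        failureProb (estimateNetworkSize cd d triv test) cd n
            (C * (d i : ℝ) ^ 2 + K (d 1))
            (C * (cd.scale i + invAck (d i)) + K (d 1))
          ≤ ENNReal.ofReal (C * (n : ℝ) ^ (-c))) ∧
      -- time `n ^ o(1)`
      (∃ C₁ : ℝ, ∀ ε : ℝ, 0 < ε → ε < 1 →
        (∃ d : ℕ → ℕ, Admissible γ d ∧
          ∀ i, 1 ≤ i → d (i + 1) = ⌈(2 : ℝ) ^ (2 : ℝ) ^ (Real.logb 2 (d i)) ^ ε⌉₊) ∧
        ∀ ε' : ℝ, ε < ε' → ε' < 1 →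
          (∀ δ : ℝ, 0 < δ → ∀ᶠ n : ℕ in atTop,
            (2 : ℝ) ^ (2 : ℝ) ^ (Real.logb 2 (Real.logb 2 n)) ^ ε' ≤ (n : ℝ) ^ δ) ∧
          ∀ d : ℕ → ℕ, Admissible γ d →
            (∀ i, 1 ≤ i → d (i + 1) = ⌈(2 : ℝ) ^ (2 : ℝ) ^ (Real.logb 2 (d i)) ^ ε⌉₊) →
            ∀ᶠ n : ℕ in atTop,
              failureProb (estimateNetworkSize cd d triv test) cd n
                  ((2 : ℝ) ^ (2 : ℝ) ^ (Real.logb 2 (Real.logb 2 n)) ^ ε')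
                  (C₁ * cd.scale (logStar n))
                ≤ ENNReal.ofReal (C * (n : ℝ) ^ (-c))) ∧
      -- time `O((log n) ^ (2 + ε))`
      (∀ B : ℝ, 0 < B → ∃ C₂ : ℝ, ∀ ε : ℝ, 0 < ε → ε ≤ B →
        (∃ d : ℕ → ℕ, Admissible γ d ∧
          ∀ i, 1 ≤ i → d (i + 1) = ⌈(d i : ℝ) ^ (1 + ε / 2)⌉₊) ∧
        ∀ d : ℕ → ℕ, Admissible γ d →
          (∀ i, 1 ≤ i → d (i + 1) = ⌈(d i : ℝ) ^ (1 + ε / 2)⌉₊) →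
          ∀ᶠ n : ℕ in atTop,
            failureProb (estimateNetworkSize cd d triv test) cd n
                (C₂ * Real.logb 2 n ^ (2 + ε))
                (C₂ * cd.scale (ε⁻¹ * Real.logb 2 (Real.logb 2 (Real.logb 2 n))))
              ≤ ENNReal.ofReal (C * (n : ℝ) ^ (-c))) ∧
      -- time `O((log n) ^ 2)`
      (∀ g : ℝ, γ ≤ g → ∃ C₃ : ℝ,
        (∃ d : ℕ → ℕ, Admissible γ d ∧ ∀ i, 1 ≤ i → d (i + 1) = ⌈g * d i⌉₊) ∧
        ∀ d : ℕ → ℕ, Admissible γ d → (∀ i, 1 ≤ i → d (i + 1) = ⌈g * d i⌉₊) →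
          ∀ᶠ n : ℕ in atTop,
            failureProb (estimateNetworkSize cd d triv test) cd n
                (C₃ * Real.logb 2 n ^ 2)
                (C₃ * cd.scale (Real.logb 2 (Real.logb 2 n)))
              ≤ ENNReal.ofReal (C * (n : ℝ) ^ (-c))) := by
  obtain ⟨C₀, c, hC₀, hc, htriv, htest, H⟩ := exists_failureProb_le cd
  -- Large enough for 30 in the time and 3020 in the energy. The additive 1 in the energy is
  -- absorbed by `invAck (d i) ≥ 1`, which matters when `log i = 0`.
  obtain ⟨C, hC⟩ : ∃ C, C = C₀ + 6040 := ⟨_, rfl⟩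
  have H' : ∀ d : ℕ → ℕ, Admissible 4 d → ∀ n i : ℕ, cd.Allows n → IsIndex d n i →
      failureProb (estimateNetworkSize cd d trivialAlgorithm testNetworkSize) cd n
          (30 * (d i : ℝ) ^ 2 + (trivialAlgorithm (2 ^ d 1)).len)
          (3020 * (cd.scale i + 1) + (trivialAlgorithm (2 ^ d 1)).len)
        ≤ ENNReal.ofReal (C * (n : ℝ) ^ (-c)) := fun d hd n i hn hi =>
    (H d hd n i hn hi).trans (ENNReal.ofReal_le_ofReal (by gcongr; linarith))
  refine ⟨4, C, c, fun k => (trivialAlgorithm (2 ^ k)).len, trivialAlgorithm, testNetworkSize,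
    by norm_num, by linarith, hc, htriv.mono hC₀.le (by linarith) le_rfl,
    htest.mono hC₀.le (by linarith) le_rfl, fun d hd n i hn hi => ?_,
    ⟨3020 * 2 + 3021, fun ε hε hε1 =>
      ⟨exists_admissible (eventually_four_mul_le_of_doubleExponential hε), fun ε' hεε hε'1 =>
        ⟨fun δ hδ => eventually_two_rpow_two_rpow_le (hε.trans hεε) hε'1 hδ,
          fun d hd hstep => ?_⟩⟩⟩,
    fun B hB => ⟨3020 * (2 + B) + 3021, fun ε hε hεB =>
      ⟨exists_admissible (eventually_four_mul_le_rpow (by linarith)), fun d hd hstep => ?_⟩⟩,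
    fun g hg => ⟨(30 * (g + 1) ^ 2 + 1) + 6041,
      exists_admissible (.of_forall fun x => mul_le_mul_of_nonneg_right hg x.cast_nonneg), fun d hd hstep => ?_⟩⟩
  · refine (failureProb_mono ?_ ?_).trans (H' d hd n i hn hi)
    · gcongr
      linarith
    · have h1 : (1 : ℝ) ≤ invAck (d i) := by
        have := hd.add_lt hi.1
        exact_mod_cast one_le_invAck (by omega)
      have h2 : 0 ≤ cd.scale i := cd.scale_nonneg (by exact_mod_cast hi.1)
      have h3 : 3020 * (cd.scale i + 1) ≤ C * (cd.scale i + invAck (d i)) := by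
        gcongr
        all_goals linarith
      linarith
  · obtain ⟨A', hA'⟩ := exists_isIndex_le_logStar hd hε hstep
    refine eventually_failureProb_le hd (H' d hd)
      (eventually_time_le_of_doubleExponential hε hεε hstep hd _) ?_
    filter_upwards [cd.eventually_energy_le zero_le_two le_rfl A' _ tendsto_logStar]
      with n hn i hi2 hi
    exact hn i (by omega) (hA' n i hi2 hi)
  · have hp : 1 < 1 + ε / 2 := by linarith
    have hy : Filter.Tendsto (fun n : ℕ => Real.logb 2 (Real.logb 2 (Real.logb 2 n))) Filter.atTop
        Filter.atTop := (Real.tendsto_logb_atTop (by norm_num)).comp tendsto_logb_logb_two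
    refine eventually_failureProb_le hd (H' d hd) ?_ ?_
    · filter_upwards [eventually_time_le_of_polynomial hp hstep (trivialAlgorithm (2 ^ d 1)).len,
        tendsto_logb_two.eventually_ge_atTop 0] with n hn hL i hi2 hi
      refine (hn i hi2 hi).trans ?_
      rw [show 2 * (1 + ε / 2) = 2 + ε by ring]
      gcongr
      linarith
    · filter_upwards [cd.eventually_energy_le (show 0 ≤ 2 + B by linarith) le_rfl 2
        (trivialAlgorithm (2 ^ d 1)).len (hy.const_mul_atTop (inv_pos.mpr hε)),
        hy.eventually_ge_atTop 0] with n hn hL i hi2 hi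
      refine hn i (by omega) ((hi.le_of_polynomial hd hp hstep hi2).trans ?_)
      rw [← mul_assoc]
      gcongr
      -- For `p = 1 + ε / 2` the factor `p / (p - 1)` equals `(2 + ε) / ε`, at most `(2 + B) * ε⁻¹`;
      -- this is where the bound on `ε` enters the energy constant.
      rw [← div_eq_mul_inv, div_le_div_iff₀ (by linarith) hε]
      nlinarith
  · refine eventually_failureProb_le hd (H' d hd) ?_ ?_
    · filter_upwards [eventually_time_le_of_geometric hg hstep (trivialAlgorithm (2 ^ d 1)).len]
        with n hn i hi2 hi
      refine (hn i hi2 hi).trans ?_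
      gcongr <;> norm_num
    · filter_upwards [cd.eventually_energy_le zero_le_one
        (show 3020 * 1 + 3021 ≤ 30 * (g + 1) ^ 2 + 1 + 6041 by nlinarith [sq_nonneg (g + 1)]) 2
        (trivialAlgorithm (2 ^ d 1)).len tendsto_logb_logb_two] with n hn i hi2 hi
      exact hn i (by omega) (hi.le_of_geometric hd hi2)
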